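/- Let $I=(0,1)$ or $I=(0,\infty)$ with Lebesgue measure $m$, and let $L^0(I)$ be the space of (classes of) measurable real functions on $I$. For $x\in L^0(I)$ put $d_x(\lambda)=m\{t\in I:|x(t)|>\lambda\}$, $x^*(t)=\inf\{\lambda>0:d_x(\lambda)<t\}$ and $x^{**}(t)=\frac1t\int_0^t x^*(s)\,ds$. A symmetric space on $I$ is a Banach space $E\subset L^0(I)$ such that: if $y\in E$, $x\in L^0(I)$ and $|x|\le|y|$ a.e., then $x\in E$ and $\|x\|_E\le\|y\|_E$; every measurable set of positive measure has a subset $B$ of finite positive measure with $\chi_B\in E$; and if $x\in E$, $y\in L^0(I)$ and $d_x=d_y$, then $y\in E$ and $\|y\|_E=\|x\|_E$. It has the Fatou property if $0\le x_n\uparrow x\in L^0(I)$ a.e., $x_n\in E$ and $\sup_n\|x_n\|_E<\infty$ imply $x\in E$ and $\|x_n\|_E\uparrow\|x\|_E$. With $D_sx(t)=x(t/s)\chi_I(t/s)$, its Boyd indices are $$\alpha_E=\lim_{s\to0^+}\frac{\ln\|D_s\|_{E\to E}}{\ln s},\qquad \beta_E=\lim_{s\to\infty}\frac{\ln\|D_s\|_{E\to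 E}}{\ln s}.$$ For spaces $E,F\subset L^0(I)$ with (quasi-)norms, $E\odot F=\{xy:x\in E,\ y\in F\}$ with $\|z\|_{E\odot F}=\inf\{\|x\|_E\|y\|_F: z=xy,\ x\in E,\ y\in F\}$, and $M(E,F)=\{x\in L^0(I): xy\in F\text{ for each }y\in E\}$ with $\|x\|_{M(E,F)}=\sup_{\|y\|_E=1}\|xy\|_F$. An equality $E=F$ of spaces means that they consist of the same elements and that their (quasi-)norms are equivalent. Let $\phi:I\to(0,\infty)$ be non-decreasing and concave. Put $m_{\phi,I}(t)=\sup_{s\in I,\,st\in I}\frac{\phi(st)}{\phi(s)}$, $$p_{\phi,I}=\lim_{t\to0^+}\frac{\ln m_{\phi,I}(t)}{\ln t},\qquad q_{\phi,I}=\lim_{t\to\infty}\frac{\ln m_{\phi,I}(t)}{\ln t},$$ and let $M_\phi$, $M_\phi^*$, $\Lambda_\phi$, $\Lambda_{\phi,1}$ consist of those $x\in L^0(I)$ for which, respectively, $\|x\|_{M_\phi}=\sup_{t\in I}\phi(t)x^{**}(t)$, $\|x\|_{M_\phi^*}=\sup_{t\in I}\phi(t)x^*(t)$, $\|x\|_{\Lambda_\phi}=\phi(0^+)\|x\|_{L^\infty(I)}+\int_Ix^*(t)\phi'(t)\,dt$,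 $\|x\|_{\Lambda_{\phi,1}}=\int_Ix^*(t)\frac{\phi(t)}{t}\,dt$ is finite. Theorem. Suppose that $0<p_{\phi,I}\le q_{\phi,I}<1$. (a) If $F$ is a symmetric space on $I$ with $\alpha_F>q_{\phi,I}$ and $M(M_\phi^*,F)\ne\{0\}$, then $$F=M_\phi^*\odot M(M_\phi^*,F)=M_\phi\odot M(M_\phi,F).$$ (b) If $E$ is a symmetric space on $I$ with the Fatou property, $0<\alpha_E\le\beta_E<p_{\phi,I}$ and $M(E,\Lambda_\phi)\ne\{0\}$, then $$\Lambda_{\phi,1}=E\odot M(E,\Lambda_\phi).$$ -/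

import Mathlib

open MeasureTheory Filter Topology Set
open scoped ENNReal NNReal

noncomputable section

/-- The two admissible base intervals, `(0, 1)` and `(0, ∞)`. -/
inductive BaseInterval
  | unit
  | halfLine

namespace BaseInterval

/-- The interval as a set of real numbers. -/
def set : BaseInterval → Set ℝ
  | unit => Ioo 0 1
  | halfLine => Ioi 0

theorem measurableSet_set (I : BaseInterval) : MeasurableSet I.set := by
  cases I
  · exact measurableSet_Ioo
  · exact measurableSet_Ioi

/-- Lebesgue measure on the interval. -/
def measure (I : BaseInterval) : Measure ℝ := volume.restrict I.set

end BaseInterval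

/-- `L⁰(I)`: classes of measurable real functions on `I` modulo equality almost everywhere. -/
abbrev L0 (I : BaseInterval) : Type := ℝ →ₘ[I.measure] ℝ

variable {I : BaseInterval}

/-! ### Distribution function, decreasing rearrangement, dilations -/

/-- The distribution function `d_x(l) = m {t ∈ I : |x t| > l}`. -/
def distr (x : L0 I) (l : ℝ≥0) : ℝ≥0∞ := I.measure {t | (l : ℝ) < |x t|}

/-- `x` and `y` have the same distribution function. -/
def Equimeasurable (x y : L0 I) : Prop := ∀ l : ℝ≥0, distr x l = distr y l

/-- The decreasing rearrangement `x^*(t) = inf {l > 0 : d_x(l) < t}` (with `inf ∅ = ∞`). -/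
def rearr (x : L0 I) (t : ℝ) : ℝ≥0∞ :=
  ⨅ (l : ℝ≥0) (_ : 0 < l ∧ distr x l < ENNReal.ofReal t), (l : ℝ≥0∞)

/-- The maximal function `x^{**}(t) = (1/t) ∫_0^t x^*(s) ds`. -/
def maxRearr (x : L0 I) (t : ℝ) : ℝ≥0∞ :=
  (∫⁻ s in Ioo 0 t, rearr x s) / ENNReal.ofReal t

/-- The dilation operator `(D_s x)(t) = x(t/s) χ_I(t/s)`. -/
def dilation (s : ℝ) (x : L0 I) : L0 I :=
  AEEqFun.mk (fun t => I.set.indicator x (t / s))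
    (((x.stronglyMeasurable.indicator I.measurableSet_set).comp_measurable
      (measurable_id.div_const s)).aestronglyMeasurable)

/-! ### Spaces of functions -/

/-- A set of classes of measurable functions together with a size functional. Only the values of
`nrm` on `carrier` are meaningful. -/
structure FunctionSpace (I : BaseInterval) where
  /-- The elements of the space. -/
  carrier : Set (L0 I)
  /-- The norm (or quasi-norm). -/
  nrm : L0 I → ℝ≥0∞

/-- `E` is a (saturated) Banach ideal space on `I`. -/
structure IsBanachIdealSpace (E : FunctionSpace I) : Prop where
  zero_mem : (0 : L0 I) ∈ E.carrier
  add_mem : ∀ x ∈ E.carrier, ∀ y ∈ E.carrier, x + y ∈ E.carrier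
  smul_mem : ∀ (c : ℝ), ∀ x ∈ E.carrier, c • x ∈ E.carrier
  nrm_lt_top : ∀ x ∈ E.carrier, E.nrm x < ∞
  nrm_eq_zero : ∀ x ∈ E.carrier, (E.nrm x = 0 ↔ x = 0)
  nrm_smul : ∀ (c : ℝ), ∀ x ∈ E.carrier, E.nrm (c • x) = ENNReal.ofReal |c| * E.nrm x
  nrm_add_le : ∀ x ∈ E.carrier, ∀ y ∈ E.carrier, E.nrm (x + y) ≤ E.nrm x + E.nrm y
  /-- Every Cauchy sequence converges. -/
  complete : ∀ u : ℕ → L0 I, (∀ n, u n ∈ E.carrier) →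
    (∀ ε : ℝ≥0∞, 0 < ε → ∃ N, ∀ m ≥ N, ∀ n ≥ N, E.nrm (u m - u n) < ε) →
    ∃ x ∈ E.carrier, Tendsto (fun n => E.nrm (u n - x)) atTop (𝓝 0)
  /-- The ideal property. -/
  ideal : ∀ (x : L0 I), ∀ y ∈ E.carrier, (∀ᵐ t ∂I.measure, |x t| ≤ |y t|) →
    x ∈ E.carrier ∧ E.nrm x ≤ E.nrm y
  /-- Every set of positive measure has a subset `B` of finite positive measure with `χ_B ∈ E`. -/
  saturated : ∀ A : Set ℝ, MeasurableSet A → 0 < I.measure A →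
    ∃ B ⊆ A, MeasurableSet B ∧ 0 < I.measure B ∧ I.measure B < ∞ ∧
      ∃ x ∈ E.carrier, x =ᵐ[I.measure] B.indicator (fun _ => (1 : ℝ))

/-- `E` is a symmetric (rearrangement invariant Banach) function space on `I`. -/
structure IsSymmetricSpace (E : FunctionSpace I) : Prop extends IsBanachIdealSpace E where
  symmetric : ∀ x ∈ E.carrier, ∀ y : L0 I, Equimeasurable x y →
    y ∈ E.carrier ∧ E.nrm y = E.nrm x

/-- The Fatou property: `0 ≤ u n ↑ x` a.e., `u n ∈ E` and `sup ‖u n‖ < ∞` imply `x ∈ E` and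
`‖u n‖ ↑ ‖x‖`. -/
def HasFatouProperty (E : FunctionSpace I) : Prop :=
  ∀ (u : ℕ → L0 I) (x : L0 I), (∀ n, u n ∈ E.carrier) →
    (∀ᵐ t ∂I.measure, 0 ≤ u 0 t ∧ Monotone (fun n => u n t) ∧
      Tendsto (fun n => u n t) atTop (𝓝 (x t))) →
    (⨆ n, E.nrm (u n)) < ∞ →
    x ∈ E.carrier ∧ Monotone (fun n => E.nrm (u n)) ∧
      Tendsto (fun n => E.nrm (u n)) atTop (𝓝 (E.nrm x))

/-- Equality of spaces up to equivalence of norms. -/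
def FunctionSpace.Same (E F : FunctionSpace I) : Prop :=
  E.carrier = F.carrier ∧
    ∃ C : ℝ≥0, ∀ x ∈ E.carrier, E.nrm x ≤ C * F.nrm x ∧ F.nrm x ≤ C * E.nrm x

/-- The pointwise product space `E ⊙ F = {x y : x ∈ E, y ∈ F}` with
`‖z‖ = inf {‖x‖_E ‖y‖_F : z = x y, x ∈ E, y ∈ F}`. -/
def FunctionSpace.prod (E F : FunctionSpace I) : FunctionSpace I where
  carrier := {z | ∃ x ∈ E.carrier, ∃ y ∈ F.carrier, z = x * y}
  nrm z := ⨅ (x ∈ E.carrier) (y ∈ F.carrier) (_ : z = x * y), E.nrm x * F.nrm y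

/-- The space of pointwise multipliers `M(E, F) = {x : x y ∈ F for each y ∈ E}` with the operator
norm `‖x‖ = sup {‖x y‖_F : y ∈ E, ‖y‖_E = 1}`. -/
def FunctionSpace.multipliers (E F : FunctionSpace I) : FunctionSpace I where
  carrier := {x | ∀ y ∈ E.carrier, x * y ∈ F.carrier}
  nrm x := ⨆ (y ∈ E.carrier) (_ : E.nrm y = 1), F.nrm (x * y)

/-! ### Boyd indices and indices of a function -/

/-- The operator norm of the dilation operator `D_s : E → E`. -/
def dilationNorm (E : FunctionSpace I) (s : ℝ) : ℝ≥0∞ :=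
  ⨆ (x ∈ E.carrier) (_ : E.nrm x ≤ 1), E.nrm (dilation s x)

/-- The lower Boyd index `α_E = lim_{s → 0+} ln ‖D_s‖ / ln s`. -/
def lowerBoydIndex (E : FunctionSpace I) : ℝ :=
  limUnder (𝓝[>] (0 : ℝ)) fun s => Real.log (dilationNorm E s).toReal / Real.log s

/-- The upper Boyd index `β_E = lim_{s → ∞} ln ‖D_s‖ / ln s`. -/
def upperBoydIndex (E : FunctionSpace I) : ℝ :=
  limUnder (atTop : Filter ℝ) fun s => Real.log (dilationNorm E s).toReal / Real.log s

/-- `m_{φ,I}(t) = sup {φ(s t) / φ(s) : s ∈ I, s t ∈ I}`. -/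
def dilationFun (I : BaseInterval) (φ : ℝ → ℝ) (t : ℝ) : ℝ :=
  sSup {r | ∃ s ∈ I.set, s * t ∈ I.set ∧ r = φ (s * t) / φ s}

/-- The lower index `p_{φ,I} = lim_{t → 0+} ln m_{φ,I}(t) / ln t`. -/
def lowerIndex (I : BaseInterval) (φ : ℝ → ℝ) : ℝ :=
  limUnder (𝓝[>] (0 : ℝ)) fun t => Real.log (dilationFun I φ t) / Real.log t

/-- The upper index `q_{φ,I} = lim_{t → ∞} ln m_{φ,I}(t) / ln t`. -/
def upperIndex (I : BaseInterval) (φ : ℝ → ℝ) : ℝ :=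
  limUnder (atTop : Filter ℝ) fun t => Real.log (dilationFun I φ t) / Real.log t

/-! ### Marcinkiewicz and Lorentz spaces -/

/-- The space of all `x ∈ L⁰(I)` at which an extended-valued functional is finite. -/
def FunctionSpace.ofENorm (N : L0 I → ℝ≥0∞) : FunctionSpace I where
  carrier := {x | N x < ∞}
  nrm := N

/-- The Marcinkiewicz space `M_φ`, `‖x‖ = sup_{t ∈ I} φ(t) x^{**}(t)`. -/
def marcinkiewicz (I : BaseInterval) (φ : ℝ → ℝ) : FunctionSpace I :=
  .ofENorm fun x => ⨆ t ∈ I.set, ENNReal.ofReal (φ t) * maxRearr x t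

/-- The Marcinkiewicz space `M_φ^*`, `‖x‖ = sup_{t ∈ I} φ(t) x^*(t)`. -/
def marcinkiewiczStar (I : BaseInterval) (φ : ℝ → ℝ) : FunctionSpace I :=
  .ofENorm fun x => ⨆ t ∈ I.set, ENNReal.ofReal (φ t) * rearr x t

/-- The Lorentz space `Λ_φ` of a non-decreasing concave `φ`,
`‖x‖ = φ(0+) ‖x‖_∞ + ∫_I x^*(t) φ'(t) dt`; for such `φ`, `φ(0+) = inf_I φ`. -/
def lorentz (I : BaseInterval) (φ : ℝ → ℝ) : FunctionSpace I :=
  .ofENorm fun x =>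
    (⨅ t ∈ I.set, ENNReal.ofReal (φ t)) * eLpNorm x ∞ I.measure +
      ∫⁻ t in I.set, rearr x t * ENNReal.ofReal (deriv φ t)

/-- The Lorentz space `Λ_{φ,1}`, `‖x‖ = ∫_I x^*(t) φ(t) / t dt`. -/
def lorentzOne (I : BaseInterval) (φ : ℝ → ℝ) : FunctionSpace I :=
  .ofENorm fun x => ∫⁻ t in I.set, rearr x t * ENNReal.ofReal (φ t / t)

end

/-!
The argument replaces every function by its values on the dyadic intervals `[2 ^ k, 2 ^ (k + 1))`
contained in the base interval. The norm of a symmetric space `E` extends to a functional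
`outerNorm` on `[0, ∞]`-valued functions, which is countably subadditive because `E` is complete.
Comparison with rearrangements makes `E` monotone with respect to distribution functions. Halving
each dyadic interval then shows that shifting a dyadic step function to the right costs at most a
factor `2`; hence a function `z` may be replaced by the sequence of values `z* (2 ^ k)`, and
dilations are bounded on `E`. Their norms are submultiplicative, so Fekete's lemma shows that the
limits defining the Boyd indices exist, and likewise for the indices of `φ`; the index hypotheses
thus become geometric decay of series in `‖D_{2 ^ i}‖`, `‖D_{2 ^ (-i)}‖` and the ratios
`φ (2 ^ (k + i)) / φ (2 ^ k)`.

The passage back from sequences to functions is `exists_factorization`: if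
`z* (2 ^ k) ≤ a k * u k` for decreasing sequences `a` and `u`, then `z = x * y` where the
distributions of `x` and `y` are controlled by the step functions of `a` and `u`. One composes the
sequences with the rank of `|z|` among the values `z* (2 ^ k)`.

For part (a) take `a = 1 / φ` and for `u` the least decreasing majorant of `φ z*`. Then `u / φ` is
dominated by a sum of left shifts of `z*` with coefficients that are summable against the dilation
norms because `q_φ < α_F`. Elements of `M_φ^*` are dominated by multiples of `1 / φ`, so the factor
of `z` built from `u` is a multiplier from `M_φ^*` to `F`. The condition `q_φ < 1` makes `M_φ` and
`M_φ^*` equivalent.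

For part (b) the sequence `z* (2 ^ k) φ (2 ^ k)` is summable, and a Lozanovskii factorization
(`exists_factor`) writes it as `a k * b k` with `a` in the dyadic unit ball of `E` and `b` in a
multiple of the dual ball. On a finite index set, `a` maximizes a weighted geometric mean over the
ball, which is compact by the Fatou property; a limit over finite index sets gives the general case.
The least decreasing majorants of `a` and of `b / φ` cost the sums `∑ ‖D_{2 ^ (-i)}‖` and
`∑ c i ‖D_{2 ^ i}‖`, finite because `0 < α_E` and `β_E < p_φ`. Finally `Λ_φ` and `Λ_{φ,1}` are
equivalent because `0 < p_φ`.
-/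

noncomputable section

variable {I : BaseInterval}

/-! ### The base interval, distribution functions and rearrangements -/

namespace BaseInterval

theorem pos_of_mem {t : ℝ} (ht : t ∈ I.set) : 0 < t := by
  cases I
  · exact ht.1
  · exact ht

theorem mem_of_le {s t : ℝ} (hs : 0 < s) (hst : s ≤ t) (ht : t ∈ I.set) : s ∈ I.set := by
  cases I
  · exact ⟨hs, hst.trans_lt ht.2⟩
  · exact hs

theorem ae_mem : ∀ᵐ t ∂I.measure, t ∈ I.set :=
  ae_restrict_mem I.measurableSet_set

theorem le_measure_ofReal_lt {d : ℝ≥0∞} (hd : d ≤ I.measure univ) :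
    d ≤ I.measure {t | ENNReal.ofReal t < d} := by
  have hm : MeasurableSet {t : ℝ | ENNReal.ofReal t < d} :=
    measurableSet_lt ENNReal.measurable_ofReal measurable_const
  rw [measure, Measure.restrict_apply hm]
  rcases eq_or_ne d ∞ with rfl | hfin
  · cases I
    · simp [measure, set] at hd
    · simp [set]
  · have h : Ioo 0 d.toReal ⊆ {t : ℝ | ENNReal.ofReal t < d} ∩ I.set := by
      intro t ht
      refine ⟨(ENNReal.ofReal_lt_iff_lt_toReal ht.1.le hfin).2 ht.2, ?_⟩
      cases I
      · refine ⟨ht.1, ht.2.trans_le ?_⟩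
        have : d ≤ 1 := by simpa [measure, set] using hd
        simpa using ENNReal.toReal_mono ENNReal.one_ne_top this
      · exact ht.1
    calc d = volume (Ioo 0 d.toReal) := by simp [hfin]
      _ ≤ _ := measure_mono h

theorem measure_ofReal_le_le (d : ℝ≥0∞) :
    I.measure {t | ENNReal.ofReal t ≤ d} ≤ d := by
  have hm : MeasurableSet {t : ℝ | ENNReal.ofReal t ≤ d} :=
    measurableSet_le ENNReal.measurable_ofReal measurable_const
  rw [measure, Measure.restrict_apply hm]
  rcases eq_or_ne d ∞ with rfl | hfin
  · exact le_top
  · have h : {t : ℝ | ENNReal.ofReal t ≤ d} ∩ I.set ⊆ Ioc 0 d.toReal := by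
      rintro t ⟨h1, h2⟩
      exact ⟨pos_of_mem h2, (ENNReal.ofReal_le_iff_le_toReal hfin).1 h1⟩
    calc _ ≤ volume (Ioc 0 d.toReal) := measure_mono h
      _ = d := by simp [hfin]

end BaseInterval

theorem distr_eq_enorm (x : L0 I) (l : ℝ≥0) :
    distr x l = I.measure {t | (l : ℝ≥0∞) < ‖x t‖ₑ} := by
  unfold distr
  congr 1
  ext t
  simp only [mem_ofPred_eq, Real.enorm_eq_ofReal_abs]
  rw [ENNReal.lt_ofReal_iff_toReal_lt ENNReal.coe_ne_top]
  rfl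

theorem distr_le_univ (x : L0 I) (l : ℝ≥0) : distr x l ≤ I.measure univ :=
  measure_mono (subset_univ _)

theorem distr_anti (x : L0 I) {l l' : ℝ≥0} (h : l ≤ l') : distr x l' ≤ distr x l :=
  measure_mono fun _ ht => lt_of_le_of_lt (NNReal.coe_le_coe.2 h) ht

/-- The distribution function is continuous from the right. -/
theorem exists_lt_distr {x : L0 I} {l : ℝ≥0} {d : ℝ≥0∞} (h : d < distr x l) :
    ∃ l' > l, d < distr x l' := by
  have hU : {t | (l : ℝ) < |x t|} =
      ⋃ n : ℕ, {t | ((l + 1 / ((n : ℝ≥0) + 1) : ℝ≥0) : ℝ) < |x t|} := by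
    ext t
    simp only [mem_ofPred_eq, mem_iUnion]
    constructor
    · intro ht
      obtain ⟨n, hn⟩ := exists_nat_one_div_lt (sub_pos.2 ht)
      refine ⟨n, ?_⟩
      push_cast
      linarith
    · rintro ⟨n, hn⟩
      refine lt_of_le_of_lt ?_ hn
      push_cast
      have : (0 : ℝ) ≤ 1 / ((n : ℝ) + 1) := by positivity
      linarith
  have hmono : Monotone fun n : ℕ => {t | ((l + 1 / ((n : ℝ≥0) + 1) : ℝ≥0) : ℝ) < |x t|} := by
    intro m n hmn t ht
    change _ < |x t| at ht ⊢
    refine lt_of_le_of_lt ?_ ht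
    push_cast
    gcongr
  unfold distr at h
  rw [hU, hmono.measure_iUnion, lt_iSup_iff] at h
  obtain ⟨n, hn⟩ := h
  refine ⟨_, ?_, hn⟩
  have : (0 : ℝ≥0) < 1 / ((n : ℝ≥0) + 1) := by positivity
  exact lt_add_of_pos_right l this

theorem rearr_le_of_distr_lt {x : L0 I} {l : ℝ≥0} {t : ℝ} (h : distr x l < ENNReal.ofReal t) :
    rearr x t ≤ l := by
  refine ENNReal.le_of_forall_pos_le_add fun ε hε _ => ?_
  unfold rearr
  refine iInf₂_le_of_le (l + ε) ⟨by positivity, ?_⟩ (by simp)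
  exact (distr_anti x (by simp)).trans_lt h

theorem le_rearr_of_le_distr {x : L0 I} {l : ℝ≥0} {t : ℝ} (h : ENNReal.ofReal t ≤ distr x l) :
    l ≤ rearr x t := by
  unfold rearr
  refine le_iInf₂ fun m hm => ?_
  by_contra hlt
  have : m ≤ l := by
    simpa using (not_le.1 hlt).le
  exact absurd (h.trans (distr_anti x this)) (not_le.2 hm.2)

theorem lt_rearr_of_lt_distr {x : L0 I} {l : ℝ≥0} {t : ℝ} (h : ENNReal.ofReal t < distr x l) :
    l < rearr x t := by
  obtain ⟨l', hl, hd⟩ := exists_lt_distr h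
  exact lt_of_lt_of_le (by simpa using hl) (le_rearr_of_le_distr hd.le)

theorem distr_le_of_rearr_le {x : L0 I} {l : ℝ≥0} {t : ℝ} (h : rearr x t ≤ l) :
    distr x l ≤ ENNReal.ofReal t := by
  by_contra hlt
  exact absurd h (not_le.2 (lt_rearr_of_lt_distr (not_le.1 hlt)))

theorem antitone_rearr (x : L0 I) : Antitone (rearr x) := by
  intro s t hst
  unfold rearr
  refine le_iInf₂ fun l hl => iInf₂_le l ⟨hl.1, hl.2.trans_le (ENNReal.ofReal_le_ofReal hst)⟩

theorem measurable_rearr (x : L0 I) : Measurable (rearr x) :=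
  (antitone_rearr x).measurable

theorem rearr_mono {x y : L0 I} (h : ∀ l, distr x l ≤ distr y l) (t : ℝ) :
    rearr x t ≤ rearr y t := by
  unfold rearr
  refine le_iInf₂ fun l hl => iInf₂_le l ⟨hl.1, (h l).trans_lt hl.2⟩

/-- The rearrangement has the distribution of the function itself. -/
theorem measure_lt_rearr (x : L0 I) (l : ℝ≥0) :
    I.measure {t | (l : ℝ≥0∞) < rearr x t} = distr x l := by
  apply le_antisymm
  · refine le_trans (measure_mono fun t ht => ?_)
      (I.measure_ofReal_le_le (distr x l))
    by_contra hlt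
    exact absurd (rearr_le_of_distr_lt (not_le.1 hlt)) (not_le.2 ht)
  · exact (I.le_measure_ofReal_lt (distr_le_univ x l)).trans
      (measure_mono fun t ht => lt_rearr_of_lt_distr ht)

theorem eq_zero_of_distr {x : L0 I} (h : ∀ l : ℝ≥0, 0 < l → distr x l = 0) : x = 0 := by
  have h0 : distr x 0 = 0 := by
    by_contra hne
    obtain ⟨l, hl, hd⟩ := exists_lt_distr (pos_iff_ne_zero.2 hne)
    exact absurd (h l hl) hd.ne'
  apply AEEqFun.ext
  have h1 : ∀ᵐ t ∂I.measure, ¬ (((0 : ℝ≥0) : ℝ) < |x t|) := by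
    rw [ae_iff]
    simpa [distr] using h0
  filter_upwards [h1, AEEqFun.coeFn_zero (μ := I.measure) (β := ℝ)] with t ht h2
  rw [h2]
  simpa using ht

/-- A function whose rearrangement vanishes on `I` is zero. -/
theorem eq_zero_of_rearr {x : L0 I} (h : ∀ t ∈ I.set, rearr x t = 0) : x = 0 := by
  refine eq_zero_of_distr fun l hl => ?_
  rw [← measure_lt_rearr]
  refine measure_mono_null (t := I.setᶜ) (fun t ht hI => ?_) ?_
  · simp [h t hI] at ht
  · exact ae_iff.1 I.ae_mem

theorem distr_smul {c : ℝ} (hc : 0 < c) (x : L0 I) (l : ℝ≥0) :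
    distr (c • x) (c.toNNReal * l) = distr x l := by
  unfold distr
  refine measure_congr ?_
  filter_upwards [AEEqFun.coeFn_smul c x] with t ht
  refine propext ?_
  change _ < |(c • x) t| ↔ _ < |x t|
  rw [ht]
  simp only [NNReal.coe_mul, Real.coe_toNNReal c hc.le, Pi.smul_apply, smul_eq_mul, abs_mul,
    abs_of_pos hc]
  exact mul_lt_mul_iff_right₀ hc

theorem rearr_smul_le {c : ℝ} (hc : 0 < c) (x : L0 I) (t : ℝ) :
    rearr (c • x) t ≤ ENNReal.ofReal c * rearr x t := by
  have hc' : ENNReal.ofReal c ≠ 0 := by simpa using hc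
  rw [rearr, rearr, ENNReal.mul_iInf_of_ne hc' ENNReal.ofReal_ne_top]
  refine le_iInf fun l => ?_
  rw [ENNReal.mul_iInf_of_ne hc' ENNReal.ofReal_ne_top]
  refine le_iInf fun hl => ?_
  refine iInf₂_le_of_le (c.toNNReal * l) ⟨mul_pos (by simpa using hc) hl.1, ?_⟩ ?_
  · rw [distr_smul hc]
    exact hl.2
  · simp [ENNReal.ofReal]

theorem rearr_smul {c : ℝ} (hc : 0 < c) (x : L0 I) (t : ℝ) :
    rearr (c • x) t = ENNReal.ofReal c * rearr x t := by
  refine le_antisymm (rearr_smul_le hc x t) ?_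
  have h := rearr_smul_le (inv_pos.2 hc) (c • x) t
  rw [smul_smul, inv_mul_cancel₀ hc.ne', one_smul] at h
  calc _ ≤ ENNReal.ofReal c * (ENNReal.ofReal c⁻¹ * rearr (c • x) t) := by gcongr
    _ = _ := by
      rw [← mul_assoc, ← ENNReal.ofReal_mul hc.le, mul_inv_cancel₀ hc.ne', ENNReal.ofReal_one,
        one_mul]

theorem distr_mul_le (x y : L0 I) (a b : ℝ≥0) :
    distr (x * y) (a * b) ≤ distr x a + distr y b := by
  unfold distr
  refine le_trans (measure_mono_ae ?_) (measure_union_le _ _)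
  filter_upwards [AEEqFun.coeFn_mul x y] with t ht h
  change _ < |(x * y) t| at h
  change t ∈ {t | (a : ℝ) < |x t|} ∪ {t | (b : ℝ) < |y t|}
  rw [ht, Pi.mul_apply, abs_mul] at h
  by_contra hn
  simp only [mem_union, mem_ofPred_eq, not_or, not_lt] at hn
  refine absurd h (not_lt.2 ?_)
  rw [NNReal.coe_mul]
  exact mul_le_mul hn.1 hn.2 (abs_nonneg _) a.2

/-! ### Dyadic step functions -/

/-- The index `k` of the dyadic interval `[2 ^ k, 2 ^ (k + 1))` that contains `t > 0`. -/
def dyadicIndex (t : ℝ) : ℤ := ⌊Real.logb 2 t⌋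

theorem measurable_dyadicIndex : Measurable dyadicIndex :=
  Int.measurable_floor.comp (Real.measurable_log.div_const _)

theorem dyadicIndex_eq_log {t : ℝ} (ht : 0 < t) : dyadicIndex t = Int.log 2 t :=
  Real.floor_logb_natCast (b := 2) ht.le

theorem zpow_dyadicIndex_le {t : ℝ} (ht : 0 < t) : (2 : ℝ) ^ dyadicIndex t ≤ t := by
  rw [dyadicIndex_eq_log ht]
  exact_mod_cast Int.zpow_log_le_self (b := 2) one_lt_two ht

theorem lt_zpow_dyadicIndex {t : ℝ} (ht : 0 < t) : t < (2 : ℝ) ^ (dyadicIndex t + 1) := by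
  rw [dyadicIndex_eq_log ht]
  exact_mod_cast Int.lt_zpow_succ_log_self (b := 2) one_lt_two t

theorem dyadicIndex_eq {t : ℝ} {k : ℤ} (h1 : (2 : ℝ) ^ k ≤ t) (h2 : t < (2 : ℝ) ^ (k + 1)) :
    dyadicIndex t = k := by
  have ht : 0 < t := (by positivity : (0 : ℝ) < 2 ^ k).trans_le h1
  have h3 := zpow_dyadicIndex_le ht
  have h4 := lt_zpow_dyadicIndex ht
  have h5 := (zpow_lt_zpow_iff_right₀ (one_lt_two (α := ℝ))).1 (h3.trans_lt h2)
  have h6 := (zpow_lt_zpow_iff_right₀ (one_lt_two (α := ℝ))).1 (h1.trans_lt h4)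
  omega

namespace BaseInterval

/-- The indices `k` of the dyadic intervals `[2 ^ k, 2 ^ (k + 1))` that meet (and then lie
in) the base interval: all integers, or the negative ones. -/
def indices (I : BaseInterval) : Set ℤ := {k | (2 : ℝ) ^ k ∈ I.set}

theorem mem_indices_of_le {j k : ℤ} (h : j ≤ k) (hk : k ∈ I.indices) : j ∈ I.indices :=
  mem_of_le (by positivity) (zpow_le_zpow_right₀ one_le_two h) hk

theorem dyadicIndex_mem {t : ℝ} (ht : t ∈ I.set) : dyadicIndex t ∈ I.indices :=
  mem_of_le (by have := pos_of_mem ht; positivity) (zpow_dyadicIndex_le (pos_of_mem ht)) ht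

theorem dyadic_subset {k : ℤ} (hk : k ∈ I.indices) {t : ℝ} (h1 : (2 : ℝ) ^ k ≤ t)
    (h2 : t < (2 : ℝ) ^ (k + 1)) : t ∈ I.set := by
  have ht : 0 < t := (by positivity : (0 : ℝ) < 2 ^ k).trans_le h1
  cases I
  · refine ⟨ht, h2.trans_le ?_⟩
    have h3 : (2 : ℝ) ^ k < 2 ^ (0 : ℤ) := by simpa using hk.2
    have h4 := (zpow_lt_zpow_iff_right₀ (one_lt_two (α := ℝ))).1 h3
    calc (2 : ℝ) ^ (k + 1) ≤ 2 ^ (0 : ℤ) := zpow_le_zpow_right₀ one_le_two (by omega)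
      _ = 1 := by simp
  · exact ht

theorem measure_univ_le_of_not_mem {k : ℤ} (hk : k ∉ I.indices) :
    I.measure univ ≤ ENNReal.ofReal (2 ^ k) := by
  cases I
  · have h : (1 : ℝ) ≤ 2 ^ k := by
      by_contra hlt
      exact hk ⟨by positivity, not_le.1 hlt⟩
    simpa [measure, set] using h
  · exact absurd (show (0 : ℝ) < 2 ^ k by positivity) hk

theorem neg_one_mem_indices (I : BaseInterval) : (-1 : ℤ) ∈ I.indices := by
  cases I
  · constructor <;> norm_num
  · change (0 : ℝ) < 2 ^ (-1 : ℤ)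
    norm_num

/-- The measure of a part `[u, v)` of a dyadic interval. -/
theorem measure_dyadic_part {k : ℤ} (hk : k ∈ I.indices) {u v : ℝ} (hu : (2 : ℝ) ^ k ≤ u)
    (hv : v ≤ (2 : ℝ) ^ (k + 1)) : I.measure (Ico u v) = ENNReal.ofReal (v - u) := by
  rw [measure, Measure.restrict_apply measurableSet_Ico, inter_eq_left.2, Real.volume_Ico]
  exact fun t ht => dyadic_subset hk (hu.trans ht.1) (ht.2.trans_le hv)

theorem setOf_dyadicIndex_ae_eq (k : ℤ) :
    ({t | dyadicIndex t = k} : Set ℝ) =ᵐ[I.measure] Ico ((2 : ℝ) ^ k) (2 ^ (k + 1)) := by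
  filter_upwards [I.ae_mem] with t ht
  refine propext ⟨fun h => ?_, fun h => dyadicIndex_eq h.1 h.2⟩
  have h' : dyadicIndex t = k := h
  subst h'
  exact ⟨zpow_dyadicIndex_le (pos_of_mem ht), lt_zpow_dyadicIndex (pos_of_mem ht)⟩

theorem measure_dyadicIndex {k : ℤ} (hk : k ∈ I.indices) :
    I.measure {t | dyadicIndex t = k} = ENNReal.ofReal (2 ^ k) := by
  rw [measure_congr (setOf_dyadicIndex_ae_eq k), measure_dyadic_part hk le_rfl le_rfl,
    zpow_add_one₀ two_ne_zero]
  congr 1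
  ring

theorem measure_dyadicIndex_of_not_mem {k : ℤ} (hk : k ∉ I.indices) :
    I.measure {t | dyadicIndex t = k} = 0 := by
  refine measure_mono_null (t := I.setᶜ) (fun t ht hI => hk ?_) (ae_iff.1 I.ae_mem)
  have h' : dyadicIndex t = k := ht
  exact h' ▸ dyadicIndex_mem hI

end BaseInterval

/-- The function with the constant value `a k` on each dyadic interval `[2 ^ k, 2 ^ (k + 1))`. -/
def dyadicStep (a : ℤ → ℝ≥0∞) (t : ℝ) : ℝ≥0∞ := a (dyadicIndex t)

theorem measurable_dyadicStep (a : ℤ → ℝ≥0∞) : Measurable (dyadicStep a) :=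
  (measurable_from_top (f := a)).comp measurable_dyadicIndex

theorem ae_dyadicStep_le {a b : ℤ → ℝ≥0∞} (h : ∀ k ∈ I.indices, a k ≤ b k) :
    ∀ᵐ t ∂I.measure, dyadicStep a t ≤ dyadicStep b t := by
  filter_upwards [I.ae_mem] with t ht
  exact h _ (I.dyadicIndex_mem ht)

/-- An almost everywhere statement about dyadic step functions holds at each index. -/
theorem forall_of_ae_dyadicIndex {p : ℤ → Prop} (h : ∀ᵐ t ∂I.measure, p (dyadicIndex t)) {k : ℤ}
    (hk : k ∈ I.indices) : p k := by
  by_contra hn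
  have h0 : I.measure {t | dyadicIndex t = k} = 0 :=
    measure_mono_null (fun t ht hp => hn ((show dyadicIndex t = k from ht) ▸ hp)) (ae_iff.1 h)
  rw [I.measure_dyadicIndex hk] at h0
  have : (0 : ℝ) < 2 ^ k := by positivity
  simp only [ENNReal.ofReal_eq_zero] at h0
  linarith

/-- The class of a measurable `[0, ∞]`-valued function (with the value `∞` replaced by `0`). -/
def toL0 (I : BaseInterval) (f : ℝ → ℝ≥0∞) (hf : Measurable f) : L0 I :=
  AEEqFun.mk (fun t => (f t).toReal) hf.ennreal_toReal.aestronglyMeasurable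

theorem enorm_toL0 {f : ℝ → ℝ≥0∞} (hf : Measurable f) (hfin : ∀ᵐ t ∂I.measure, f t ≠ ∞) :
    ∀ᵐ t ∂I.measure, ‖toL0 I f hf t‖ₑ = f t := by
  filter_upwards [hfin, AEEqFun.coeFn_mk (μ := I.measure) (fun t => (f t).toReal)
    hf.ennreal_toReal.aestronglyMeasurable] with t ht h
  rw [toL0, h, Real.enorm_of_nonneg ENNReal.toReal_nonneg, ENNReal.ofReal_toReal ht]

theorem distr_toL0 {f : ℝ → ℝ≥0∞} (hf : Measurable f) (hfin : ∀ᵐ t ∂I.measure, f t ≠ ∞)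
    (l : ℝ≥0) : distr (toL0 I f hf) l = I.measure {t | (l : ℝ≥0∞) < f t} := by
  rw [distr_eq_enorm]
  refine measure_congr ?_
  filter_upwards [enorm_toL0 hf hfin] with t ht
  exact propext (show _ < _ ↔ _ < _ by rw [ht])

/-! ### The extension of the norm to arbitrary `[0, ∞]`-valued functions -/

/-- The least norm of an element of `E` whose modulus dominates `f`; it extends the norm of `E` to
all `[0, ∞]`-valued functions and is `∞` where there is no such element. -/
def FunctionSpace.outerNorm (E : FunctionSpace I) (f : ℝ → ℝ≥0∞) : ℝ≥0∞ :=
  ⨅ (x ∈ E.carrier) (_ : ∀ᵐ t ∂I.measure, f t ≤ ‖x t‖ₑ), E.nrm x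

namespace FunctionSpace

variable {E : FunctionSpace I}

theorem outerNorm_le {f : ℝ → ℝ≥0∞} {x : L0 I} (hx : x ∈ E.carrier)
    (h : ∀ᵐ t ∂I.measure, f t ≤ ‖x t‖ₑ) : E.outerNorm f ≤ E.nrm x :=
  iInf₂_le_of_le x hx (iInf_le _ h)

theorem exists_of_outerNorm_lt {f : ℝ → ℝ≥0∞} {r : ℝ≥0∞} (h : E.outerNorm f < r) :
    ∃ x ∈ E.carrier, (∀ᵐ t ∂I.measure, f t ≤ ‖x t‖ₑ) ∧ E.nrm x < r := by
  simp only [outerNorm, iInf_lt_iff] at h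
  obtain ⟨x, hx, h1, h2⟩ := h
  exact ⟨x, hx, h1, h2⟩

theorem le_outerNorm {f : ℝ → ℝ≥0∞} {r : ℝ≥0∞}
    (h : ∀ x ∈ E.carrier, (∀ᵐ t ∂I.measure, f t ≤ ‖x t‖ₑ) → r ≤ E.nrm x) : r ≤ E.outerNorm f :=
  le_iInf₂ fun x hx => le_iInf fun h1 => h x hx h1

theorem outerNorm_mono {f g : ℝ → ℝ≥0∞} (h : ∀ᵐ t ∂I.measure, f t ≤ g t) :
    E.outerNorm f ≤ E.outerNorm g :=
  le_outerNorm fun x hx h1 => outerNorm_le hx <| by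
    filter_upwards [h, h1] with t h2 h3 using h2.trans h3

theorem outerNorm_dyadicStep_mono {a b : ℤ → ℝ≥0∞} (h : ∀ k ∈ I.indices, a k ≤ b k) :
    E.outerNorm (dyadicStep a) ≤ E.outerNorm (dyadicStep b) :=
  outerNorm_mono (ae_dyadicStep_le h)

theorem ae_ne_top_of_outerNorm {f : ℝ → ℝ≥0∞} (h : E.outerNorm f ≠ ∞) :
    ∀ᵐ t ∂I.measure, f t ≠ ∞ := by
  obtain ⟨x, -, h1, -⟩ := exists_of_outerNorm_lt (lt_top_iff_ne_top.2 h)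
  filter_upwards [h1] with t ht
  exact ne_top_of_le_ne_top enorm_ne_top ht

end FunctionSpace

namespace IsBanachIdealSpace

open FunctionSpace

variable {E : FunctionSpace I}

theorem ideal_enorm (hE : IsBanachIdealSpace E) {x y : L0 I} (hy : y ∈ E.carrier)
    (h : ∀ᵐ t ∂I.measure, ‖x t‖ₑ ≤ ‖y t‖ₑ) : x ∈ E.carrier ∧ E.nrm x ≤ E.nrm y := by
  refine hE.ideal x y hy ?_
  filter_upwards [h] with t ht
  rw [Real.enorm_eq_ofReal_abs, Real.enorm_eq_ofReal_abs] at ht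
  exact (ENNReal.ofReal_le_ofReal_iff (abs_nonneg _)).1 ht

theorem mem_of_outerNorm_ne_top (hE : IsBanachIdealSpace E) {x : L0 I}
    (h : E.outerNorm (fun t => ‖x t‖ₑ) ≠ ∞) : x ∈ E.carrier := by
  obtain ⟨y, hy, h1, -⟩ := exists_of_outerNorm_lt (lt_top_iff_ne_top.2 h)
  exact (hE.ideal_enorm hy h1).1

theorem nrm_le_outerNorm (hE : IsBanachIdealSpace E) (x : L0 I) {f : ℝ → ℝ≥0∞}
    (h : ∀ᵐ t ∂I.measure, ‖x t‖ₑ ≤ f t) : E.nrm x ≤ E.outerNorm f :=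
  le_outerNorm fun y hy h1 => (hE.ideal_enorm hy <| by
    filter_upwards [h, h1] with t h2 h3 using h2.trans h3).2

theorem outerNorm_zero (hE : IsBanachIdealSpace E) : E.outerNorm (fun _ => 0) = 0 := by
  rw [← nonpos_iff_eq_zero]
  exact (outerNorm_le hE.zero_mem (ae_of_all _ fun _ => bot_le)).trans
    ((hE.nrm_eq_zero 0 hE.zero_mem).2 rfl).le

theorem nrm_sub_comm (hE : IsBanachIdealSpace E) {x y : L0 I} (hx : x ∈ E.carrier)
    (hy : y ∈ E.carrier) : x - y ∈ E.carrier ∧ E.nrm (x - y) = E.nrm (y - x) := by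
  have hmem : ∀ x ∈ E.carrier, ∀ y ∈ E.carrier, x - y ∈ E.carrier := fun x hx y hy => by
    have := hE.add_mem x hx _ (hE.smul_mem (-1) y hy)
    rwa [neg_one_smul, ← sub_eq_add_neg] at this
  refine ⟨hmem x hx y hy, ?_⟩
  have := hE.nrm_smul (-1) (y - x) (hmem y hy x hx)
  simpa using this

theorem outerNorm_const_mul (hE : IsBanachIdealSpace E) (c : ℝ≥0) (f : ℝ → ℝ≥0∞) :
    E.outerNorm (fun t => c * f t) ≤ c * E.outerNorm f := by
  rcases eq_or_ne c 0 with rfl | hc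
  · simp [hE.outerNorm_zero]
  · have hc' : (c : ℝ≥0∞) ≠ 0 := by simpa using hc
    rw [outerNorm, outerNorm, ENNReal.mul_iInf_of_ne hc' ENNReal.coe_ne_top]
    refine le_iInf fun x => ?_
    rw [ENNReal.mul_iInf_of_ne hc' ENNReal.coe_ne_top]
    refine le_iInf fun hx => ?_
    rw [ENNReal.mul_iInf_of_ne hc' ENNReal.coe_ne_top]
    refine le_iInf fun h => ?_
    have hn : E.nrm ((c : ℝ) • x) = c * E.nrm x := by
      rw [hE.nrm_smul _ x hx]
      simp
    rw [← hn]
    refine outerNorm_le (hE.smul_mem _ x hx) ?_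
    filter_upwards [h, AEEqFun.coeFn_smul (c : ℝ) x] with t h1 h2
    rw [h2, Pi.smul_apply, enorm_smul]
    gcongr
    simp

/-- In a Banach ideal space an absolutely convergent series of nonnegative functions is dominated
by an element whose norm is at most the sum of the norms. -/
theorem exists_sum_le (hE : IsBanachIdealSpace E) {y : ℕ → L0 I} (hy : ∀ n, y n ∈ E.carrier)
    (h0 : ∀ n, ∀ᵐ t ∂I.measure, 0 ≤ y n t) (hsum : ∑' n, E.nrm (y n) ≠ ∞) :
    ∃ x ∈ E.carrier, E.nrm x ≤ ∑' n, E.nrm (y n) ∧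
      ∀ᵐ t ∂I.measure, ∀ n, ∑ i ∈ Finset.range n, y i t ≤ x t := by
  have hmem : ∀ (s : Finset ℕ), ∑ i ∈ s, y i ∈ E.carrier ∧
      E.nrm (∑ i ∈ s, y i) ≤ ∑ i ∈ s, E.nrm (y i) := by
    intro s
    induction s using Finset.induction_on with
    | empty => simpa using ⟨hE.zero_mem, (hE.nrm_eq_zero 0 hE.zero_mem).2 rfl⟩
    | insert i s hi ih =>
      rw [Finset.sum_insert hi, Finset.sum_insert hi]
      refine ⟨hE.add_mem _ (hy i) _ ih.1, (hE.nrm_add_le _ (hy i) _ ih.1).trans ?_⟩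
      gcongr
      exact ih.2
  set S : ℕ → L0 I := fun n => ∑ i ∈ Finset.range n, y i with hS
  have hcoe : ∀ n, ∀ᵐ t ∂I.measure, S n t = ∑ i ∈ Finset.range n, y i t := by
    intro n
    induction n with
    | zero =>
      filter_upwards [AEEqFun.coeFn_zero (μ := I.measure) (β := ℝ)] with t ht
      simp [hS, ht]
    | succ n ih =>
      have h1 : S (n + 1) = S n + y n := Finset.sum_range_succ _ _
      filter_upwards [ih, AEEqFun.coeFn_add (S n) (y n)] with t h2 h3
      rw [h1, h3, Pi.add_apply, h2, Finset.sum_range_succ]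
  have htail : ∀ n m, n ≤ m → E.nrm (S m - S n) ≤ ∑' i, E.nrm (y (i + n)) := by
    intro n m hnm
    have h1 : S m - S n = ∑ i ∈ Finset.Ico n m, y i := by
      rw [hS, Finset.sum_Ico_eq_sub _ hnm]
    rw [h1]
    refine (hmem _).2.trans ?_
    rw [Finset.sum_Ico_eq_sum_range]
    simp_rw [add_comm n]
    exact ENNReal.sum_le_tsum _
  have hSm : ∀ n, S n ∈ E.carrier := fun n => (hmem _).1
  obtain ⟨x, hx, hlim⟩ := hE.complete S hSm fun ε hε => by
    have h1 := ENNReal.tendsto_sum_nat_add (fun n => E.nrm (y n)) hsum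
    obtain ⟨N, hN⟩ := (h1.eventually (gt_mem_nhds hε)).exists
    have h2 : ∀ n ≥ N, E.nrm (S n - S N) < ε := fun n hn => (htail N n hn).trans_lt hN
    have h3 : ∀ m ≥ N, ∀ n ≥ N, n ≤ m → E.nrm (S m - S n) < ε := fun m hm n hn hnm => by
      refine (htail n m hnm).trans_lt (lt_of_le_of_lt ?_ hN)
      obtain ⟨d, rfl⟩ := Nat.exists_eq_add_of_le hn
      have : ∀ i, y (i + (N + d)) = (fun j => y (j + N)) (i + d) := fun i => by
        simp only
        congr 1
        omega
      simp_rw [this]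
      exact ENNReal.tsum_comp_le_tsum_of_injective (add_left_injective d)
        (fun j => E.nrm (y (j + N)))
    refine ⟨N, fun m hm n hn => ?_⟩
    rcases le_total n m with h | h
    · exact h3 m hm n hn h
    · rw [(hE.nrm_sub_comm (hSm m) (hSm n)).2]
      exact h3 n hn m hm h
  refine ⟨x, hx, ?_, ?_⟩
  · have h1 : ∀ m, E.nrm x ≤ E.nrm (S m - x) + ∑' n, E.nrm (y n) := by
      intro m
      have h2 := hE.nrm_sub_comm hx (hSm m)
      have h3 := hE.nrm_add_le _ h2.1 _ (hSm m)
      rw [sub_add_cancel, h2.2] at h3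
      refine h3.trans ?_
      gcongr
      exact (hmem _).2.trans (ENNReal.sum_le_tsum _)
    have h2 := hlim.add (tendsto_const_nhds (x := ∑' n, E.nrm (y n)))
    rw [zero_add] at h2
    exact ge_of_tendsto' h2 h1
  · rw [ae_all_iff]
    intro n
    have hyall : ∀ᵐ t ∂I.measure, ∀ n, 0 ≤ y n t := ae_all_iff.2 h0
    -- For `m ≥ n` the positive part of `S n - x` is at most `|S m - x|`, whose norm tends to `0`.
    have hu : ∀ m ≥ n, (S n - x) ⊔ 0 ∈ E.carrier ∧
        E.nrm ((S n - x) ⊔ 0) ≤ E.nrm (S m - x) := by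
      intro m hm
      refine hE.ideal _ _ (hE.nrm_sub_comm (hSm m) hx).1 ?_
      filter_upwards [AEEqFun.coeFn_sup (S n - x) 0, AEEqFun.coeFn_sub (S n) x,
        AEEqFun.coeFn_sub (S m) x, AEEqFun.coeFn_zero (μ := I.measure) (β := ℝ), hcoe n, hcoe m,
        hyall] with t e1 e2 e3 e4 e5 e6 e7
      have hle : S n t ≤ S m t := by
        rw [e5, e6]
        exact Finset.sum_le_sum_of_subset_of_nonneg (Finset.range_mono hm) fun i _ _ => e7 i
      rw [e1, e2, e3, e4, Pi.sub_apply, Pi.sub_apply, Pi.zero_apply]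
      rcases le_total (S n t - x t) 0 with h | h
      · simp [sup_eq_right.2 h]
      · rw [sup_eq_left.2 h, abs_of_nonneg h]
        exact le_trans (by linarith) (le_abs_self _)
    have h0 : E.nrm ((S n - x) ⊔ 0) = 0 := by
      refine le_antisymm (ge_of_tendsto hlim ?_) bot_le
      filter_upwards [eventually_ge_atTop n] with m hm using (hu m hm).2
    have h1 := (hE.nrm_eq_zero _ (hu n le_rfl).1).1 h0
    filter_upwards [AEEqFun.coeFn_sup (S n - x) 0, AEEqFun.coeFn_sub (S n) x,
      AEEqFun.coeFn_zero (μ := I.measure) (β := ℝ), hcoe n] with t e1 e2 e4 e5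
    rw [h1, e4, e2, Pi.sub_apply, Pi.zero_apply] at e1
    have : S n t - x t ≤ 0 := e1 ▸ le_sup_left
    rw [← e5]
    linarith

theorem outerNorm_tsum_le (hE : IsBanachIdealSpace E) (f : ℕ → ℝ → ℝ≥0∞) :
    E.outerNorm (fun t => ∑' n, f n t) ≤ ∑' n, E.outerNorm (f n) := by
  rcases eq_or_ne (∑' n, E.outerNorm (f n)) ∞ with h | h
  · exact h ▸ le_top
  refine ENNReal.le_of_forall_pos_le_add fun ε hε _ => ?_
  obtain ⟨δ, hδ, hδε⟩ := ENNReal.exists_pos_sum_of_countable'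
    (ε := (ε : ℝ≥0∞)) (by simpa using hε.ne') ℕ
  have hex : ∀ n, ∃ x ∈ E.carrier, (∀ᵐ t ∂I.measure, f n t ≤ ‖x t‖ₑ) ∧
      E.nrm x < E.outerNorm (f n) + δ n := fun n =>
    exists_of_outerNorm_lt (ENNReal.lt_add_right
      (ne_top_of_le_ne_top h (ENNReal.le_tsum n)) (hδ n).ne')
  choose x hx h1 h2 using hex
  have habs : ∀ n, |x n| ∈ E.carrier ∧ E.nrm |x n| ≤ E.nrm (x n) := fun n => by
    refine hE.ideal _ _ (hx n) ?_
    filter_upwards [AEEqFun.coeFn_abs (x n)] with t ht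
    rw [ht, abs_abs]
  have hle : ∑' n, E.nrm |x n| ≤ ∑' n, E.outerNorm (f n) + ε := by
    calc ∑' n, E.nrm |x n| ≤ ∑' n, (E.outerNorm (f n) + δ n) :=
          ENNReal.tsum_le_tsum fun n => (habs n).2.trans (h2 n).le
      _ = ∑' n, E.outerNorm (f n) + ∑' n, δ n := ENNReal.tsum_add
      _ ≤ _ := by gcongr
  have habs' : ∀ᵐ t ∂I.measure, ∀ n, |x n| t = |x n t| :=
    ae_all_iff.2 fun n => AEEqFun.coeFn_abs (x n)
  obtain ⟨z, hz, hzn, hzs⟩ := hE.exists_sum_le (fun n => (habs n).1)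
    (fun n => by filter_upwards [habs'] with t ht; rw [ht]; exact abs_nonneg _)
    (ne_top_of_le_ne_top (ENNReal.add_ne_top.2 ⟨h, ENNReal.coe_ne_top⟩) hle)
  refine (outerNorm_le hz ?_).trans (hzn.trans hle)
  filter_upwards [habs', hzs, ae_all_iff.2 h1] with t e1 e2 e3
  rw [ENNReal.tsum_eq_iSup_nat]
  refine iSup_le fun n => ?_
  calc ∑ i ∈ Finset.range n, f i t ≤ ∑ i ∈ Finset.range n, ENNReal.ofReal (|x i| t) := by
        gcongr with i
        rw [e1, ← Real.enorm_eq_ofReal_abs]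
        exact e3 i
    _ = ENNReal.ofReal (∑ i ∈ Finset.range n, |x i| t) := by
        rw [ENNReal.ofReal_sum_of_nonneg]
        intro i _
        rw [e1]
        exact abs_nonneg _
    _ ≤ ‖z t‖ₑ := by
        rw [Real.enorm_eq_ofReal_abs]
        exact ENNReal.ofReal_le_ofReal ((e2 n).trans (le_abs_self _))

theorem outerNorm_add_le (hE : IsBanachIdealSpace E) (f g : ℝ → ℝ≥0∞) :
    E.outerNorm (fun t => f t + g t) ≤ E.outerNorm f + E.outerNorm g := by
  have h := hE.outerNorm_tsum_le fun n : ℕ => if n = 0 then f else if n = 1 then g else fun _ => 0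
  have h1 : ∀ F : ℕ → ℝ≥0∞, (∀ n, n ∉ Finset.range 2 → F n = 0) → ∑' n, F n = F 0 + F 1 :=
    fun F hF => by rw [tsum_eq_sum hF, Finset.sum_range_succ, Finset.sum_range_one]
  have h2 : ∀ n, n ∉ Finset.range 2 → n ≠ 0 ∧ n ≠ 1 := fun n hn => by
    simp only [Finset.mem_range] at hn
    omega
  rw [h1 _ fun n hn => by simp [h2 n hn, hE.outerNorm_zero]] at h
  refine le_trans (le_of_eq ?_) (h.trans (by simp))
  congr 1
  ext t
  rw [h1 _ fun n hn => by simp [h2 n hn]]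
  simp

end IsBanachIdealSpace

/-! ### Comparison of distributions in symmetric spaces -/

theorem measurableSet_lt_abs (x : L0 I) (l : ℝ) : MeasurableSet {t | l < |x t|} :=
  measurableSet_lt measurable_const (AEEqFun.measurable x).abs

theorem distr_zero (l : ℝ≥0) : distr (0 : L0 I) l = 0 := by
  refine measure_mono_null (t := {t | ¬ (0 : L0 I) t = 0}) (fun t ht h => ?_) (ae_iff.1 ?_)
  · have : (l : ℝ) < |(0 : L0 I) t| := ht
    rw [h, abs_zero] at this
    exact absurd l.2 (not_le.2 this)
  · filter_upwards [AEEqFun.coeFn_zero (μ := I.measure) (β := ℝ)] with t ht using ht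

theorem exists_distr_lt {x : L0 I} {l : ℝ≥0} (h : distr x l ≠ ∞) {ε : ℝ≥0∞} (hε : 0 < ε) :
    ∃ l', distr x l' < ε := by
  have hanti : Antitone fun n : ℕ => {t | ((l + n : ℝ≥0) : ℝ) < |x t|} := by
    intro m n hmn t ht
    change _ < |x t| at ht ⊢
    refine lt_of_le_of_lt ?_ ht
    push_cast
    gcongr
  have hlim := tendsto_measure_iInter_atTop (μ := I.measure)
    (fun n => (measurableSet_lt_abs x _).nullMeasurableSet) hanti ⟨0, by simpa [distr] using h⟩
  have hempty : ⋂ n : ℕ, {t | ((l + n : ℝ≥0) : ℝ) < |x t|} = ∅ := by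
    refine eq_empty_iff_forall_notMem.2 fun t ht => ?_
    obtain ⟨n, hn⟩ := exists_nat_ge |x t|
    have h1 : ((l + n : ℝ≥0) : ℝ) < |x t| := mem_iInter.1 ht n
    push_cast at h1
    linarith [l.2]
  rw [hempty, measure_empty] at hlim
  obtain ⟨n, hn⟩ := (hlim.eventually (gt_mem_nhds hε)).exists
  exact ⟨_, hn⟩

theorem rearr_ne_top {x : L0 I} {l : ℝ≥0} (h : distr x l ≠ ∞) {t : ℝ} (ht : 0 < t) :
    rearr x t ≠ ∞ := by
  obtain ⟨l', hl⟩ := exists_distr_lt h (ENNReal.ofReal_pos.2 ht)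
  exact ne_top_of_le_ne_top ENNReal.coe_ne_top (rearr_le_of_distr_lt hl)

theorem ae_rearr_ne_top {x : L0 I} {l : ℝ≥0} (h : distr x l ≠ ∞) :
    ∀ᵐ t ∂I.measure, rearr x t ≠ ∞ := by
  filter_upwards [I.ae_mem] with t ht using rearr_ne_top h (I.pos_of_mem ht)

theorem equimeasurable_rearr {x : L0 I} {l : ℝ≥0} (h : distr x l ≠ ∞) :
    Equimeasurable x (toL0 I (rearr x) (measurable_rearr x)) := fun m => by
  rw [distr_toL0 _ (ae_rearr_ne_top h), measure_lt_rearr]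

namespace IsSymmetricSpace

open FunctionSpace

variable {E : FunctionSpace I}

/-- An element of a symmetric space with an everywhere infinite distribution function would be
equimeasurable with its double. -/
theorem exists_distr_ne_top (hE : IsSymmetricSpace E) {x : L0 I} (hx : x ∈ E.carrier) :
    ∃ l, distr x l ≠ ∞ := by
  by_contra! h
  have h2 : Equimeasurable x ((2 : ℝ) • x) := fun l => by
    have := distr_smul two_pos x (l / 2)
    rw [h, Real.toNNReal_ofNat, mul_div_cancel₀ l two_ne_zero] at this
    rw [h, this]
  have h3 := (hE.symmetric x hx _ h2).2
  rw [hE.nrm_smul _ x hx, abs_two, ENNReal.ofReal_ofNat, two_mul] at h3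
  have h4 : E.nrm x = 0 := by
    exact (ENNReal.add_left_inj (hE.nrm_lt_top x hx).ne).1 (by rw [zero_add]; exact h3)
  have h5 := h 0
  rw [(hE.nrm_eq_zero x hx).1 h4, distr_zero] at h5
  exact ENNReal.zero_ne_top h5

theorem ae_rearr_ne_top (hE : IsSymmetricSpace E) {x : L0 I} (hx : x ∈ E.carrier) :
    ∀ᵐ t ∂I.measure, rearr x t ≠ ∞ := by
  obtain ⟨l, hl⟩ := hE.exists_distr_ne_top hx
  exact _root_.ae_rearr_ne_top hl

theorem outerNorm_rearr (hE : IsSymmetricSpace E) {x : L0 I} (hx : x ∈ E.carrier) :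
    E.outerNorm (rearr x) ≤ E.nrm x := by
  obtain ⟨l, hl⟩ := hE.exists_distr_ne_top hx
  have h := hE.symmetric x hx _ (equimeasurable_rearr hl)
  rw [← h.2]
  refine outerNorm_le h.1 ?_
  filter_upwards [enorm_toL0 (measurable_rearr x) (hE.ae_rearr_ne_top hx)] with t ht
  exact ht.ge

/-- A function is controlled by any majorant of its rearrangement. -/
theorem nrm_le_outerNorm_of_rearr_le (hE : IsSymmetricSpace E) {x : L0 I} {f : ℝ → ℝ≥0∞}
    (h : ∀ᵐ t ∂I.measure, rearr x t ≤ f t) (hf : E.outerNorm f ≠ ∞) :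
    x ∈ E.carrier ∧ E.nrm x ≤ E.outerNorm f := by
  have h1 : ∀ᵐ t ∂I.measure, rearr x t ≠ ∞ := by
    filter_upwards [h, ae_ne_top_of_outerNorm hf] with t h1 h2 using ne_top_of_le_ne_top h2 h1
  have hl : ∃ l, distr x l ≠ ∞ := by
    by_contra! hall
    have h2 : ∀ t, rearr x t = ∞ := fun t =>
      ENNReal.eq_top_of_forall_nnreal_le fun l => le_rearr_of_le_distr (hall l ▸ le_top)
    have hp : ∀ᵐ t ∂I.measure, False := by
      filter_upwards [h1] with t ht using ht (h2 t)
    have := forall_of_ae_dyadicIndex (p := fun _ => False) hp I.neg_one_mem_indices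
    exact this
  obtain ⟨l, hl⟩ := hl
  set X := toL0 I (rearr x) (measurable_rearr x)
  have hX : ∀ᵐ t ∂I.measure, ‖X t‖ₑ ≤ f t := by
    filter_upwards [enorm_toL0 (measurable_rearr x) h1, h] with t h2 h3
    exact h2.trans_le h3
  have hXE : X ∈ E.carrier := hE.mem_of_outerNorm_ne_top
    (ne_top_of_le_ne_top hf (outerNorm_mono hX))
  have hsym := hE.symmetric X hXE x fun m => (equimeasurable_rearr hl m).symm
  exact ⟨hsym.1, hsym.2.trans_le (hE.nrm_le_outerNorm X hX)⟩

theorem outerNorm_le_of_measure_le (hE : IsSymmetricSpace E) {f g : ℝ → ℝ≥0∞}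
    (hf : Measurable f)
    (h : ∀ l : ℝ≥0, I.measure {t | (l : ℝ≥0∞) < f t} ≤ I.measure {t | (l : ℝ≥0∞) < g t}) :
    E.outerNorm f ≤ E.outerNorm g := by
  refine le_outerNorm fun x hx hgx => ?_
  have h1 : ∀ l : ℝ≥0, I.measure {t | (l : ℝ≥0∞) < f t} ≤ distr x l := fun l => by
    refine (h l).trans ?_
    rw [distr_eq_enorm]
    refine measure_mono_ae ?_
    filter_upwards [hgx] with t ht h1 using lt_of_lt_of_le h1 ht
  obtain ⟨l, hl⟩ := hE.exists_distr_ne_top hx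
  have hfin : ∀ᵐ t ∂I.measure, f t ≠ ∞ := by
    rw [ae_iff]
    by_contra hne
    obtain ⟨m, hm⟩ := exists_distr_lt hl (pos_iff_ne_zero.2 hne)
    refine absurd ((h1 m).trans_lt hm) (not_lt.2 (measure_mono fun t ht => ?_))
    have : f t = ∞ := not_not.1 ht
    change _ < f t
    rw [this]
    exact ENNReal.coe_lt_top
  set y := toL0 I f hf
  have hy : ∀ l, distr y l ≤ distr x l := fun l => (distr_toL0 hf hfin l).trans_le (h1 l)
  have hxr := hE.outerNorm_rearr hx
  have hy2 := hE.nrm_le_outerNorm_of_rearr_le (x := y) (ae_of_all _ (rearr_mono hy))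
    (ne_top_of_le_ne_top (hE.nrm_lt_top x hx).ne hxr)
  refine (outerNorm_le hy2.1 ?_).trans (hy2.2.trans hxr)
  filter_upwards [enorm_toL0 hf hfin] with t ht using ht.ge

end IsSymmetricSpace

/-! ### Dyadic shifts in symmetric spaces -/

theorem measure_inter_dyadicIndex (H : Set ℝ) (hH : MeasurableSet H) (p : ℤ → Prop) :
    I.measure {t | t ∈ H ∧ p (dyadicIndex t)} =
      ∑' k : ℤ, I.measure {t | t ∈ H ∧ dyadicIndex t = k ∧ p k} := by
  have h1 : {t | t ∈ H ∧ p (dyadicIndex t)} = ⋃ k : ℤ, {t | t ∈ H ∧ dyadicIndex t = k ∧ p k} := by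
    ext t
    simp
  rw [h1, measure_iUnion]
  · intro j k hjk
    refine Set.disjoint_left.2 fun t h2 h3 => hjk ?_
    exact h2.2.1.symm.trans h3.2.1
  · intro k
    exact hH.inter ((measurable_dyadicIndex (measurableSet_singleton k)).inter
      (MeasurableSet.const _))

/-- Shifting a dyadic step function to the right moves the value on `[2 ^ (k - 1), 2 ^ k)` to each
half of `[2 ^ k, 2 ^ (k + 1))`. -/
theorem measure_half_shift_le (H : Set ℝ) (hH : MeasurableSet H)
    (hhalf : ∀ k ∈ I.indices, I.measure {t | t ∈ H ∧ dyadicIndex t = k} ≤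
      ENNReal.ofReal (2 ^ (k - 1))) (p : ℤ → Prop) :
    I.measure {t | t ∈ H ∧ p (dyadicIndex t - 1)} ≤ I.measure {t | p (dyadicIndex t)} := by
  have h2 := measure_inter_dyadicIndex (I := I) univ MeasurableSet.univ p
  simp only [mem_univ, true_and] at h2
  have h3 := (Equiv.subRight (1 : ℤ)).tsum_eq fun k => I.measure {t | dyadicIndex t = k ∧ p k}
  rw [measure_inter_dyadicIndex H hH fun k => p (k - 1), h2, ← h3]
  refine ENNReal.tsum_le_tsum fun k => ?_
  rw [Equiv.subRight_apply]
  by_cases hp : p (k - 1)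
  · simp only [hp, and_true]
    by_cases hk : k ∈ I.indices
    · rw [I.measure_dyadicIndex (I.mem_indices_of_le (by omega) hk)]
      exact hhalf k hk
    · refine le_trans (measure_mono (t := {t | dyadicIndex t = k}) fun t ht => ht.2) ?_
      rw [I.measure_dyadicIndex_of_not_mem hk]
      exact bot_le
  · simp [hp]

namespace IsSymmetricSpace

open FunctionSpace

variable {E : FunctionSpace I}

/-- Shifting a dyadic step function to the right costs at most a factor `2`: on either half of each
dyadic interval the shifted function is equimeasurable with a part of the original one. -/
theorem outerNorm_shift_le (hE : IsSymmetricSpace E) (a : ℤ → ℝ≥0∞) :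
    E.outerNorm (dyadicStep fun k => a (k - 1)) ≤ 2 * E.outerNorm (dyadicStep a) := by
  -- The union of the left halves of the dyadic intervals.
  set H : Set ℝ := {t | t < 2 ^ dyadicIndex t * (3 / 2)}
  have hz : Measurable fun t => (2 : ℝ) ^ dyadicIndex t * (3 / 2) :=
    ((measurable_from_top (f := fun k : ℤ => (2 : ℝ) ^ k)).comp
      measurable_dyadicIndex).mul_const _
  have hH : MeasurableSet H := measurableSet_lt measurable_id hz
  have hpart : ∀ (u v : ℤ → ℝ) (H' : Set ℝ), (∀ k, (2 : ℝ) ^ k ≤ u k) →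
      (∀ k, v k ≤ (2 : ℝ) ^ (k + 1)) → (∀ k, v k - u k = 2 ^ (k - 1)) →
      (∀ k t, t ∈ H' → t ∈ Ico ((2 : ℝ) ^ k) (2 ^ (k + 1)) → dyadicIndex t = k →
        t ∈ Ico (u k) (v k)) → ∀ k ∈ I.indices,
      I.measure {t | t ∈ H' ∧ dyadicIndex t = k} ≤ ENNReal.ofReal (2 ^ (k - 1)) := by
    intro u v H' hu hv huv hmem k hk
    rw [← huv, ← I.measure_dyadic_part hk (hu k) (hv k)]
    refine measure_mono_ae ?_
    filter_upwards [I.ae_mem] with t ht h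
    have hp := I.pos_of_mem ht
    refine hmem k t h.1 ?_ h.2
    have h2 : dyadicIndex t = k := h.2
    rw [← h2]
    exact ⟨zpow_dyadicIndex_le hp, lt_zpow_dyadicIndex hp⟩
  have hpos : ∀ k : ℤ, (0 : ℝ) < 2 ^ k := fun k => by positivity
  have h1 := hpart (fun k => 2 ^ k) (fun k => 2 ^ k * (3 / 2)) H (fun k => le_rfl)
    (fun k => by rw [zpow_add_one₀ two_ne_zero]; nlinarith [hpos k])
    (fun k => by rw [zpow_sub_one₀ two_ne_zero]; ring)
    (fun k t ht h2 h3 => ⟨h2.1, by rw [← h3]; exact ht⟩)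
  have h2 := hpart (fun k => 2 ^ k * (3 / 2)) (fun k => 2 ^ (k + 1)) Hᶜ
    (fun k => by nlinarith [hpos k]) (fun k => le_rfl)
    (fun k => by rw [zpow_sub_one₀ two_ne_zero, zpow_add_one₀ two_ne_zero]; ring)
    (fun k t ht h2 h3 => ⟨by rw [← h3]; exact not_lt.1 ht, h2.2⟩)
  have hb : ∀ H' : Set ℝ, MeasurableSet H' → (∀ k ∈ I.indices,
      I.measure {t | t ∈ H' ∧ dyadicIndex t = k} ≤ ENNReal.ofReal (2 ^ (k - 1))) →
      E.outerNorm (H'.indicator (dyadicStep fun k => a (k - 1))) ≤ E.outerNorm (dyadicStep a) := by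
    intro H' hH' h
    refine hE.outerNorm_le_of_measure_le ((measurable_dyadicStep _).indicator hH') fun l => ?_
    refine le_trans (measure_mono fun t ht => ?_)
      (measure_half_shift_le H' hH' h fun k => (l : ℝ≥0∞) < a k)
    have ht' : (l : ℝ≥0∞) < H'.indicator (dyadicStep fun k => a (k - 1)) t := ht
    by_cases hm : t ∈ H'
    · rw [indicator_of_mem hm] at ht'
      exact ⟨hm, ht'⟩
    · simp [indicator_of_notMem hm] at ht'
  calc E.outerNorm (dyadicStep fun k => a (k - 1))
      = E.outerNorm (fun t => H.indicator (dyadicStep fun k => a (k - 1)) t +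
          Hᶜ.indicator (dyadicStep fun k => a (k - 1)) t) := by
        congr 1
        ext t
        exact (congrFun (indicator_self_add_compl H _) t).symm
    _ ≤ _ := hE.outerNorm_add_le _ _
    _ ≤ _ := by
      rw [two_mul]
      exact add_le_add (hb H hH h1) (hb Hᶜ hH.compl h2)

theorem outerNorm_shift_nat_le (hE : IsSymmetricSpace E) (a : ℤ → ℝ≥0∞) (n : ℕ) :
    E.outerNorm (dyadicStep fun k => a (k - n)) ≤ 2 ^ n * E.outerNorm (dyadicStep a) := by
  induction n with
  | zero => simp
  | succ n ih =>
    have h := hE.outerNorm_shift_le fun k => a (k - n)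
    have h1 : ∀ k : ℤ, a (k - (n + 1 : ℕ)) = a (k - 1 - n) := fun k => by
      congr 1
      push_cast
      ring
    simp_rw [h1]
    refine h.trans ?_
    rw [pow_succ', mul_assoc]
    gcongr

/-- The values of the rearrangement at the points `2 ^ (k + 1)` give a minorant of it. -/
theorem outerNorm_dyadic_rearr_le (hE : IsSymmetricSpace E) {x : L0 I} (hx : x ∈ E.carrier) :
    E.outerNorm (dyadicStep fun k => rearr x (2 ^ (k + 1))) ≤ E.nrm x := by
  refine le_trans (outerNorm_mono ?_) (hE.outerNorm_rearr hx)
  filter_upwards [I.ae_mem] with t ht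
  exact antitone_rearr x (lt_zpow_dyadicIndex (I.pos_of_mem ht)).le

theorem outerNorm_dyadic_rearr_le_two (hE : IsSymmetricSpace E) {x : L0 I}
    (hx : x ∈ E.carrier) :
    E.outerNorm (dyadicStep fun k => rearr x (2 ^ k)) ≤ 2 * E.nrm x := by
  have h := hE.outerNorm_shift_le fun k => rearr x (2 ^ (k + 1))
  simp only [sub_add_cancel] at h
  refine h.trans ?_
  gcongr
  exact hE.outerNorm_dyadic_rearr_le hx

/-- The values of the rearrangement at points `2 ^ (k + n)` control the norm. -/
theorem nrm_le_of_dyadic_rearr (hE : IsSymmetricSpace E) {x : L0 I} {a : ℤ → ℝ≥0∞} (n : ℕ)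
    (h : ∀ k ∈ I.indices, rearr x (2 ^ (k + n)) ≤ a k) (ha : E.outerNorm (dyadicStep a) ≠ ∞) :
    x ∈ E.carrier ∧ E.nrm x ≤ 2 ^ n * E.outerNorm (dyadicStep a) := by
  have h1 := hE.outerNorm_shift_nat_le a n
  have h2 : E.outerNorm (dyadicStep fun k => a (k - n)) ≠ ∞ :=
    ne_top_of_le_ne_top (ENNReal.mul_ne_top (by simp) ha) h1
  have h3 := hE.nrm_le_outerNorm_of_rearr_le (x := x) (f := dyadicStep fun k => a (k - n)) ?_ h2
  · exact ⟨h3.1, h3.2.trans h1⟩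
  · filter_upwards [I.ae_mem] with t ht
    refine (antitone_rearr x (zpow_dyadicIndex_le (I.pos_of_mem ht))).trans ?_
    have := h (dyadicIndex t - n) (I.mem_indices_of_le (by omega) (I.dyadicIndex_mem ht))
    rwa [sub_add_cancel] at this

/-- An element whose distribution function is at most `2 ^ n` times that of `x ∈ E` belongs
to `E`. -/
theorem nrm_le_of_distr_le (hE : IsSymmetricSpace E) {x y : L0 I} (hx : x ∈ E.carrier) (n : ℕ)
    (h : ∀ l, distr y l ≤ ENNReal.ofReal (2 ^ n) * distr x l) :
    y ∈ E.carrier ∧ E.nrm y ≤ 2 ^ (n + 1) * E.nrm x := by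
  -- A factor `2 ^ n` in the distribution function is a shift by `n` of the rearrangement.
  have hk : ∀ k : ℤ, rearr y (2 ^ (k + n)) ≤ rearr x (2 ^ k) := by
    intro k
    refine ENNReal.le_of_forall_nnreal_lt fun l hl => le_rearr_of_le_distr ?_
    have h1 : ENNReal.ofReal (2 ^ (k + n)) ≤ distr y l := by
      by_contra hlt
      exact absurd (rearr_le_of_distr_lt (not_le.1 hlt)) (not_le.2 hl)
    have h2 := h1.trans (h l)
    have hp : ENNReal.ofReal (2 ^ n) ≠ 0 := by
      rw [Ne, ENNReal.ofReal_eq_zero, not_le]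
      positivity
    have h3 : (2 : ℝ) ^ (k + n) = 2 ^ n * 2 ^ k := by
      rw [zpow_add₀ two_ne_zero, zpow_natCast, mul_comm]
    rw [h3, ENNReal.ofReal_mul (by positivity)] at h2
    exact (ENNReal.mul_le_mul_iff_right hp ENNReal.ofReal_ne_top).1 h2
  have h1 := hE.outerNorm_dyadic_rearr_le_two hx
  have h2 : E.outerNorm (dyadicStep fun k => rearr x (2 ^ k)) ≠ ∞ :=
    ne_top_of_le_ne_top (ENNReal.mul_ne_top (by simp) (hE.nrm_lt_top x hx).ne) h1
  have h3 := hE.nrm_le_of_dyadic_rearr n (fun k _ => hk k) h2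
  refine ⟨h3.1, h3.2.trans ?_⟩
  rw [pow_succ, mul_assoc]
  gcongr

end IsSymmetricSpace

/-! ### Submultiplicative functions and their indices -/

/-- Fekete's lemma for functions of a real variable. -/
theorem exists_tendsto_div_of_subadditive {h : ℝ → ℝ}
    (hsub : ∀ u ≥ 0, ∀ v ≥ 0, h (u + v) ≤ h u + h v) {C : ℝ} (hC : ∀ u ∈ Icc (0 : ℝ) 1, h u ≤ C)
    {m : ℝ} (hm : ∀ n : ℕ, m * n ≤ h n) : ∃ L, Tendsto (fun u => h u / u) atTop (𝓝 L) := by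
  have hs : Subadditive fun n : ℕ => h n := fun a b => by
    simp only [Nat.cast_add]
    exact hsub _ (Nat.cast_nonneg a) _ (Nat.cast_nonneg b)
  have hb : BddBelow (range fun n : ℕ => h n / n) := by
    refine ⟨min m 0, ?_⟩
    rintro _ ⟨n, rfl⟩
    rcases Nat.eq_zero_or_pos n with rfl | hn
    · simp
    · have : (0 : ℝ) < n := by exact_mod_cast hn
      exact (min_le_left _ _).trans ((le_div_iff₀ this).2 (hm n))
  have hL := hs.tendsto_lim hb
  refine ⟨hs.lim, ?_⟩
  have hf : Tendsto (fun u : ℝ => ⌊u⌋₊) atTop atTop := tendsto_nat_floor_atTop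
  have h1 : Tendsto (fun u : ℝ => (⌊u⌋₊ : ℝ) / u) atTop (𝓝 1) := tendsto_nat_floor_div_atTop
  have hinv : Tendsto (fun u : ℝ => C / u) atTop (𝓝 0) := tendsto_id.const_div_atTop C
  have h2 : Tendsto (fun u : ℝ => ((⌊u⌋₊ + 1 : ℕ) : ℝ) / u) atTop (𝓝 1) := by
    have := h1.add (tendsto_id.const_div_atTop (1 : ℝ))
    rw [add_zero] at this
    refine this.congr fun u => ?_
    push_cast
    simp [add_div]
  -- `h u` lies between `h (⌊u⌋ + 1) - C` and `h ⌊u⌋ + C`.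
  have hup := ((hL.comp hf).mul h1).add hinv
  have hlo := ((hL.comp ((tendsto_add_atTop_nat 1).comp hf)).mul h2).sub hinv
  rw [mul_one, add_zero] at hup
  rw [mul_one, sub_zero] at hlo
  refine tendsto_of_tendsto_of_tendsto_of_le_of_le' hlo hup ?_ ?_
  · filter_upwards [eventually_ge_atTop 1] with u hu
    have hu0 : (0 : ℝ) < u := by linarith
    have hn : ((⌊u⌋₊ + 1 : ℕ) : ℝ) ≠ 0 := by positivity
    have h3 := Nat.lt_floor_add_one u
    have h4 := Nat.floor_le hu0.le
    have h5 := hsub u hu0.le (((⌊u⌋₊ + 1 : ℕ) : ℝ) - u) (by push_cast; linarith)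
    have h6 := hC (((⌊u⌋₊ + 1 : ℕ) : ℝ) - u) ⟨by push_cast; linarith, by push_cast; linarith⟩
    rw [add_sub_cancel] at h5
    simp only [Function.comp_apply]
    rw [div_mul_div_cancel₀ hn, ← sub_div]
    gcongr
    linarith
  · filter_upwards [eventually_ge_atTop 1] with u hu
    have hu0 : (0 : ℝ) < u := by linarith
    have hn : ((⌊u⌋₊ : ℕ) : ℝ) ≠ 0 := by
      have := Nat.floor_pos.2 hu
      positivity
    have h3 := Nat.lt_floor_add_one u
    have h4 := Nat.floor_le hu0.le
    have h5 := hsub ⌊u⌋₊ (Nat.cast_nonneg _) (u - ⌊u⌋₊) (by linarith)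
    have h6 := hC (u - ⌊u⌋₊) ⟨by linarith, by linarith⟩
    rw [add_sub_cancel] at h5
    simp only [Function.comp_apply]
    rw [div_mul_div_cancel₀ hn, ← add_div]
    gcongr
    linarith

/-- A submultiplicative function on `[1, ∞)` has a power type at infinity. -/
theorem exists_tendsto_log_div_log_atTop {g : ℝ → ℝ} (hpos : ∀ s ≥ 1, 0 < g s)
    (hmul : ∀ s ≥ 1, ∀ t ≥ 1, g (s * t) ≤ g s * g t) {C : ℝ}
    (hC : ∀ s ∈ Icc (1 : ℝ) 4, g s ≤ C) {m : ℝ}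
    (hm : ∀ n : ℕ, m * n ≤ Real.log (g (Real.exp n))) :
    ∃ L, Tendsto (fun s => Real.log (g s) / Real.log s) atTop (𝓝 L) := by
  obtain ⟨L, hL⟩ := exists_tendsto_div_of_subadditive (h := fun u => Real.log (g (Real.exp u)))
    (C := Real.log C) (m := m)
    (fun u hu v hv => by
      have h1 := Real.one_le_exp hu
      have h2 := Real.one_le_exp hv
      rw [Real.exp_add, ← Real.log_mul (hpos _ h1).ne' (hpos _ h2).ne']
      exact Real.log_le_log (hpos _ (one_le_mul_of_one_le_of_one_le h1 h2)) (hmul _ h1 _ h2))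
    (fun u hu => by
      refine Real.log_le_log (hpos _ (Real.one_le_exp hu.1)) (hC _ ⟨Real.one_le_exp hu.1, ?_⟩)
      have h1 := Real.exp_le_exp.2 hu.2
      have h2 := Real.exp_one_lt_d9
      linarith)
    hm
  refine ⟨L, (hL.comp Real.tendsto_log_atTop).congr' ?_⟩
  filter_upwards [eventually_gt_atTop 0] with s hs
  simp [Real.exp_log hs]

theorem exists_le_mul_pow_of_eventually {a : ℕ → ℝ} {r : ℝ} (hr : 0 < r) (ha : ∀ i, 0 ≤ a i)
    (h : ∀ᶠ i in atTop, a i ≤ r ^ i) : ∃ C : ℝ≥0, ∀ i, a i ≤ C * r ^ i := by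
  obtain ⟨N, hN⟩ := eventually_atTop.1 h
  have h0 : ∀ i, 0 ≤ a i / r ^ i := fun i => div_nonneg (ha i) (pow_pos hr i).le
  have hS : 0 ≤ ∑ i ∈ Finset.range N, a i / r ^ i := Finset.sum_nonneg fun i _ => h0 i
  refine ⟨⟨1 + ∑ i ∈ Finset.range N, a i / r ^ i, by linarith⟩, fun i => ?_⟩
  rw [← div_le_iff₀ (pow_pos hr i)]
  change _ ≤ 1 + ∑ i ∈ Finset.range N, a i / r ^ i
  rcases lt_or_ge i N with hi | hi
  · have := Finset.single_le_sum (fun i _ => h0 i) (Finset.mem_range.2 hi)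
    linarith
  · have := (div_le_one (pow_pos hr i)).2 (hN i hi)
    linarith

/-- Above the index at infinity, a submultiplicative function is of smaller power order along
powers of `2`. -/
theorem exists_le_mul_pow_of_limUnder_lt {g : ℝ → ℝ} (hpos : ∀ s ≥ 1, 0 < g s)
    (hmul : ∀ s ≥ 1, ∀ t ≥ 1, g (s * t) ≤ g s * g t) {C : ℝ}
    (hC : ∀ s ∈ Icc (1 : ℝ) 4, g s ≤ C) {m : ℝ}
    (hm : ∀ n : ℕ, m * n ≤ Real.log (g (Real.exp n)))
    {q : ℝ} (hq : limUnder atTop (fun s => Real.log (g s) / Real.log s) < q) :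
    ∃ C : ℝ≥0, ∀ i : ℕ, g (2 ^ i) ≤ C * ((2 : ℝ) ^ q) ^ i := by
  have hL := tendsto_nhds_limUnder (exists_tendsto_log_div_log_atTop hpos hmul hC hm)
  have hpow : Tendsto (fun i : ℕ => (2 : ℝ) ^ i) atTop atTop :=
    tendsto_pow_atTop_atTop_of_one_lt one_lt_two
  refine exists_le_mul_pow_of_eventually (by positivity)
    (fun i => (hpos _ (one_le_pow₀ one_le_two)).le) ?_
  filter_upwards [(hL.comp hpow).eventually (gt_mem_nhds hq), eventually_gt_atTop 0] with i h1 h2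
  have h3 : (1 : ℝ) < 2 ^ i := one_lt_pow₀ one_lt_two h2.ne'
  have h4 := (div_lt_iff₀ (Real.log_pos h3)).1 h1
  rw [← Real.rpow_mul_natCast zero_le_two, mul_comm, Real.rpow_natCast_mul zero_le_two]
  have h5 : Real.log (g (2 ^ i)) ≤ Real.log (((2 : ℝ) ^ i) ^ q) := by
    rw [Real.log_rpow (by positivity)]
    exact h4.le
  exact (Real.log_le_log_iff (hpos _ h3.le) (by positivity)).1 h5

/-- Below the index at zero, a submultiplicative function is of larger power order along
powers of `1 / 2`. -/
theorem exists_le_mul_pow_of_lt_limUnder {g : ℝ → ℝ} (hpos : ∀ s, 0 < s → s ≤ 1 → 0 < g s)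
    (hmul : ∀ s, 0 < s → s ≤ 1 → ∀ t, 0 < t → t ≤ 1 → g (s * t) ≤ g s * g t) {C : ℝ}
    (hC : ∀ s, 0 < s → s ≤ 1 → g s ≤ C) {m : ℝ}
    (hm : ∀ n : ℕ, m * n ≤ Real.log (g (Real.exp n)⁻¹))
    {p : ℝ} (hp : p < limUnder (𝓝[>] (0 : ℝ)) (fun s => Real.log (g s) / Real.log s)) :
    ∃ C : ℝ≥0, ∀ i : ℕ, g ((2 ^ i)⁻¹) ≤ C * ((2 : ℝ) ^ (-p)) ^ i := by
  have hi : ∀ s : ℝ, s ≥ 1 → 0 < s⁻¹ ∧ s⁻¹ ≤ 1 := fun s hs =>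
    ⟨inv_pos.2 (by linarith), inv_le_one_of_one_le₀ hs⟩
  have hpos' : ∀ s ≥ (1 : ℝ), 0 < g s⁻¹ := fun s hs => hpos _ (hi s hs).1 (hi s hs).2
  have hmul' : ∀ s ≥ (1 : ℝ), ∀ t ≥ (1 : ℝ), g (s * t)⁻¹ ≤ g s⁻¹ * g t⁻¹ := fun s hs t ht => by
    rw [mul_inv]
    exact hmul _ (hi s hs).1 (hi s hs).2 _ (hi t ht).1 (hi t ht).2
  have hC' : ∀ s ∈ Icc (1 : ℝ) 4, g s⁻¹ ≤ C := fun s hs => hC _ (hi s hs.1).1 (hi s hs.1).2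
  obtain ⟨L, hL⟩ := exists_tendsto_log_div_log_atTop hpos' hmul' hC' hm
  have hL0 : Tendsto (fun s => Real.log (g s) / Real.log s) (𝓝[>] (0 : ℝ)) (𝓝 (-L)) := by
    refine (hL.comp tendsto_inv_nhdsGT_zero).neg.congr fun s => ?_
    simp [div_neg]
  rw [hL0.limUnder_eq] at hp
  refine exists_le_mul_pow_of_limUnder_lt (g := fun s => g s⁻¹) hpos' hmul' hC' hm ?_
  rw [hL.limUnder_eq]
  linarith

/-! ### Dilations in symmetric spaces -/

theorem ae_dilation (s : ℝ) (x : L0 I) :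
    ∀ᵐ t ∂I.measure, dilation s x t = I.set.indicator x (t / s) :=
  AEEqFun.coeFn_mk _ _

theorem ae_comp_div {p : ℝ → Prop} (h : ∀ᵐ t ∂I.measure, p t) {s : ℝ} (hs : 0 < s) :
    ∀ᵐ t ∂I.measure, t / s ∈ I.set → p (t / s) := by
  rw [BaseInterval.measure, ae_restrict_iff' I.measurableSet_set] at h ⊢
  have h1 : ∀ᵐ t : ℝ, t / s ∈ I.set → p (t / s) := by
    rw [ae_iff] at h ⊢
    have h2 := Real.volume_preimage_mul_right (inv_ne_zero hs.ne') {a | ¬ (a ∈ I.set → p a)}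
    rw [h, mul_zero] at h2
    exact h2
  filter_upwards [h1] with t ht _ using ht

theorem distr_dilation_le {s : ℝ} (hs : 0 < s) (x : L0 I) (l : ℝ≥0) :
    distr (dilation s x) l ≤ ENNReal.ofReal s * distr x l := by
  set A : Set ℝ := {t | (l : ℝ) < |x t|} ∩ I.set
  have hx : distr x l = volume A := Measure.restrict_apply (measurableSet_lt_abs x l)
  have h2 := Real.volume_preimage_mul_right (inv_ne_zero hs.ne') A
  rw [inv_inv, abs_of_pos hs] at h2
  rw [hx, ← h2]
  refine le_trans (measure_mono_ae ?_) (Measure.restrict_apply_le I.set _)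
  filter_upwards [ae_dilation s x] with t ht h
  have h3 : (l : ℝ) < |I.set.indicator x (t / s)| := by rw [← ht]; exact h
  by_cases hI : t / s ∈ I.set
  · rw [indicator_of_mem hI] at h3
    exact ⟨h3, hI⟩
  · rw [indicator_of_notMem hI, abs_zero] at h3
    exact absurd l.2 (not_le.2 h3)

theorem dilation_smul {s : ℝ} (hs : 0 < s) (c : ℝ) (x : L0 I) :
    dilation s (c • x) = c • dilation s x := by
  apply AEEqFun.ext
  filter_upwards [ae_dilation s x, ae_dilation s (c • x), AEEqFun.coeFn_smul c (dilation s x),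
    ae_comp_div (AEEqFun.coeFn_smul c x) hs] with t h1 h2 h3 h4
  rw [h2, h3, Pi.smul_apply, h1]
  by_cases hI : t / s ∈ I.set
  · rw [indicator_of_mem hI, indicator_of_mem hI, h4 hI, Pi.smul_apply]
  · rw [indicator_of_notMem hI, indicator_of_notMem hI, smul_zero]

/-- `D_s (D_t x) = D_{s t} x` as soon as `D_t` is not applied to values that `D_s` discards. -/
theorem dilation_dilation {s t : ℝ} (hs : 0 < s) (x : L0 I)
    (h : ∀ r ∈ I.set, r / (s * t) ∈ I.set → r / s ∈ I.set) :
    dilation s (dilation t x) = dilation (s * t) x := by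
  apply AEEqFun.ext
  filter_upwards [ae_dilation s (dilation t x), ae_dilation (s * t) x,
    ae_comp_div (ae_dilation t x) hs, I.ae_mem] with r h1 h2 h3 hr
  rw [h1, h2]
  by_cases hI : r / s ∈ I.set
  · rw [indicator_of_mem hI, h3 hI, div_div]
  · rw [indicator_of_notMem hI, indicator_of_notMem fun hI' => hI (h r hr hI')]

theorem dilation_one (x : L0 I) : dilation 1 x = x := by
  apply AEEqFun.ext
  filter_upwards [ae_dilation 1 x, I.ae_mem] with t h1 ht
  rw [h1, div_one, indicator_of_mem ht]

namespace IsSymmetricSpace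

open FunctionSpace

variable {E : FunctionSpace I}

theorem nrm_le_of_distr_le_one (hE : IsSymmetricSpace E) {x y : L0 I} (hx : x ∈ E.carrier)
    (h : ∀ l, distr y l ≤ distr x l) : y ∈ E.carrier ∧ E.nrm y ≤ E.nrm x := by
  have h1 := hE.outerNorm_rearr hx
  have h2 := hE.nrm_le_outerNorm_of_rearr_le (x := y) (ae_of_all _ (rearr_mono h))
    (ne_top_of_le_ne_top (hE.nrm_lt_top x hx).ne h1)
  exact ⟨h2.1, h2.2.trans h1⟩

theorem dilation_mem_of_le_one (hE : IsSymmetricSpace E) {s : ℝ} (hs : 0 < s) (h1 : s ≤ 1)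
    {x : L0 I} (hx : x ∈ E.carrier) :
    dilation s x ∈ E.carrier ∧ E.nrm (dilation s x) ≤ E.nrm x :=
  hE.nrm_le_of_distr_le_one hx fun l => (distr_dilation_le hs x l).trans <|
    mul_le_of_le_one_left bot_le (ENNReal.ofReal_le_one.2 h1)

theorem dilation_mem_of_le_pow (hE : IsSymmetricSpace E) {s : ℝ} (hs : 0 < s) {n : ℕ}
    (h1 : s ≤ 2 ^ n) {x : L0 I} (hx : x ∈ E.carrier) :
    dilation s x ∈ E.carrier ∧ E.nrm (dilation s x) ≤ 2 ^ (n + 1) * E.nrm x :=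
  hE.nrm_le_of_distr_le hx n fun l => (distr_dilation_le hs x l).trans (by gcongr)

theorem dilation_mem (hE : IsSymmetricSpace E) {s : ℝ} (hs : 0 < s) {x : L0 I}
    (hx : x ∈ E.carrier) : dilation s x ∈ E.carrier := by
  obtain ⟨n, hn⟩ := pow_unbounded_of_one_lt s one_lt_two
  exact (hE.dilation_mem_of_le_pow hs hn.le hx).1

theorem nrm_dilation_le (hE : IsSymmetricSpace E) {s : ℝ} (hs : 0 < s) {x : L0 I}
    (hx : x ∈ E.carrier) : E.nrm (dilation s x) ≤ dilationNorm E s * E.nrm x := by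
  rcases eq_or_ne (E.nrm x) 0 with h0 | h0
  · obtain ⟨n, hn⟩ := pow_unbounded_of_one_lt s one_lt_two
    have := (hE.dilation_mem_of_le_pow hs hn.le hx).2
    rw [h0, mul_zero] at this
    exact this.trans bot_le
  · have hfin := (hE.nrm_lt_top x hx).ne
    set c : ℝ := (E.nrm x).toReal
    have hcpos : 0 < c := ENNReal.toReal_pos h0 hfin
    have hcE : ENNReal.ofReal c = E.nrm x := ENNReal.ofReal_toReal hfin
    have hy := hE.smul_mem c⁻¹ x hx
    have hyn : E.nrm (c⁻¹ • x) = 1 := by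
      rw [hE.nrm_smul _ x hx, abs_of_pos (inv_pos.2 hcpos), ENNReal.ofReal_inv_of_pos hcpos, hcE,
        ENNReal.inv_mul_cancel h0 hfin]
    have h1 : E.nrm (dilation s (c⁻¹ • x)) ≤ dilationNorm E s :=
      le_iSup₂_of_le (c⁻¹ • x) hy (le_iSup_of_le hyn.le le_rfl)
    have h2 : dilation s x = c • dilation s (c⁻¹ • x) := by
      rw [← dilation_smul hs, smul_smul, mul_inv_cancel₀ hcpos.ne', one_smul]
    rw [h2, hE.nrm_smul _ _ (hE.dilation_mem hs hy), abs_of_pos hcpos, hcE, mul_comm]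
    gcongr

theorem dilationNorm_le_one (hE : IsSymmetricSpace E) {s : ℝ} (hs : 0 < s) (h1 : s ≤ 1) :
    dilationNorm E s ≤ 1 :=
  iSup₂_le fun _ hx => iSup_le fun h => (hE.dilation_mem_of_le_one hs h1 hx).2.trans h

theorem dilationNorm_le_pow (hE : IsSymmetricSpace E) {s : ℝ} (hs : 0 < s) {n : ℕ}
    (h1 : s ≤ 2 ^ n) : dilationNorm E s ≤ 2 ^ (n + 1) :=
  iSup₂_le fun _ hx => iSup_le fun h => (hE.dilation_mem_of_le_pow hs h1 hx).2.trans <| by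
    calc _ ≤ (2 : ℝ≥0∞) ^ (n + 1) * 1 := by gcongr
      _ = _ := mul_one _

theorem dilationNorm_ne_top (hE : IsSymmetricSpace E) {s : ℝ} (hs : 0 < s) :
    dilationNorm E s ≠ ∞ := by
  obtain ⟨n, hn⟩ := pow_unbounded_of_one_lt s one_lt_two
  exact ne_top_of_le_ne_top (by simp) (hE.dilationNorm_le_pow hs hn.le)

theorem exists_ne_zero (hE : IsSymmetricSpace E) : ∃ x ∈ E.carrier, x ≠ 0 := by
  have h0 : 0 < I.measure univ := by
    refine lt_of_lt_of_le ?_ (measure_mono (subset_univ {t | dyadicIndex t = -1}))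
    rw [I.measure_dyadicIndex I.neg_one_mem_indices]
    simp
  obtain ⟨B, -, -, hB, -, x, hx, hxB⟩ := hE.saturated univ MeasurableSet.univ h0
  refine ⟨x, hx, fun h => ?_⟩
  refine hB.ne' (measure_mono_null (t := {t | ¬ x t = B.indicator (fun _ => (1 : ℝ)) t} ∪
    {t | ¬ (0 : L0 I) t = 0}) (fun t ht => ?_) (measure_union_null (ae_iff.1 hxB) (ae_iff.1 ?_)))
  · by_contra hn
    simp only [mem_union, mem_ofPred_eq, not_or, not_not] at hn
    rw [indicator_of_mem ht, h, hn.2] at hn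
    exact zero_ne_one hn.1
  · filter_upwards [AEEqFun.coeFn_zero (μ := I.measure) (β := ℝ)] with t ht using ht

theorem dilationNorm_mul_le (hE : IsSymmetricSpace E) {s t : ℝ} (hs : 0 < s) (ht : 0 < t)
    (h : ∀ r ∈ I.set, r / (s * t) ∈ I.set → r / s ∈ I.set) :
    dilationNorm E (s * t) ≤ dilationNorm E s * dilationNorm E t :=
  iSup₂_le fun x hx => iSup_le fun hx1 => by
    rw [← dilation_dilation hs x h]
    refine (hE.nrm_dilation_le hs (hE.dilation_mem ht hx)).trans ?_
    gcongr
    exact le_iSup₂_of_le x hx (le_iSup_of_le hx1 le_rfl)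

theorem one_le_dilationNorm_one (hE : IsSymmetricSpace E) : 1 ≤ dilationNorm E 1 := by
  obtain ⟨x, hx, hx0⟩ := hE.exists_ne_zero
  have h := hE.nrm_dilation_le one_pos hx
  rw [dilation_one] at h
  have h0 : E.nrm x ≠ 0 := fun h0 => hx0 ((hE.nrm_eq_zero x hx).1 h0)
  exact (ENNReal.mul_le_mul_iff_left h0 (hE.nrm_lt_top x hx).ne).1 (by rwa [one_mul])

theorem one_le_dilationNorm_inv_mul (hE : IsSymmetricSpace E) {s : ℝ} (hs : 0 < s)
    (h1 : s ≤ 1) : 1 ≤ dilationNorm E s⁻¹ * dilationNorm E s := by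
  have h := hE.dilationNorm_mul_le (inv_pos.2 hs) hs fun r hr _ =>
    I.mem_of_le (by have := I.pos_of_mem hr; positivity)
      (by rw [div_inv_eq_mul]; exact mul_le_of_le_one_right (I.pos_of_mem hr).le h1) hr
  rw [inv_mul_cancel₀ hs.ne'] at h
  exact hE.one_le_dilationNorm_one.trans h

theorem dilationNorm_mul_le_of_one_le (hE : IsSymmetricSpace E) {s t : ℝ} (hs : 1 ≤ s)
    (ht : 1 ≤ t) : dilationNorm E (s * t) ≤ dilationNorm E s * dilationNorm E t :=
  hE.dilationNorm_mul_le (by linarith) (by linarith) fun r hr _ =>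
    I.mem_of_le (by have := I.pos_of_mem hr; positivity) (div_le_self (I.pos_of_mem hr).le hs) hr

theorem dilationNorm_mul_le_of_le_one (hE : IsSymmetricSpace E) {s t : ℝ} (hs : 0 < s)
    (ht : 0 < t) (ht1 : t ≤ 1) :
    dilationNorm E (s * t) ≤ dilationNorm E s * dilationNorm E t :=
  hE.dilationNorm_mul_le hs ht fun r hr h => by
    have hr0 := I.pos_of_mem hr
    refine I.mem_of_le (by positivity) ?_ h
    gcongr
    exact mul_le_of_le_one_right hs.le ht1

theorem dilationNorm_pos (hE : IsSymmetricSpace E) {s : ℝ} (hs : 0 < s) (h1 : s ≤ 1) :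
    dilationNorm E s ≠ 0 ∧ 1 ≤ dilationNorm E s⁻¹ := by
  have h := hE.one_le_dilationNorm_inv_mul hs h1
  refine ⟨fun h0 => ?_, h.trans (mul_le_of_le_one_right bot_le (hE.dilationNorm_le_one hs h1))⟩
  rw [h0, mul_zero] at h
  exact absurd h (by simp)

theorem one_le_dilationNorm (hE : IsSymmetricSpace E) {s : ℝ} (hs : 1 ≤ s) :
    1 ≤ (dilationNorm E s).toReal := by
  have h := (hE.dilationNorm_pos (inv_pos.2 (by linarith : (0 : ℝ) < s))
    (inv_le_one_of_one_le₀ hs)).2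
  rw [inv_inv] at h
  simpa using ENNReal.toReal_mono (hE.dilationNorm_ne_top (by linarith)) h

theorem toReal_dilationNorm_mul_le (hE : IsSymmetricSpace E) {s t : ℝ} (hs : 1 ≤ s)
    (ht : 1 ≤ t) :
    (dilationNorm E (s * t)).toReal ≤ (dilationNorm E s).toReal * (dilationNorm E t).toReal := by
  rw [← ENNReal.toReal_mul]
  exact ENNReal.toReal_mono (ENNReal.mul_ne_top (hE.dilationNorm_ne_top (by linarith))
    (hE.dilationNorm_ne_top (by linarith))) (hE.dilationNorm_mul_le_of_one_le hs ht)

theorem toReal_dilationNorm_le_eight (hE : IsSymmetricSpace E) {s : ℝ}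
    (hs : s ∈ Icc (1 : ℝ) 4) : (dilationNorm E s).toReal ≤ 8 := by
  have h := hE.dilationNorm_le_pow (n := 2) (s := s) (by linarith [hs.1]) (by linarith [hs.2])
  have h1 := ENNReal.toReal_mono (by simp) h
  simp only [ENNReal.toReal_pow, ENNReal.toReal_ofNat] at h1
  norm_num at h1
  exact h1

/-- The upper Boyd index controls the dilations by powers of `2`. -/
theorem exists_dilationNorm_two_pow_le (hE : IsSymmetricSpace E) {β : ℝ}
    (hβ : upperBoydIndex E < β) :
    ∃ C : ℝ≥0, ∀ i : ℕ, (dilationNorm E (2 ^ i)).toReal ≤ C * ((2 : ℝ) ^ β) ^ i :=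
  exists_le_mul_pow_of_limUnder_lt (g := fun s => (dilationNorm E s).toReal) (m := 0)
    (fun _ hs => zero_lt_one.trans_le (hE.one_le_dilationNorm hs))
    (fun _ hs _ ht => hE.toReal_dilationNorm_mul_le hs ht)
    (fun _ hs => hE.toReal_dilationNorm_le_eight hs)
    (fun n => by
      rw [zero_mul]
      exact Real.log_nonneg (hE.one_le_dilationNorm (Real.one_le_exp (Nat.cast_nonneg n)))) hβ

/-- The lower Boyd index controls the dilations by powers of `1 / 2`. -/
theorem exists_dilationNorm_inv_two_pow_le (hE : IsSymmetricSpace E) {α : ℝ}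
    (hα : α < lowerBoydIndex E) :
    ∃ C : ℝ≥0, ∀ i : ℕ, (dilationNorm E (2 ^ i)⁻¹).toReal ≤ C * ((2 : ℝ) ^ (-α)) ^ i := by
  have hpow : ∀ n : ℕ, (dilationNorm E (Real.exp n)).toReal ≤
      (dilationNorm E (Real.exp 1)).toReal ^ n := fun n => by
    induction n with
    | zero =>
      have := ENNReal.toReal_mono ENNReal.one_ne_top (hE.dilationNorm_le_one one_pos le_rfl)
      simpa using this
    | succ n ih =>
      rw [Nat.cast_succ, Real.exp_add, pow_succ]
      refine (hE.toReal_dilationNorm_mul_le (Real.one_le_exp (Nat.cast_nonneg n))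
        (Real.one_le_exp zero_le_one)).trans ?_
      gcongr
  have hfin : ∀ s, 0 < s → dilationNorm E s ≠ ∞ := fun s => hE.dilationNorm_ne_top
  have hpos : ∀ s, 0 < s → s ≤ 1 → 0 < (dilationNorm E s).toReal := fun s hs h1 =>
    ENNReal.toReal_pos (hE.dilationNorm_pos hs h1).1 (hfin s hs)
  refine exists_le_mul_pow_of_lt_limUnder (g := fun s => (dilationNorm E s).toReal) (C := 1)
    (m := -Real.log (dilationNorm E (Real.exp 1)).toReal) hpos ?_ ?_ ?_ hα
  · intro s hs _ t ht ht1
    rw [← ENNReal.toReal_mul]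
    exact ENNReal.toReal_mono (ENNReal.mul_ne_top (hfin s hs) (hfin t ht))
      (hE.dilationNorm_mul_le_of_le_one hs ht ht1)
  · intro s hs h1
    simpa using ENNReal.toReal_mono ENNReal.one_ne_top (hE.dilationNorm_le_one hs h1)
  · intro n
    -- `‖D_{exp (-n)}‖ ≥ 1 / ‖D_{exp n}‖ ≥ ‖D_e‖ ^ (-n)`
    have he : (0 : ℝ) < (Real.exp n)⁻¹ := by positivity
    have he1 : (Real.exp n)⁻¹ ≤ 1 := inv_le_one_of_one_le₀ (Real.one_le_exp (Nat.cast_nonneg n))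
    have h1 := hE.one_le_dilationNorm_inv_mul he he1
    rw [inv_inv] at h1
    have h2 := ENNReal.toReal_mono (ENNReal.mul_ne_top (hfin _ (Real.exp_pos n)) (hfin _ he)) h1
    rw [ENNReal.toReal_one, ENNReal.toReal_mul] at h2
    have hg : 0 < (dilationNorm E (Real.exp n)).toReal :=
      zero_lt_one.trans_le (hE.one_le_dilationNorm (Real.one_le_exp (Nat.cast_nonneg n)))
    have h3 := Real.log_le_log one_pos h2
    rw [Real.log_one, Real.log_mul hg.ne' (hpos _ he he1).ne'] at h3
    have h4 := Real.log_le_log hg (hpow n)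
    rw [Real.log_pow] at h4
    linarith

end IsSymmetricSpace

/-! ### Indices of a concave function -/

section Concave

variable {φ : ℝ → ℝ}

/-- A positive concave function satisfies `φ t ≤ 2 (t / s) φ s` for `s ≤ t`. -/
theorem ConcaveOn.le_two_mul_div (hconc : ConcaveOn ℝ I.set φ) (hpos : ∀ t ∈ I.set, 0 < φ t)
    {s t : ℝ} (hs : 0 < s) (hst : s ≤ t) (ht : t ∈ I.set) : φ t ≤ 2 * (t / s) * φ s := by
  have ht0 := I.pos_of_mem ht
  have hr : s / 2 ∈ I.set := I.mem_of_le (by positivity) (by linarith) ht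
  have hd : 0 < t - s / 2 := by linarith
  have h := hconc.2 hr ht
    (show 0 ≤ (t - s) / (t - s / 2) from div_nonneg (by linarith) hd.le)
    (show 0 ≤ (s / 2) / (t - s / 2) by positivity)
    (by rw [← add_div, div_eq_one_iff_eq hd.ne']; ring)
  have he : ((t - s) / (t - s / 2)) • (s / 2) + ((s / 2) / (t - s / 2)) • t = s := by
    rw [smul_eq_mul, smul_eq_mul, div_mul_eq_mul_div, div_mul_eq_mul_div, ← add_div,
      div_eq_iff hd.ne']
    ring
  rw [he, smul_eq_mul, smul_eq_mul] at h
  have h1 : 0 ≤ (t - s) / (t - s / 2) * φ (s / 2) :=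
    mul_nonneg (div_nonneg (by linarith) hd.le) (hpos _ hr).le
  have h2 : s / 2 / t * φ t ≤ (s / 2) / (t - s / 2) * φ t := by
    have := (hpos t ht).le
    gcongr
    linarith
  have h3 : s / 2 / t * φ t ≤ φ s := by linarith
  calc φ t = 2 * (t / s) * (s / 2 / t * φ t) := by field_simp
    _ ≤ _ := by gcongr

theorem exists_mem_mul_mem {t : ℝ} (ht : 0 < t) : ∃ s ∈ I.set, s * t ∈ I.set := by
  cases I
  · refine ⟨1 / (2 * (1 + t)), ⟨by positivity, ?_⟩, by positivity, ?_⟩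
    · rw [div_lt_one (by positivity)]
      linarith
    · rw [div_mul_eq_mul_div, div_lt_one (by positivity)]
      linarith
  · exact ⟨1, mem_Ioi.2 one_pos, by simpa [BaseInterval.set] using ht⟩

theorem ratio_le (hpos : ∀ t ∈ I.set, 0 < φ t) (hmono : MonotoneOn φ I.set)
    (hconc : ConcaveOn ℝ I.set φ) {s t : ℝ} (hs : s ∈ I.set) (hst : s * t ∈ I.set) :
    φ (s * t) / φ s ≤ max 1 (2 * t) := by
  have hs0 := I.pos_of_mem hs
  rw [div_le_iff₀ (hpos s hs)]
  rcases le_total t 1 with h | h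
  · have h1 : φ (s * t) ≤ φ s := hmono hst hs (mul_le_of_le_one_right hs0.le h)
    nlinarith [le_max_left 1 (2 * t), hpos s hs]
  · have h1 := hconc.le_two_mul_div hpos hs0 (le_mul_of_one_le_right hs0.le h) hst
    rw [mul_div_cancel_left₀ t hs0.ne'] at h1
    nlinarith [le_max_right 1 (2 * t), hpos s hs]

theorem ratio_le_dilationFun (hpos : ∀ t ∈ I.set, 0 < φ t) (hmono : MonotoneOn φ I.set)
    (hconc : ConcaveOn ℝ I.set φ) {s t : ℝ} (hs : s ∈ I.set) (hst : s * t ∈ I.set) :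
    φ (s * t) / φ s ≤ dilationFun I φ t := by
  refine le_csSup ⟨max 1 (2 * t), ?_⟩ ⟨s, hs, hst, rfl⟩
  rintro _ ⟨r, hr, hrt, rfl⟩
  exact ratio_le hpos hmono hconc hr hrt

theorem dilationFun_le {t C : ℝ} (ht : 0 < t)
    (h : ∀ s ∈ I.set, s * t ∈ I.set → φ (s * t) / φ s ≤ C) : dilationFun I φ t ≤ C := by
  obtain ⟨s, hs, hst⟩ := exists_mem_mul_mem (I := I) ht
  refine csSup_le ⟨_, s, hs, hst, rfl⟩ ?_
  rintro _ ⟨r, hr, hrt, rfl⟩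
  exact h r hr hrt

theorem dilationFun_pos (hpos : ∀ t ∈ I.set, 0 < φ t) (hmono : MonotoneOn φ I.set)
    (hconc : ConcaveOn ℝ I.set φ) {t : ℝ} (ht : 0 < t) : 0 < dilationFun I φ t := by
  obtain ⟨s, hs, hst⟩ := exists_mem_mul_mem (I := I) ht
  exact (div_pos (hpos _ hst) (hpos s hs)).trans_le (ratio_le_dilationFun hpos hmono hconc hs hst)

theorem dilationFun_mul_le (hpos : ∀ t ∈ I.set, 0 < φ t) (hmono : MonotoneOn φ I.set)
    (hconc : ConcaveOn ℝ I.set φ) {s t : ℝ} (hs : 0 < s) (ht : 0 < t)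
    (h : ∀ r ∈ I.set, r * (s * t) ∈ I.set → r * s ∈ I.set) :
    dilationFun I φ (s * t) ≤ dilationFun I φ s * dilationFun I φ t := by
  refine dilationFun_le (by positivity) fun r hr hrst => ?_
  have hrs := h r hr hrst
  have hrst' : r * s * t ∈ I.set := by rwa [mul_assoc]
  have h1 := ratio_le_dilationFun hpos hmono hconc hr hrs
  have h2 := ratio_le_dilationFun hpos hmono hconc hrs hrst'
  calc φ (r * (s * t)) / φ r = φ (r * s) / φ r * (φ (r * s * t) / φ (r * s)) := by
        have := (hpos _ hrs).ne'
        rw [mul_assoc]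
        field_simp
    _ ≤ _ := mul_le_mul h1 h2 (div_pos (hpos _ hrst') (hpos _ hrs)).le
        (dilationFun_pos hpos hmono hconc hs).le

/-- The upper index controls the growth of `φ`. -/
theorem exists_ratio_le_of_upperIndex_lt (hpos : ∀ t ∈ I.set, 0 < φ t) (hmono : MonotoneOn φ I.set)
    (hconc : ConcaveOn ℝ I.set φ) {q : ℝ} (hq : upperIndex I φ < q) :
    ∃ C : ℝ≥0, ∀ (i : ℕ) (s : ℝ), s ∈ I.set → s * 2 ^ i ∈ I.set →
      φ (s * 2 ^ i) ≤ C * ((2 : ℝ) ^ q) ^ i * φ s := by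
  obtain ⟨C, hC⟩ := exists_le_mul_pow_of_limUnder_lt (g := dilationFun I φ) (C := 8) (m := 0)
    (fun s hs => dilationFun_pos hpos hmono hconc (by linarith))
    (fun s hs t ht => dilationFun_mul_le hpos hmono hconc (by linarith) (by linarith)
      fun r hr hrst => by
        have hr0 := I.pos_of_mem hr
        refine I.mem_of_le (by positivity) ?_ hrst
        gcongr
        exact le_mul_of_one_le_right (by linarith) ht)
    (fun s hs => dilationFun_le (by linarith [hs.1]) fun r hr hrs =>
      (ratio_le hpos hmono hconc hr hrs).trans
        (max_le (by norm_num) (by linarith [hs.2])))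
    (fun n => by
      rw [zero_mul]
      refine Real.log_nonneg ?_
      obtain ⟨s, hs, hst⟩ := exists_mem_mul_mem (I := I) (Real.exp_pos n)
      refine le_trans ?_ (ratio_le_dilationFun hpos hmono hconc hs hst)
      rw [one_le_div (hpos s hs)]
      exact hmono hs hst (le_mul_of_one_le_right (I.pos_of_mem hs).le
        (Real.one_le_exp (Nat.cast_nonneg n)))) hq
  refine ⟨C, fun i s hs hst => ?_⟩
  rw [← div_le_iff₀ (hpos s hs)]
  exact (ratio_le_dilationFun hpos hmono hconc hs hst).trans (hC i)

/-- The lower index controls the decay of `φ` at zero. -/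
theorem exists_ratio_le_of_lt_lowerIndex (hpos : ∀ t ∈ I.set, 0 < φ t) (hmono : MonotoneOn φ I.set)
    (hconc : ConcaveOn ℝ I.set φ) {p : ℝ} (hp : p < lowerIndex I φ) :
    ∃ C : ℝ≥0, ∀ (i : ℕ) (s : ℝ), s ∈ I.set →
      φ (s / 2 ^ i) ≤ C * ((2 : ℝ) ^ (-p)) ^ i * φ s := by
  obtain ⟨C, hC⟩ := exists_le_mul_pow_of_lt_limUnder (g := dilationFun I φ) (C := 1) (m := -2)
    (fun s hs _ => dilationFun_pos hpos hmono hconc hs)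
    (fun s hs hs1 t ht ht1 => dilationFun_mul_le hpos hmono hconc hs ht
      fun r hr _ => by
        have hr0 := I.pos_of_mem hr
        exact I.mem_of_le (by positivity) (mul_le_of_le_one_right hr0.le hs1) hr)
    (fun s hs hs1 => dilationFun_le hs fun r hr hrs => by
      rw [div_le_one (hpos r hr)]
      exact hmono hrs hr (mul_le_of_le_one_right (I.pos_of_mem hr).le hs1))
    (fun n => by
      rcases Nat.eq_zero_or_pos n with rfl | hn
      · refine (by simp : (-2 : ℝ) * (0 : ℕ) ≤ 0).trans (Real.log_nonneg ?_)
        obtain ⟨s, hs, hst⟩ := exists_mem_mul_mem (I := I) one_pos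
        refine le_trans (le_of_eq ?_) (ratio_le_dilationFun hpos hmono hconc hs
          (by simpa using hs))
        simp [(hpos s hs).ne']
      · have he : (0 : ℝ) < (Real.exp n)⁻¹ := by positivity
        have he1 : (1 : ℝ) ≤ Real.exp n := Real.one_le_exp (Nat.cast_nonneg n)
        obtain ⟨s, hs, hst⟩ := exists_mem_mul_mem (I := I) he
        have hs0 := I.pos_of_mem hs
        have h1 := ratio_le_dilationFun hpos hmono hconc hs hst
        have h2 := hconc.le_two_mul_div hpos (I.pos_of_mem hst)
          (mul_le_of_le_one_right hs0.le (inv_le_one_of_one_le₀ he1)) hs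
        have h3 : (2 * Real.exp n)⁻¹ ≤ φ (s * (Real.exp n)⁻¹) / φ s := by
          rw [le_div_iff₀ (hpos s hs), inv_mul_le_iff₀ (by positivity)]
          refine h2.trans (le_of_eq ?_)
          field_simp
        have h4 := Real.log_le_log (by positivity) (h3.trans h1)
        rw [Real.log_inv, Real.log_mul two_ne_zero (Real.exp_pos _).ne', Real.log_exp] at h4
        have h5 := Real.log_two_lt_d9
        have h6 : (1 : ℝ) ≤ n := by exact_mod_cast hn
        linarith) hp
  refine ⟨C, fun i s hs => ?_⟩
  have hs0 := I.pos_of_mem hs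
  rw [← div_le_iff₀ (hpos s hs), div_eq_mul_inv s]
  exact (ratio_le_dilationFun hpos hmono hconc hs
    (I.mem_of_le (by positivity) (mul_le_of_le_one_right hs0.le
      (inv_le_one_of_one_le₀ (one_le_pow₀ one_le_two))) hs)).trans (hC i)

end Concave

/-! ### Transfer of dyadic sequences along a function -/

/-- The values `x^*(2 ^ k)` at the dyadic points of the base interval, and `0` elsewhere. -/
def dyadicRearr (x : L0 I) (k : ℤ) : ℝ≥0∞ := by
  classical exact if k ∈ I.indices then rearr x (2 ^ k) else 0

theorem dyadicRearr_of_mem {k : ℤ} (hk : k ∈ I.indices) (x : L0 I) :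
    dyadicRearr x k = rearr x (2 ^ k) := if_pos hk

theorem dyadicRearr_of_not_mem {k : ℤ} (hk : k ∉ I.indices) (x : L0 I) :
    dyadicRearr x k = 0 := if_neg hk

theorem antitone_dyadicRearr (x : L0 I) : Antitone (dyadicRearr x) := by
  intro j k hjk
  by_cases hk : k ∈ I.indices
  · rw [dyadicRearr_of_mem hk, dyadicRearr_of_mem (I.mem_indices_of_le hjk hk)]
    exact antitone_rearr x (zpow_le_zpow_right₀ one_le_two hjk)
  · rw [dyadicRearr_of_not_mem hk]
    exact bot_le

theorem measure_dyadicRearr_lt_le (x : L0 I) (k : ℤ) :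
    I.measure {t | dyadicRearr x k < ‖x t‖ₑ} ≤ ENNReal.ofReal (2 ^ k) := by
  by_cases hk : k ∈ I.indices
  · rw [dyadicRearr_of_mem hk]
    rcases eq_or_ne (rearr x (2 ^ k)) ∞ with h | h
    · simp [h]
    · lift rearr x (2 ^ k) to ℝ≥0 using h with l hl
      rw [← distr_eq_enorm]
      exact distr_le_of_rearr_le hl.ge
  · exact (measure_mono (subset_univ _)).trans (I.measure_univ_le_of_not_mem hk)

/-- The function which takes the value `a k` where `|z|` lies between `z^*(2 ^ (k + 1))` and
`z^*(2 ^ k)`. It arranges the values of a decreasing sequence `a` over the base interval in the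
same order as the values of `|z|`, which replaces the composition with a measure preserving map
carrying `z^*` to `|z|`. The supremum is the value at the least admissible index, `a` being
decreasing. -/
def rankStep (z : L0 I) (a : ℤ → ℝ≥0∞) (t : ℝ) : ℝ≥0∞ :=
  ⨆ k : ℤ, {t | dyadicRearr z (k + 1) < ‖z t‖ₑ}.indicator (fun _ => a k) t

theorem measurable_rankStep (z : L0 I) (a : ℤ → ℝ≥0∞) : Measurable (rankStep z a) :=
  Measurable.iSup fun _ => measurable_const.indicator
    (measurableSet_lt measurable_const (AEEqFun.measurable z).enorm)

theorem measure_lt_rankStep_le (z : L0 I) {a : ℤ → ℝ≥0∞} (ha : Antitone a) (k : ℤ) :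
    I.measure {t | a k < rankStep z a t} ≤ ENNReal.ofReal (2 ^ k) := by
  refine le_trans (measure_mono fun t ht => ?_) (measure_dyadicRearr_lt_le z k)
  have ht' : a k < rankStep z a t := ht
  obtain ⟨j, hj⟩ := lt_iSup_iff.1 ht'
  by_cases hm : t ∈ {t | dyadicRearr z (j + 1) < ‖z t‖ₑ}
  · rw [indicator_of_mem hm] at hj
    have hjk : j < k := by
      by_contra hlt
      exact absurd (ha (not_lt.1 hlt)) (not_le.2 hj)
    exact lt_of_le_of_lt (antitone_dyadicRearr z hjk) hm
  · rw [indicator_of_notMem hm] at hj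
    exact absurd hj not_lt_bot

theorem eq_zero_of_forall_le_zpow {d : ℝ≥0∞}
    (h : ∀ k ∈ I.indices, d ≤ ENNReal.ofReal (2 ^ k)) : d = 0 := by
  have h1 : Tendsto (fun n : ℕ => ENNReal.ofReal ((1 / 2 : ℝ) ^ n)) atTop (𝓝 0) := by
    have := ENNReal.tendsto_ofReal (tendsto_pow_atTop_nhds_zero_of_lt_one (r := (1 / 2 : ℝ))
      (by norm_num) (by norm_num))
    simpa using this
  refine le_antisymm (ge_of_tendsto h1 ?_) bot_le
  filter_upwards [eventually_ge_atTop 1] with n hn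
  have h2 := h (-n) (I.mem_indices_of_le (by omega) I.neg_one_mem_indices)
  rwa [zpow_neg, zpow_natCast, ← inv_pow, ← one_div] at h2

theorem ae_rankStep_ne_top (z : L0 I) {a : ℤ → ℝ≥0∞} (ha : Antitone a) (hfin : ∀ k, a k ≠ ∞) :
    ∀ᵐ t ∂I.measure, rankStep z a t ≠ ∞ := by
  rw [ae_iff]
  refine eq_zero_of_forall_le_zpow (I := I) fun k _ => ?_
  refine le_trans (measure_mono fun t ht => ?_) (measure_lt_rankStep_le z ha k)
  have : rankStep z a t = ∞ := not_not.1 ht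
  exact (lt_top_iff_ne_top.2 (hfin k)).trans_eq this.symm

/-- Almost every point of the support of `z` has a rank. -/
theorem ae_exists_dyadicRearr {z : L0 I} (hz : ∀ l : ℝ≥0, 0 < l → distr z l ≠ ∞) :
    ∀ᵐ t ∂I.measure, z t ≠ 0 → ∃ k ∈ I.indices, ‖z t‖ₑ ≤ rearr z (2 ^ k) ∧
      dyadicRearr z (k + 1) < ‖z t‖ₑ := by
  have h1 : ∀ᵐ t ∂I.measure, ¬ ∀ k, dyadicRearr z k < ‖z t‖ₑ := by
    rw [ae_iff]
    refine eq_zero_of_forall_le_zpow (I := I) fun k _ => ?_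
    refine le_trans (measure_mono fun t ht => ?_) (measure_dyadicRearr_lt_le z k)
    exact not_not.1 ht k
  filter_upwards [h1] with t ht hzt
  push Not at ht
  obtain ⟨l, hl0, hl⟩ : ∃ l : ℝ≥0, 0 < l ∧ (l : ℝ≥0∞) < ‖z t‖ₑ := by
    obtain ⟨l, h2, h3⟩ := ENNReal.lt_iff_exists_nnreal_btwn.1 (enorm_pos.2 hzt)
    exact ⟨l, by simpa using h2, h3⟩
  have hbdd : ∃ b, ∀ k, ‖z t‖ₑ ≤ dyadicRearr z k → k ≤ b := by
    obtain ⟨n, hn⟩ := pow_unbounded_of_one_lt (distr z l).toReal (one_lt_two (α := ℝ))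
    refine ⟨n, fun k hk => ?_⟩
    by_contra hlt
    have h2 : rearr z (2 ^ (n : ℤ)) ≤ l := by
      refine rearr_le_of_distr_lt ?_
      rw [zpow_natCast]
      exact (ENNReal.lt_ofReal_iff_toReal_lt (hz l hl0)).2 hn
    have h3 : dyadicRearr z k ≤ rearr z (2 ^ (n : ℤ)) := by
      refine (antitone_dyadicRearr z (not_le.1 hlt).le).trans ?_
      by_cases hnI : (n : ℤ) ∈ I.indices
      · rw [dyadicRearr_of_mem hnI]
      · rw [dyadicRearr_of_not_mem hnI]
        exact bot_le
    exact absurd (hk.trans (h3.trans h2)) (not_le.2 hl)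
  obtain ⟨k, hk, hmax⟩ := Int.exists_greatest_of_bdd hbdd ht
  have hkI : k ∈ I.indices := by
    by_contra hn
    rw [dyadicRearr_of_not_mem hn] at hk
    exact absurd hk (not_le.2 (enorm_pos.2 hzt))
  refine ⟨k, hkI, by rwa [dyadicRearr_of_mem hkI] at hk, ?_⟩
  by_contra hn
  have := hmax (k + 1) (not_lt.1 hn)
  omega

theorem rearr_le_of_forall_distr {x : L0 I} {a : ℝ≥0∞} {k : ℤ}
    (h : ∀ l : ℝ≥0, a ≤ l → distr x l ≤ ENNReal.ofReal (2 ^ k)) : rearr x (2 ^ (k + 1)) ≤ a := by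
  rcases eq_or_ne a ∞ with rfl | ha
  · exact le_top
  lift a to ℝ≥0 using ha
  refine rearr_le_of_distr_lt ((h a le_rfl).trans_lt ?_)
  rw [ENNReal.ofReal_lt_ofReal_iff (by positivity)]
  exact zpow_lt_zpow_right₀ one_lt_two (by omega)

theorem rearr_mul_le {x y : L0 I} {a b : ℝ≥0∞} (ha : a ≠ ∞) (hb : b ≠ ∞) {k : ℤ}
    (hx : rearr x (2 ^ k) ≤ a) (hy : rearr y (2 ^ k) ≤ b) :
    rearr (x * y) (2 ^ (k + 2)) ≤ a * b := by
  lift a to ℝ≥0 using ha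
  lift b to ℝ≥0 using hb
  rw [← ENNReal.coe_mul]
  have hp : (0 : ℝ) < 2 ^ k := by positivity
  refine rearr_le_of_distr_lt (((distr_mul_le x y a b).trans
    (add_le_add (distr_le_of_rearr_le hx) (distr_le_of_rearr_le hy))).trans_lt ?_)
  rw [← ENNReal.ofReal_add hp.le hp.le, ENNReal.ofReal_lt_ofReal_iff (by positivity),
    zpow_add₀ two_ne_zero]
  norm_num
  linarith

/-- A factorization of the dyadic values of `z^*` into decreasing sequences yields a factorization
of `z` into functions whose rearrangements are controlled by these sequences. -/
theorem exists_factorization {z : L0 I} (hz : ∀ l : ℝ≥0, 0 < l → distr z l ≠ ∞)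
    {a u : ℤ → ℝ≥0∞} (ha : Antitone a) (hu : Antitone u) (hfin : ∀ k, u k ≠ ∞)
    (h : ∀ k ∈ I.indices, rearr z (2 ^ k) ≤ a k * u k) :
    ∃ x y : L0 I, z = x * y ∧ (∀ k : ℤ, rearr x (2 ^ (k + 1)) ≤ a k) ∧
      ∀ k : ℤ, rearr y (2 ^ (k + 1)) ≤ u k := by
  have hufin := ae_rankStep_ne_top z hu hfin
  set y := toL0 I (rankStep z u) (measurable_rankStep z u) with hy
  have hyn := enorm_toL0 (measurable_rankStep z u) hufin
  have hxm : Measurable fun t => z t * (y t)⁻¹ :=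
    (AEEqFun.measurable z).mul (AEEqFun.measurable y).inv
  set x : L0 I := AEEqFun.mk (fun t => z t * (y t)⁻¹) hxm.aestronglyMeasurable
  have hxc : ∀ᵐ t ∂I.measure, x t = z t * (y t)⁻¹ := AEEqFun.coeFn_mk _ _
  -- The factor `y` has no zeros on the support of `z`, so `x = z / y` is a factor there.
  have hkey : ∀ᵐ t ∂I.measure, z t ≠ 0 → y t ≠ 0 ∧ ‖z t‖ₑ ≤ rankStep z a t * ‖y t‖ₑ := by
    filter_upwards [ae_exists_dyadicRearr hz, hyn] with t h1 h2 hzt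
    obtain ⟨k, hk, h3, h4⟩ := h1 hzt
    have h5 : ∀ b : ℤ → ℝ≥0∞, b k ≤ rankStep z b t := fun b => by
      refine le_iSup_of_le k ?_
      rw [indicator_of_mem]
      exact h4
    have h6 : ‖z t‖ₑ ≤ rankStep z a t * ‖y t‖ₑ := by
      rw [h2]
      exact h3.trans ((h k hk).trans (mul_le_mul' (h5 a) (h5 u)))
    refine ⟨fun h0 => ?_, h6⟩
    rw [h0, enorm_zero, mul_zero] at h6
    exact hzt (enorm_eq_zero.1 (le_antisymm h6 bot_le))
  have hxle : ∀ᵐ t ∂I.measure, ‖x t‖ₑ ≤ rankStep z a t := by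
    filter_upwards [hxc, hkey] with t h1 h2
    rcases eq_or_ne (z t) 0 with h0 | h0
    · simp [h1, h0]
    · obtain ⟨h3, h4⟩ := h2 h0
      have h5 : ‖y t‖ₑ ≠ 0 := enorm_ne_zero.2 h3
      rw [h1, enorm_mul, enorm_inv h3, ← div_eq_mul_inv]
      exact ENNReal.div_le_of_le_mul h4
  refine ⟨x, y, ?_, fun k => ?_, fun k => ?_⟩
  · apply AEEqFun.ext
    filter_upwards [AEEqFun.coeFn_mul x y, hxc, hkey] with t h1 h2 h3
    rw [h1, Pi.mul_apply, h2]
    rcases eq_or_ne (z t) 0 with h0 | h0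
    · simp [h0]
    · rw [inv_mul_cancel_right₀ (h3 h0).1]
  · refine rearr_le_of_forall_distr fun l hl => ?_
    refine le_trans ?_ (measure_lt_rankStep_le z ha k)
    rw [distr_eq_enorm]
    refine measure_mono_ae ?_
    filter_upwards [hxle] with t h1 h2
    exact lt_of_le_of_lt hl (lt_of_lt_of_le h2 h1)
  · refine rearr_le_of_forall_distr fun l hl => ?_
    rw [hy, distr_toL0 _ hufin]
    exact (measure_mono fun t ht => lt_of_le_of_lt hl ht).trans (measure_lt_rankStep_le z hu k)

/-! ### Decreasing majorants of dyadic sequences -/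

/-- The sequence `a` shifted to the left by `i` places, with the value `0` brought in at the right
end of the base interval. -/
def shiftLeft (I : BaseInterval) (a : ℤ → ℝ≥0∞) (i : ℕ) (k : ℤ) : ℝ≥0∞ := by
  classical exact if k + i ∈ I.indices then a (k + i) else 0

theorem shiftLeft_of_mem {a : ℤ → ℝ≥0∞} {i : ℕ} {k : ℤ} (h : k + i ∈ I.indices) :
    shiftLeft I a i k = a (k + i) := if_pos h

theorem shiftLeft_of_not_mem {a : ℤ → ℝ≥0∞} {i : ℕ} {k : ℤ} (h : k + i ∉ I.indices) :
    shiftLeft I a i k = 0 := if_neg h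

/-- The least decreasing majorant `sup {a j : j ≥ k}` of `a` on the indices of the base
interval. -/
def decreasingMajorant (I : BaseInterval) (a : ℤ → ℝ≥0∞) (k : ℤ) : ℝ≥0∞ :=
  ⨆ i : ℕ, shiftLeft I a i k

theorem antitone_decreasingMajorant (a : ℤ → ℝ≥0∞) : Antitone (decreasingMajorant I a) := by
  intro j k hjk
  obtain ⟨n, rfl⟩ := Int.le.dest hjk
  refine iSup_le fun i => le_iSup_of_le (n + i) ?_
  have h : j + ((n + i : ℕ) : ℤ) = j + n + i := by push_cast; ring
  unfold shiftLeft
  rw [h]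

theorem le_decreasingMajorant (a : ℤ → ℝ≥0∞) {k : ℤ} (hk : k ∈ I.indices) :
    a k ≤ decreasingMajorant I a k := by
  refine le_iSup_of_le 0 ?_
  rw [shiftLeft_of_mem] <;> simp [hk]

theorem decreasingMajorant_le_tsum (a : ℤ → ℝ≥0∞) (k : ℤ) :
    decreasingMajorant I a k ≤ ∑' i, shiftLeft I a i k :=
  iSup_le fun i => ENNReal.le_tsum i

theorem decreasingMajorant_of_not_mem (a : ℤ → ℝ≥0∞) {k : ℤ} (hk : k ∉ I.indices) :
    decreasingMajorant I a k = 0 := by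
  refine le_antisymm (iSup_le fun i => ?_) bot_le
  rw [shiftLeft_of_not_mem fun h => hk (I.mem_indices_of_le (by omega) h)]

theorem dyadicIndex_mul_zpow {t : ℝ} (ht : 0 < t) (i : ℤ) :
    dyadicIndex (t * 2 ^ i) = dyadicIndex t + i := by
  refine dyadicIndex_eq ?_ ?_
  · rw [zpow_add₀ two_ne_zero]
    gcongr
    exact zpow_dyadicIndex_le ht
  · rw [add_right_comm, zpow_add₀ two_ne_zero]
    gcongr
    exact lt_zpow_dyadicIndex ht

namespace IsSymmetricSpace

open FunctionSpace

variable {E : FunctionSpace I}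

theorem dilationNorm_ne_zero (hE : IsSymmetricSpace E) {s : ℝ} (hs : 0 < s) :
    dilationNorm E s ≠ 0 := by
  rcases le_total s 1 with h | h
  · exact (hE.dilationNorm_pos hs h).1
  · intro h0
    have := hE.one_le_dilationNorm h
    rw [h0, ENNReal.toReal_zero] at this
    linarith

theorem outerNorm_le_dilationNorm_mul (hE : IsSymmetricSpace E) {s : ℝ} (hs : 0 < s)
    {f g : ℝ → ℝ≥0∞} (h : ∀ t ∈ I.set, f t ≤ I.set.indicator g (t / s)) :
    E.outerNorm f ≤ dilationNorm E s * E.outerNorm g := by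
  have h0 := hE.dilationNorm_ne_zero hs
  have h1 := hE.dilationNorm_ne_top hs
  rw [outerNorm, outerNorm, ENNReal.mul_iInf_of_ne h0 h1]
  refine le_iInf fun x => ?_
  rw [ENNReal.mul_iInf_of_ne h0 h1]
  refine le_iInf fun hx => ?_
  rw [ENNReal.mul_iInf_of_ne h0 h1]
  refine le_iInf fun hg => ?_
  refine (outerNorm_le (hE.dilation_mem hs hx) ?_).trans (hE.nrm_dilation_le hs hx)
  filter_upwards [I.ae_mem, ae_dilation s x, ae_comp_div hg hs] with t ht h2 h3
  rw [h2]
  refine (h t ht).trans ?_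
  by_cases hI : t / s ∈ I.set
  · rw [indicator_of_mem hI, indicator_of_mem hI]
    exact h3 hI
  · simp [indicator_of_notMem hI]

theorem outerNorm_shiftLeft_le (hE : IsSymmetricSpace E) (a : ℤ → ℝ≥0∞) (i : ℕ) :
    E.outerNorm (dyadicStep (shiftLeft I a i)) ≤
      dilationNorm E (2 ^ i)⁻¹ * E.outerNorm (dyadicStep a) := by
  refine hE.outerNorm_le_dilationNorm_mul (by positivity) fun t ht => ?_
  have ht0 := I.pos_of_mem ht
  have h1 := dyadicIndex_mul_zpow ht0 i
  rw [div_inv_eq_mul]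
  rw [zpow_natCast] at h1
  unfold dyadicStep
  by_cases h : dyadicIndex t + i ∈ I.indices
  · have h2 : t * 2 ^ i ∈ I.set := by
      have h3 : 0 < t * 2 ^ i := by positivity
      have h4 := lt_zpow_dyadicIndex h3
      have h5 := zpow_dyadicIndex_le h3
      rw [h1] at h4 h5
      exact I.dyadic_subset h h5 h4
    rw [shiftLeft_of_mem h, indicator_of_mem h2, h1]
  · rw [shiftLeft_of_not_mem h]
    exact bot_le

theorem outerNorm_shiftRight_le (hE : IsSymmetricSpace E) (a : ℤ → ℝ≥0∞) (i : ℕ) :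
    E.outerNorm (dyadicStep fun k => a (k - i)) ≤
      dilationNorm E (2 ^ i) * E.outerNorm (dyadicStep a) := by
  refine hE.outerNorm_le_dilationNorm_mul (by positivity) fun t ht => ?_
  have ht0 := I.pos_of_mem ht
  have h1 := dyadicIndex_mul_zpow ht0 (-i)
  have h2 : t / 2 ^ i ∈ I.set :=
    I.mem_of_le (by positivity) (div_le_self ht0.le (one_le_pow₀ one_le_two)) ht
  rw [indicator_of_mem h2]
  rw [zpow_neg, zpow_natCast, ← div_eq_mul_inv] at h1
  unfold dyadicStep
  rw [h1, ← sub_eq_add_neg]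

end IsSymmetricSpace

/-! ### Summability of the dilation norms -/

/-- The values of `φ` at the dyadic points. -/
def dyadicValue (φ : ℝ → ℝ) (k : ℤ) : ℝ≥0∞ := ENNReal.ofReal (φ (2 ^ k))

theorem dyadicValue_ne_top (φ : ℝ → ℝ) (k : ℤ) : dyadicValue φ k ≠ ∞ := ENNReal.ofReal_ne_top

theorem dyadicValue_ne_zero {φ : ℝ → ℝ} (hpos : ∀ t ∈ I.set, 0 < φ t) {k : ℤ}
    (hk : k ∈ I.indices) : dyadicValue φ k ≠ 0 := by
  simpa [dyadicValue] using hpos _ hk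

theorem dyadicValue_mono {φ : ℝ → ℝ} (hmono : MonotoneOn φ I.set) {j k : ℤ} (hjk : j ≤ k)
    (hk : k ∈ I.indices) : dyadicValue φ j ≤ dyadicValue φ k :=
  ENNReal.ofReal_le_ofReal (hmono (I.mem_indices_of_le hjk hk) hk
    (zpow_le_zpow_right₀ one_le_two hjk))

theorem tsum_mul_ne_top {C C' r s : ℝ≥0} (hrs : r * s < 1) {a : ℕ → ℝ≥0∞}
    (ha : ∀ i, a i ≤ C' * s ^ i) : ∑' i : ℕ, ((C * r ^ i : ℝ≥0) : ℝ≥0∞) * a i ≠ ∞ := by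
  have h1 : ∑' i : ℕ, ((C * C' * (r * s) ^ i : ℝ≥0) : ℝ≥0∞) ≠ ∞ :=
    ENNReal.tsum_coe_ne_top_iff_summable.2 ((NNReal.summable_geometric hrs).mul_left _)
  refine ne_top_of_le_ne_top h1 (ENNReal.tsum_le_tsum fun i => ?_)
  calc ((C * r ^ i : ℝ≥0) : ℝ≥0∞) * a i ≤ (C * r ^ i : ℝ≥0) * (C' * s ^ i) := by
        gcongr
        exact ha i
    _ = _ := by
        push_cast
        rw [mul_pow]
        ring

theorem toNNReal_rpow_mul_lt_one {p q : ℝ} (h : p + q < 0) :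
    ((2 : ℝ) ^ p).toNNReal * ((2 : ℝ) ^ q).toNNReal < 1 := by
  rw [← Real.toNNReal_mul (by positivity), ← Real.rpow_add two_pos, Real.toNNReal_lt_one]
  exact Real.rpow_lt_one_of_one_lt_of_neg one_lt_two h

theorem ofReal_mul_rpow_pow (C : ℝ≥0) (p : ℝ) (i : ℕ) :
    ENNReal.ofReal (C * ((2 : ℝ) ^ p) ^ i) = C * (((2 : ℝ) ^ p).toNNReal : ℝ≥0∞) ^ i := by
  rw [ENNReal.ofReal_mul C.coe_nonneg, ENNReal.ofReal_pow (by positivity)]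
  simp [ENNReal.ofReal]

section Weights

variable {φ : ℝ → ℝ}

theorem exists_dyadicValue_add_le (hpos : ∀ t ∈ I.set, 0 < φ t) (hmono : MonotoneOn φ I.set)
    (hconc : ConcaveOn ℝ I.set φ) {q : ℝ} (hq : upperIndex I φ < q) :
    ∃ C : ℝ≥0, ∀ (i : ℕ) (k : ℤ), k + i ∈ I.indices → dyadicValue φ (k + i) ≤
      (C * ((2 : ℝ) ^ q).toNNReal ^ i : ℝ≥0) * dyadicValue φ k := by
  obtain ⟨C, hC⟩ := exists_ratio_le_of_upperIndex_lt hpos hmono hconc hq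
  refine ⟨C, fun i k hk => ?_⟩
  have h1 : (2 : ℝ) ^ (k + i) = 2 ^ k * 2 ^ i := by
    rw [zpow_add₀ two_ne_zero, zpow_natCast]
  have hk0 : k ∈ I.indices := I.mem_indices_of_le (by omega) hk
  have h2 := hC i (2 ^ k) hk0 (by rw [← h1]; exact hk)
  push_cast
  rw [dyadicValue, dyadicValue, h1, ← ofReal_mul_rpow_pow,
    ← ENNReal.ofReal_mul (mul_nonneg C.coe_nonneg (by positivity))]
  exact ENNReal.ofReal_le_ofReal h2

theorem exists_dyadicValue_sub_le (hpos : ∀ t ∈ I.set, 0 < φ t) (hmono : MonotoneOn φ I.set)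
    (hconc : ConcaveOn ℝ I.set φ) {p : ℝ} (hp : p < lowerIndex I φ) :
    ∃ C : ℝ≥0, ∀ (i : ℕ) (k : ℤ), k ∈ I.indices → dyadicValue φ (k - i) ≤
      (C * ((2 : ℝ) ^ (-p)).toNNReal ^ i : ℝ≥0) * dyadicValue φ k := by
  obtain ⟨C, hC⟩ := exists_ratio_le_of_lt_lowerIndex hpos hmono hconc hp
  refine ⟨C, fun i k hk => ?_⟩
  have h1 : (2 : ℝ) ^ (k - i) = 2 ^ k / 2 ^ i := by
    rw [zpow_sub₀ two_ne_zero, zpow_natCast]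
  have h2 := hC i (2 ^ k) hk
  push_cast
  rw [dyadicValue, dyadicValue, h1, ← ofReal_mul_rpow_pow,
    ← ENNReal.ofReal_mul (mul_nonneg C.coe_nonneg (by positivity))]
  exact ENNReal.ofReal_le_ofReal h2

end Weights

namespace IsSymmetricSpace

open FunctionSpace

variable {E : FunctionSpace I} {φ : ℝ → ℝ}

theorem exists_dilationNorm_inv_le (hE : IsSymmetricSpace E) {α : ℝ}
    (hα : α < lowerBoydIndex E) : ∃ C : ℝ≥0, ∀ i : ℕ,
      dilationNorm E (2 ^ i)⁻¹ ≤ C * (((2 : ℝ) ^ (-α)).toNNReal : ℝ≥0∞) ^ i := by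
  obtain ⟨C, hC⟩ := hE.exists_dilationNorm_inv_two_pow_le hα
  refine ⟨C, fun i => ?_⟩
  rw [← ofReal_mul_rpow_pow]
  exact (ENNReal.le_ofReal_iff_toReal_le (hE.dilationNorm_ne_top (by positivity))
    (mul_nonneg C.coe_nonneg (by positivity))).2 (hC i)

theorem exists_dilationNorm_le (hE : IsSymmetricSpace E) {β : ℝ}
    (hβ : upperBoydIndex E < β) : ∃ C : ℝ≥0, ∀ i : ℕ,
      dilationNorm E (2 ^ i) ≤ C * (((2 : ℝ) ^ β).toNNReal : ℝ≥0∞) ^ i := by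
  obtain ⟨C, hC⟩ := hE.exists_dilationNorm_two_pow_le hβ
  refine ⟨C, fun i => ?_⟩
  rw [← ofReal_mul_rpow_pow]
  exact (ENNReal.le_ofReal_iff_toReal_le (hE.dilationNorm_ne_top (by positivity))
    (mul_nonneg C.coe_nonneg (by positivity))).2 (hC i)

theorem exists_summable_of_upperIndex_lt (hE : IsSymmetricSpace E)
    (hpos : ∀ t ∈ I.set, 0 < φ t) (hmono : MonotoneOn φ I.set) (hconc : ConcaveOn ℝ I.set φ)
    (h : upperIndex I φ < lowerBoydIndex E) : ∃ c : ℕ → ℝ≥0,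
      (∀ (i : ℕ) (k : ℤ), k + i ∈ I.indices →
        dyadicValue φ (k + i) ≤ c i * dyadicValue φ k) ∧
      ∑' i, (c i : ℝ≥0∞) * dilationNorm E (2 ^ i)⁻¹ ≠ ∞ := by
  obtain ⟨q, hq, h1⟩ := exists_between h
  obtain ⟨α, hqα, hα⟩ := exists_between h1
  obtain ⟨C, hC⟩ := exists_dyadicValue_add_le hpos hmono hconc hq
  obtain ⟨C', hC'⟩ := hE.exists_dilationNorm_inv_le hα
  exact ⟨_, hC, tsum_mul_ne_top (toNNReal_rpow_mul_lt_one (by linarith)) hC'⟩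

theorem exists_summable_of_lt_lowerIndex (hE : IsSymmetricSpace E)
    (hpos : ∀ t ∈ I.set, 0 < φ t) (hmono : MonotoneOn φ I.set) (hconc : ConcaveOn ℝ I.set φ)
    (h : upperBoydIndex E < lowerIndex I φ) : ∃ c : ℕ → ℝ≥0,
      (∀ (i : ℕ) (k : ℤ), k ∈ I.indices → dyadicValue φ (k - i) ≤ c i * dyadicValue φ k) ∧
      ∑' i, (c i : ℝ≥0∞) * dilationNorm E (2 ^ i) ≠ ∞ := by
  obtain ⟨β, hβ, h1⟩ := exists_between h
  obtain ⟨p, hβp, hp⟩ := exists_between h1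
  obtain ⟨C, hC⟩ := exists_dyadicValue_sub_le hpos hmono hconc hp
  obtain ⟨C', hC'⟩ := hE.exists_dilationNorm_le hβ
  exact ⟨_, hC, tsum_mul_ne_top (toNNReal_rpow_mul_lt_one (by linarith)) hC'⟩

theorem tsum_dilationNorm_inv_ne_top (hE : IsSymmetricSpace E) (h : 0 < lowerBoydIndex E) :
    ∑' i : ℕ, dilationNorm E (2 ^ i)⁻¹ ≠ ∞ := by
  obtain ⟨α, hα0, hα⟩ := exists_between h
  obtain ⟨C', hC'⟩ := hE.exists_dilationNorm_inv_le hα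
  have := tsum_mul_ne_top (C := 1) (r := 1) (s := ((2 : ℝ) ^ (-α)).toNNReal) (by
    rw [one_mul, Real.toNNReal_lt_one]
    exact Real.rpow_lt_one_of_one_lt_of_neg one_lt_two (by linarith)) hC'
  simpa using this

theorem eq_zero_of_outerNorm_eq_zero (hE : IsSymmetricSpace E) {a : ℤ → ℝ≥0∞}
    (h : E.outerNorm (dyadicStep a) = 0) {k : ℤ} (hk : k ∈ I.indices) : a k = 0 := by
  have hfin : E.outerNorm (dyadicStep a) ≠ ∞ := by simp [h]
  have h1 := enorm_toL0 (measurable_dyadicStep a) (ae_ne_top_of_outerNorm hfin)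
  set x := toL0 I (dyadicStep a) (measurable_dyadicStep a)
  have hle : ∀ᵐ t ∂I.measure, ‖x t‖ₑ ≤ dyadicStep a t := by
    filter_upwards [h1] with t ht using ht.le
  have hx : x ∈ E.carrier :=
    hE.mem_of_outerNorm_ne_top (ne_top_of_le_ne_top hfin (outerNorm_mono hle))
  have hx0 : x = 0 := (hE.nrm_eq_zero x hx).1
    (le_antisymm ((hE.nrm_le_outerNorm x hle).trans h.le) bot_le)
  refine forall_of_ae_dyadicIndex (p := fun k => a k = 0) ?_ hk
  filter_upwards [h1, AEEqFun.coeFn_zero (μ := I.measure) (β := ℝ)] with t h2 h3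
  rw [hx0, h3, Pi.zero_apply, enorm_zero] at h2
  exact h2.symm

/-- If the lower Boyd index is positive, the elements of `E` have rearrangements vanishing at
infinity: otherwise `E` contains the constants, which the dilations preserve. -/
theorem distr_ne_top (hE : IsSymmetricSpace E) (hα : 0 < lowerBoydIndex E) {z : L0 I}
    (hz : z ∈ E.carrier) (l : ℝ≥0) (hl : 0 < l) : distr z l ≠ ∞ := by
  intro htop
  have hI : ∀ k : ℤ, k ∈ I.indices := fun k => by
    by_contra hk
    have h1 := (distr_le_univ z l).trans (I.measure_univ_le_of_not_mem hk)
    rw [htop] at h1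
    exact absurd h1 (by simp)
  set A := E.outerNorm (dyadicStep fun _ => (l : ℝ≥0∞))
  have hle : A ≤ 2 * E.nrm z := by
    refine le_trans (outerNorm_dyadicStep_mono fun k _ => ?_) (hE.outerNorm_dyadic_rearr_le_two hz)
    exact le_rearr_of_le_distr (htop ▸ le_top)
  have hAfin : A ≠ ∞ :=
    ne_top_of_le_ne_top (ENNReal.mul_ne_top (by simp) (hE.nrm_lt_top z hz).ne) hle
  have h1 : ∀ i : ℕ, A ≤ dilationNorm E (2 ^ i)⁻¹ * A := fun i => by
    refine le_trans (outerNorm_dyadicStep_mono fun k _ => ?_) (hE.outerNorm_shiftLeft_le _ i)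
    rw [shiftLeft_of_mem (hI _)]
  have h2 := ENNReal.tendsto_atTop_zero_of_tsum_ne_top (hE.tsum_dilationNorm_inv_ne_top hα)
  have h3 := ENNReal.Tendsto.mul_const h2 (Or.inr hAfin)
  rw [zero_mul] at h3
  have h4 : A = 0 := le_antisymm (ge_of_tendsto' h3 h1) bot_le
  have h5 := hE.eq_zero_of_outerNorm_eq_zero h4 (hI 0)
  simp only [ENNReal.coe_eq_zero] at h5
  exact hl.ne' h5

theorem outerNorm_decreasingMajorant_le (hE : IsSymmetricSpace E) {a b : ℤ → ℝ≥0∞}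
    (d : ℤ → ℝ≥0∞) {c : ℕ → ℝ≥0}
    (h : ∀ (i : ℕ) (k : ℤ), k + i ∈ I.indices → b (k + i) * d k ≤ c i * a (k + i)) :
    E.outerNorm (dyadicStep fun k => decreasingMajorant I b k * d k) ≤
      (∑' i, (c i : ℝ≥0∞) * dilationNorm E (2 ^ i)⁻¹) * E.outerNorm (dyadicStep a) := by
  have h1 : ∀ k, decreasingMajorant I b k * d k ≤ ∑' i, (c i : ℝ≥0∞) * shiftLeft I a i k := by
    intro k
    refine (mul_le_mul_left (decreasingMajorant_le_tsum b k) (d k)).trans ?_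
    rw [← ENNReal.tsum_mul_right]
    refine ENNReal.tsum_le_tsum fun i => ?_
    by_cases hk : k + i ∈ I.indices
    · rw [shiftLeft_of_mem hk, shiftLeft_of_mem hk]
      exact h i k hk
    · rw [shiftLeft_of_not_mem hk, zero_mul]
      exact bot_le
  refine (outerNorm_mono (ae_of_all _ fun t => h1 (dyadicIndex t))).trans ?_
  refine (hE.outerNorm_tsum_le _).trans ?_
  rw [← ENNReal.tsum_mul_right]
  refine ENNReal.tsum_le_tsum fun i => ?_
  refine (hE.outerNorm_const_mul (c i) (dyadicStep (shiftLeft I a i))).trans ?_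
  rw [mul_assoc]
  gcongr
  exact hE.outerNorm_shiftLeft_le a i

end IsSymmetricSpace

/-! ### Pointwise products with spaces of multipliers -/

/-- The class of spaces for which the norm of a multiplier bounds the product: the functional is
finite on the space and positively homogeneous. -/
structure FunctionSpace.IsHomogeneous (G : FunctionSpace I) : Prop where
  nrm_ne_top : ∀ x ∈ G.carrier, G.nrm x ≠ ∞
  nrm_zero : G.nrm 0 = 0
  smul_mem : ∀ c : ℝ, 0 < c → ∀ x ∈ G.carrier, c • x ∈ G.carrier
  nrm_smul : ∀ c : ℝ, 0 < c → ∀ x ∈ G.carrier, G.nrm (c • x) = ENNReal.ofReal c * G.nrm x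

theorem IsBanachIdealSpace.isHomogeneous {E : FunctionSpace I} (hE : IsBanachIdealSpace E) :
    E.IsHomogeneous where
  nrm_ne_top x hx := (hE.nrm_lt_top x hx).ne
  nrm_zero := (hE.nrm_eq_zero 0 hE.zero_mem).2 rfl
  smul_mem c _ x hx := hE.smul_mem c x hx
  nrm_smul c hc x hx := by rw [hE.nrm_smul c x hx, abs_of_pos hc]

namespace FunctionSpace

theorem isHomogeneous_ofENorm {N : L0 I → ℝ≥0∞} (h0 : N 0 = 0)
    (hN : ∀ (c : ℝ) (x : L0 I), 0 < c → N (c • x) = ENNReal.ofReal c * N x) :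
    (ofENorm N).IsHomogeneous where
  nrm_ne_top _ hx := ne_of_lt hx
  nrm_zero := h0
  smul_mem c hc x hx := by
    change N (c • x) < ∞
    rw [hN c x hc]
    exact ENNReal.mul_lt_top ENNReal.ofReal_lt_top hx
  nrm_smul c hc x _ := hN c x hc

variable {G F : FunctionSpace I}

/-- A bound for `‖x w‖` by the norm of `w` bounds the norm of the multiplier `x`. -/
theorem mem_multipliers_of_le {y : L0 I} {C : ℝ≥0∞}
    (h : ∀ w ∈ G.carrier, y * w ∈ F.carrier ∧ F.nrm (y * w) ≤ C * G.nrm w) :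
    y ∈ (G.multipliers F).carrier ∧ (G.multipliers F).nrm y ≤ C := by
  refine ⟨fun w hw => (h w hw).1, iSup₂_le fun w hw => iSup_le fun hw1 => ?_⟩
  have := (h w hw).2
  rwa [hw1, mul_one] at this

theorem nrm_mul_le (hG : G.IsHomogeneous) (hF : F.IsHomogeneous)
    (hG0 : ∀ x ∈ G.carrier, G.nrm x = 0 → x = 0) {x y : L0 I} (hx : x ∈ G.carrier)
    (hy : y ∈ (G.multipliers F).carrier) :
    F.nrm (x * y) ≤ G.nrm x * (G.multipliers F).nrm y := by
  rcases eq_or_ne (G.nrm x) 0 with h0 | h0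
  · have hxy : x * y = 0 := by
      apply AEEqFun.ext
      rw [hG0 x hx h0]
      filter_upwards [AEEqFun.coeFn_mul (0 : L0 I) y,
        AEEqFun.coeFn_zero (μ := I.measure) (β := ℝ)] with t h1 h2
      rw [h1, Pi.mul_apply, h2, Pi.zero_apply, zero_mul]
    rw [hxy, hF.nrm_zero]
    exact bot_le
  · have hfin := hG.nrm_ne_top x hx
    set c : ℝ := (G.nrm x).toReal
    have hcpos : 0 < c := ENNReal.toReal_pos h0 hfin
    have hcE : ENNReal.ofReal c = G.nrm x := ENNReal.ofReal_toReal hfin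
    have hw := hG.smul_mem c⁻¹ (inv_pos.2 hcpos) x hx
    have hwn : G.nrm (c⁻¹ • x) = 1 := by
      rw [hG.nrm_smul _ (inv_pos.2 hcpos) x hx, ENNReal.ofReal_inv_of_pos hcpos, hcE,
        ENNReal.inv_mul_cancel h0 hfin]
    have h1 : F.nrm (y * (c⁻¹ • x)) ≤ (G.multipliers F).nrm y :=
      le_iSup₂_of_le (c⁻¹ • x) hw (le_iSup_of_le hwn le_rfl)
    have h2 : x * y = c • (y * (c⁻¹ • x)) := by
      apply AEEqFun.ext
      filter_upwards [AEEqFun.coeFn_mul x y, AEEqFun.coeFn_smul c (y * (c⁻¹ • x)),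
        AEEqFun.coeFn_mul y (c⁻¹ • x), AEEqFun.coeFn_smul c⁻¹ x] with t e1 e2 e3 e4
      rw [e1, e2, Pi.smul_apply, e3, Pi.mul_apply, Pi.mul_apply, e4, Pi.smul_apply, smul_eq_mul,
        smul_eq_mul]
      field_simp
    rw [h2, hF.nrm_smul _ hcpos _ (hy _ hw), hcE]
    gcongr

/-- The criterion for `F = G ⊙ M(G, F)` in terms of `H = F`, where `H` has the same elements
as `F` and an equivalent norm. -/
theorem same_prod_multipliers {H : FunctionSpace I} (hG : G.IsHomogeneous) (hF : F.IsHomogeneous)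
    (hG0 : ∀ x ∈ G.carrier, G.nrm x = 0 → x = 0) {A B : ℝ≥0}
    (hFH : ∀ x ∈ F.carrier, x ∈ H.carrier ∧ H.nrm x ≤ A * F.nrm x)
    (hfac : ∀ z ∈ H.carrier, ∃ x ∈ G.carrier, ∃ y ∈ (G.multipliers F).carrier, z = x * y ∧
      G.nrm x * (G.multipliers F).nrm y ≤ B * H.nrm z) :
    H.Same (G.prod (G.multipliers F)) := by
  have hle : ∀ x ∈ G.carrier, ∀ y ∈ (G.multipliers F).carrier, x * y ∈ H.carrier ∧
      H.nrm (x * y) ≤ A * (G.nrm x * (G.multipliers F).nrm y) := fun x hx y hy => by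
    have h1 : x * y ∈ F.carrier := mul_comm x y ▸ hy x hx
    refine ⟨(hFH _ h1).1, (hFH _ h1).2.trans ?_⟩
    gcongr
    exact nrm_mul_le hG hF hG0 hx hy
  refine ⟨?_, max A B, fun z hz => ⟨?_, ?_⟩⟩
  · ext z
    refine ⟨fun hz => ?_, ?_⟩
    · obtain ⟨x, hx, y, hy, hz, -⟩ := hfac z hz
      exact ⟨x, hx, y, hy, hz⟩
    · rintro ⟨x, hx, y, hy, rfl⟩
      exact (hle x hx y hy).1
  · obtain ⟨x₀, hx₀, y₀, hy₀, hz₀, -⟩ := hfac z hz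
    rcases eq_or_ne (max A B) 0 with h0 | h0
    · have hA : A = 0 := le_antisymm ((le_max_left A B).trans h0.le) bot_le
      have := (hle x₀ hx₀ y₀ hy₀).2
      rw [← hz₀, hA, ENNReal.coe_zero, zero_mul] at this
      exact this.trans bot_le
    · have h0' : ((max A B : ℝ≥0) : ℝ≥0∞) ≠ 0 := by simpa using h0
      change _ ≤ _ * ⨅ (x ∈ G.carrier) (y ∈ (G.multipliers F).carrier) (_ : z = x * y),
        G.nrm x * (G.multipliers F).nrm y
      simp only [ENNReal.mul_iInf_of_ne h0' ENNReal.coe_ne_top]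
      refine le_iInf₂ fun x hx => le_iInf₂ fun y hy => le_iInf fun h => ?_
      rw [h]
      refine (hle x hx y hy).2.trans ?_
      gcongr
      exact le_max_left A B
  · obtain ⟨x, hx, y, hy, h, h1⟩ := hfac z hz
    refine (iInf₂_le_of_le x hx (iInf₂_le_of_le y hy (iInf_le _ h))).trans (h1.trans ?_)
    gcongr
    exact le_max_right A B

end FunctionSpace

/-! ### Marcinkiewicz spaces -/

section Marcinkiewicz

variable {φ : ℝ → ℝ}

theorem rearr_zero {t : ℝ} (ht : 0 < t) : rearr (0 : L0 I) t = 0 := by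
  have h : distr (0 : L0 I) 0 < ENNReal.ofReal t := by
    rw [distr_zero]
    exact ENNReal.ofReal_pos.2 ht
  simpa using rearr_le_of_distr_lt h

theorem isHomogeneous_marcinkiewiczStar : (marcinkiewiczStar I φ).IsHomogeneous := by
  refine FunctionSpace.isHomogeneous_ofENorm ?_ fun c x hc => ?_
  · refine le_antisymm (iSup₂_le fun t ht => ?_) bot_le
    rw [rearr_zero (I.pos_of_mem ht), mul_zero]
  · simp only [ENNReal.mul_iSup]
    refine iSup_congr fun t => iSup_congr fun _ => ?_
    rw [rearr_smul hc]
    ring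

theorem maxRearr_smul {c : ℝ} (hc : 0 < c) (x : L0 I) (t : ℝ) :
    maxRearr (c • x) t = ENNReal.ofReal c * maxRearr x t := by
  unfold maxRearr
  simp_rw [rearr_smul hc]
  rw [lintegral_const_mul _ (measurable_rearr x), mul_div_assoc]

theorem isHomogeneous_marcinkiewicz : (marcinkiewicz I φ).IsHomogeneous := by
  refine FunctionSpace.isHomogeneous_ofENorm ?_ fun c x hc => ?_
  · refine le_antisymm (iSup₂_le fun t ht => ?_) bot_le
    have h : maxRearr (0 : L0 I) t = 0 := by
      unfold maxRearr
      rw [setLIntegral_congr_fun (g := fun _ => 0) measurableSet_Ioo fun s hs => rearr_zero hs.1]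
      simp
    rw [h, mul_zero]
  · simp only [ENNReal.mul_iSup]
    refine iSup_congr fun t => iSup_congr fun _ => ?_
    rw [maxRearr_smul hc]
    ring

theorem rearr_le_maxRearr (x : L0 I) {t : ℝ} (ht : 0 < t) : rearr x t ≤ maxRearr x t := by
  have h0 : ENNReal.ofReal t ≠ 0 := (ENNReal.ofReal_pos.2 ht).ne'
  unfold maxRearr
  rw [ENNReal.le_div_iff_mul_le (Or.inl h0) (Or.inl ENNReal.ofReal_ne_top)]
  calc rearr x t * ENNReal.ofReal t = ∫⁻ _ in Ioo 0 t, rearr x t := by simp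
    _ ≤ _ := setLIntegral_mono (measurable_rearr x) fun s hs => antitone_rearr x hs.2.le

theorem marcinkiewiczStar_nrm_le (x : L0 I) :
    (marcinkiewiczStar I φ).nrm x ≤ (marcinkiewicz I φ).nrm x :=
  iSup₂_mono fun t ht => by
    gcongr
    exact rearr_le_maxRearr x (I.pos_of_mem ht)

theorem eq_zero_of_marcinkiewiczStar_nrm (hpos : ∀ t ∈ I.set, 0 < φ t) {x : L0 I}
    (h : (marcinkiewiczStar I φ).nrm x = 0) : x = 0 := by
  refine eq_zero_of_rearr fun t ht => ?_
  have h1 : ENNReal.ofReal (φ t) * rearr x t ≤ 0 := h ▸ le_iSup₂_of_le t ht le_rfl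
  rcases mul_eq_zero.1 (le_antisymm h1 bot_le) with h2 | h2
  · simp only [ENNReal.ofReal_eq_zero] at h2
    exact absurd h2 (not_le.2 (hpos t ht))
  · exact h2

theorem rearr_le_of_marcinkiewiczStar (hpos : ∀ t ∈ I.set, 0 < φ t) (x : L0 I) {k : ℤ}
    (hk : k ∈ I.indices) :
    rearr x (2 ^ k) ≤ (marcinkiewiczStar I φ).nrm x * (dyadicValue φ k)⁻¹ := by
  rw [← div_eq_mul_inv, ENNReal.le_div_iff_mul_le (Or.inl (dyadicValue_ne_zero hpos hk))
    (Or.inl (dyadicValue_ne_top φ k)), mul_comm]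
  exact le_iSup₂_of_le (2 ^ k : ℝ) hk le_rfl

theorem ofReal_le_dyadicValue (hpos : ∀ t ∈ I.set, 0 < φ t) (hconc : ConcaveOn ℝ I.set φ)
    {t : ℝ} (ht : t ∈ I.set) (n : ℕ) :
    ENNReal.ofReal (φ t) ≤ 2 ^ (n + 2) * dyadicValue φ (dyadicIndex t - n) := by
  have ht0 := I.pos_of_mem ht
  have hp : (0 : ℝ) < 2 ^ (dyadicIndex t - n) := by positivity
  have hle : (2 : ℝ) ^ (dyadicIndex t - n) ≤ t :=
    (zpow_le_zpow_right₀ one_le_two (by omega)).trans (zpow_dyadicIndex_le ht0)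
  have h1 := hconc.le_two_mul_div hpos hp hle ht
  have h2 : t / 2 ^ (dyadicIndex t - n) ≤ 2 ^ (n + 1) := by
    rw [div_le_iff₀ hp, ← zpow_natCast, ← zpow_add₀ two_ne_zero]
    refine (lt_zpow_dyadicIndex ht0).le.trans (le_of_eq ?_)
    congr 1
    push_cast
    ring
  have h3 : (2 : ℝ≥0∞) ^ (n + 2) = ENNReal.ofReal (2 ^ (n + 2)) := by
    rw [ENNReal.ofReal_pow zero_le_two, ENNReal.ofReal_ofNat]
  rw [h3, dyadicValue, ← ENNReal.ofReal_mul (by positivity)]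
  refine ENNReal.ofReal_le_ofReal (h1.trans ?_)
  have h4 := (hpos _ (I.mem_of_le hp hle ht)).le
  calc 2 * (t / 2 ^ (dyadicIndex t - n)) * φ (2 ^ (dyadicIndex t - n))
      ≤ 2 * 2 ^ (n + 1) * φ (2 ^ (dyadicIndex t - n)) := by gcongr
    _ = _ := by ring

theorem marcinkiewiczStar_nrm_le_of_dyadic (hpos : ∀ t ∈ I.set, 0 < φ t)
    (hconc : ConcaveOn ℝ I.set φ) {x : L0 I}
    (h : ∀ k ∈ I.indices, rearr x (2 ^ (k + 1)) ≤ (dyadicValue φ k)⁻¹) :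
    (marcinkiewiczStar I φ).nrm x ≤ 8 := by
  refine iSup₂_le fun t ht => ?_
  have ht0 := I.pos_of_mem ht
  have hk : dyadicIndex t - 1 ∈ I.indices := I.mem_indices_of_le (by omega) (I.dyadicIndex_mem ht)
  have h1 := h _ hk
  rw [sub_add_cancel] at h1
  have h2 := ofReal_le_dyadicValue hpos hconc ht 1
  calc ENNReal.ofReal (φ t) * rearr x t
      ≤ 2 ^ (1 + 2) * dyadicValue φ (dyadicIndex t - 1) *
          (dyadicValue φ (dyadicIndex t - 1))⁻¹ := by
        gcongr
        · exact_mod_cast h2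
        · exact (antitone_rearr x (zpow_dyadicIndex_le ht0)).trans h1
    _ = 8 := by
        rw [mul_assoc, ENNReal.mul_inv_cancel (dyadicValue_ne_zero hpos hk)
          (dyadicValue_ne_top φ _)]
        norm_num

theorem lintegral_dyadicStep (a : ℤ → ℝ≥0∞) :
    ∫⁻ t, dyadicStep a t ∂I.measure = ∑' k, a k * I.measure {t | dyadicIndex t = k} := by
  have h1 : ∫⁻ t, dyadicStep a t ∂I.measure = ∫⁻ k, a k ∂(I.measure.map dyadicIndex) :=
    (lintegral_map (measurable_from_top (f := a)) measurable_dyadicIndex).symm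
  rw [h1, lintegral_countable']
  refine tsum_congr fun k => ?_
  rw [Measure.map_apply measurable_dyadicIndex (measurableSet_singleton k)]
  rfl

theorem tsum_eq_tsum_sub {f : ℤ → ℝ≥0∞} {k : ℤ} (h : ∀ j, k < j → f j = 0) :
    ∑' j, f j = ∑' i : ℕ, f (k - i) := by
  refine (Function.Injective.tsum_eq (g := fun i : ℕ => k - (i : ℤ))
    (fun i j hij => by simpa using hij) fun j hj => ?_).symm
  have hjk : j ≤ k := by
    by_contra hlt
    exact hj (h j (not_le.1 hlt))
  exact ⟨(k - j).toNat, by simp only; omega⟩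

/-- For an upper index below `1` the norm of `M_φ` is equivalent to the quasi-norm of `M_φ^*`. -/
theorem exists_marcinkiewicz_nrm_le (hpos : ∀ t ∈ I.set, 0 < φ t) (hmono : MonotoneOn φ I.set)
    (hconc : ConcaveOn ℝ I.set φ) (hq : upperIndex I φ < 1) :
    ∃ C : ℝ≥0, ∀ x : L0 I,
      (marcinkiewicz I φ).nrm x ≤ C * (marcinkiewiczStar I φ).nrm x := by
  obtain ⟨q, hq1, hq2⟩ := exists_between hq
  obtain ⟨C, hC⟩ := exists_dyadicValue_add_le hpos hmono hconc hq1
  set c : ℕ → ℝ≥0 := fun i => C * ((2 : ℝ) ^ q).toNNReal ^ i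
  have hS : ∑' i : ℕ, (c i : ℝ≥0∞) * (2⁻¹) ^ i ≠ ∞ := by
    refine tsum_mul_ne_top (C' := 1) (toNNReal_rpow_mul_lt_one (by linarith : q + -1 < 0))
      fun i => ?_
    rw [Real.rpow_neg_one, Real.toNNReal_inv]
    simp
  set S := ∑' i : ℕ, (c i : ℝ≥0∞) * (2⁻¹) ^ i
  refine ⟨(4 * S).toNNReal, fun x => ?_⟩
  rw [ENNReal.coe_toNNReal (ENNReal.mul_ne_top (by simp) hS)]
  refine iSup₂_le fun t ht => ?_
  have ht0 := I.pos_of_mem ht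
  set k := dyadicIndex t with hk
  have hkI : k ∈ I.indices := I.dyadicIndex_mem ht
  set W := (marcinkiewiczStar I φ).nrm x
  have hv0 := dyadicValue_ne_zero hpos hkI
  have hvt := dyadicValue_ne_top φ k
  classical
  -- On `(0, t)` the rearrangement of `x` is at most `‖x‖_{M_φ^*} / φ`; here `W` is that norm.
  set a : ℤ → ℝ≥0∞ := fun j => if j ≤ k then W * (dyadicValue φ j)⁻¹ else 0
  have hale : ∀ j ≤ k, a j = W * (dyadicValue φ j)⁻¹ := fun j hj => if_pos hj
  have hagt : ∀ j, k < j → a j = 0 := fun j hj => if_neg (not_le.2 hj)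
  set P := ENNReal.ofReal ((2 : ℝ) ^ k)
  have hP : ∀ i : ℕ, ENNReal.ofReal ((2 : ℝ) ^ (k - i)) = P * 2⁻¹ ^ i := fun i => by
    rw [zpow_sub₀ two_ne_zero, zpow_natCast, div_eq_mul_inv, ENNReal.ofReal_mul (by positivity),
      ENNReal.ofReal_inv_of_pos (by positivity), ENNReal.ofReal_pow zero_le_two,
      ENNReal.ofReal_ofNat, ENNReal.inv_pow]
  have hint : ∫⁻ s in Ioo 0 t, rearr x s ≤ P * (W * ((dyadicValue φ k)⁻¹ * S)) := by
    have hsub : volume.restrict (Ioo 0 t) ≤ I.measure :=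
      Measure.restrict_mono (fun s hs => I.mem_of_le hs.1 hs.2.le ht) le_rfl
    calc ∫⁻ s in Ioo 0 t, rearr x s ≤ ∫⁻ s in Ioo 0 t, dyadicStep a s := by
          refine setLIntegral_mono (measurable_dyadicStep a) fun s hs => ?_
          have hsI : s ∈ I.set := I.mem_of_le hs.1 hs.2.le ht
          have hle : dyadicIndex s ≤ k := by
            have h1 := (zpow_dyadicIndex_le hs.1).trans_lt (hs.2.trans (lt_zpow_dyadicIndex ht0))
            have := (zpow_lt_zpow_iff_right₀ (one_lt_two (α := ℝ))).1 h1
            omega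
          rw [dyadicStep, hale _ hle]
          exact (antitone_rearr x (zpow_dyadicIndex_le hs.1)).trans
            (rearr_le_of_marcinkiewiczStar hpos x (I.dyadicIndex_mem hsI))
      _ ≤ ∫⁻ s, dyadicStep a s ∂I.measure := lintegral_mono' hsub le_rfl
      _ = ∑' i : ℕ, a (k - i) * I.measure {t | dyadicIndex t = k - i} := by
          rw [lintegral_dyadicStep, tsum_eq_tsum_sub (k := k)]
          intro j hj
          rw [hagt j hj, zero_mul]
      _ ≤ ∑' i : ℕ, P * (W * ((dyadicValue φ k)⁻¹ * (c i * (2⁻¹) ^ i))) := by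
          refine ENNReal.tsum_le_tsum fun i => ?_
          have hi : k - i ∈ I.indices := I.mem_indices_of_le (by omega) hkI
          have hle : k - (i : ℤ) ≤ k := by omega
          rw [I.measure_dyadicIndex hi, hale _ hle, hP]
          have h1 := hC i (k - i) (by rwa [sub_add_cancel])
          rw [sub_add_cancel] at h1
          have h2 : (dyadicValue φ (k - i))⁻¹ ≤ (dyadicValue φ k)⁻¹ * c i := by
            rw [mul_comm, ← div_eq_mul_inv, ENNReal.le_div_iff_mul_le (Or.inl hv0) (Or.inl hvt),
              mul_comm, ← div_eq_mul_inv]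
            exact ENNReal.div_le_of_le_mul h1
          calc W * (dyadicValue φ (k - i))⁻¹ * (P * 2⁻¹ ^ i)
              ≤ W * ((dyadicValue φ k)⁻¹ * c i) * (P * 2⁻¹ ^ i) := by gcongr
            _ = _ := by ring
      _ = _ := by
          rw [ENNReal.tsum_mul_left, ENNReal.tsum_mul_left, ENNReal.tsum_mul_left]
  have hmax : maxRearr x t ≤ W * ((dyadicValue φ k)⁻¹ * S) := by
    have hle : P ≤ ENNReal.ofReal t := ENNReal.ofReal_le_ofReal (zpow_dyadicIndex_le ht0)
    refine ENNReal.div_le_of_le_mul (hint.trans ?_)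
    rw [mul_comm]
    gcongr
  have h3 := ofReal_le_dyadicValue hpos hconc ht 0
  simp only [Nat.cast_zero, sub_zero, ← hk] at h3
  calc ENNReal.ofReal (φ t) * maxRearr x t
      ≤ 2 ^ (0 + 2) * dyadicValue φ k * (W * ((dyadicValue φ k)⁻¹ * S)) := by gcongr
    _ = 2 ^ 2 * (dyadicValue φ k * (dyadicValue φ k)⁻¹) * S * W := by ring
    _ = 4 * S * W := by
        rw [ENNReal.mul_inv_cancel hv0 hvt]
        norm_num

/-- The factorization of a symmetric space `F` through a space `G` equivalent to `M_φ^*`. The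
first factor is modelled on `1 / φ`, the second on the least decreasing majorant of `φ z^*`. -/
theorem same_prod_multipliers_of_equiv_marcinkiewiczStar {F G : FunctionSpace I}
    (hF : IsSymmetricSpace F) (hpos : ∀ t ∈ I.set, 0 < φ t) (hmono : MonotoneOn φ I.set)
    (hconc : ConcaveOn ℝ I.set φ) (hα0 : 0 < lowerBoydIndex F)
    (hα : upperIndex I φ < lowerBoydIndex F) (hG : G.IsHomogeneous)
    (hcar : ∀ x, G.nrm x ≠ ∞ → x ∈ G.carrier)
    (hle : ∀ x, (marcinkiewiczStar I φ).nrm x ≤ G.nrm x) {C : ℝ≥0}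
    (hge : ∀ x, G.nrm x ≤ C * (marcinkiewiczStar I φ).nrm x) :
    F.Same (G.prod (G.multipliers F)) := by
  obtain ⟨c, hc, hS⟩ := hF.exists_summable_of_upperIndex_lt hpos hmono hconc hα
  set S := ∑' i, (c i : ℝ≥0∞) * dilationNorm F (2 ^ i)⁻¹
  refine FunctionSpace.same_prod_multipliers (A := 1) (B := C * 8 * (8 * S * 2).toNNReal) hG
    hF.isHomogeneous (fun x _ h => eq_zero_of_marcinkiewiczStar_nrm hpos
      (le_antisymm ((hle x).trans h.le) bot_le)) (fun x hx => ⟨hx, by simp⟩) fun z hz => ?_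
  set v := dyadicValue φ
  set u := decreasingMajorant I fun k => v k * rearr z (2 ^ k) with hu
  set a : ℤ → ℝ≥0∞ := I.indices.indicator fun k => (v k)⁻¹ with ha
  have haanti : Antitone a := by
    intro j k hjk
    by_cases hk : k ∈ I.indices
    · rw [ha, indicator_of_mem hk, indicator_of_mem (I.mem_indices_of_le hjk hk)]
      exact ENNReal.inv_le_inv.2 (dyadicValue_mono hmono hjk hk)
    · rw [ha, indicator_of_notMem hk]
      exact bot_le
  -- `u / φ` is dominated by the sum of the left shifts of `z^*` with coefficients `c i`.
  have hN : F.outerNorm (dyadicStep fun k => u k * (v k)⁻¹) ≤ S * (2 * F.nrm z) := by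
    refine (hF.outerNorm_decreasingMajorant_le (a := fun k => rearr z (2 ^ k)) (c := c)
      (fun k => (v k)⁻¹) fun i k hk => ?_).trans ?_
    · have hk0 : k ∈ I.indices := I.mem_indices_of_le (by omega) hk
      calc v (k + i) * rearr z (2 ^ (k + i)) * (v k)⁻¹
          ≤ c i * v k * rearr z (2 ^ (k + i)) * (v k)⁻¹ := by
            gcongr
            exact hc i k hk
        _ = c i * rearr z (2 ^ (k + i)) * (v k * (v k)⁻¹) := by ring
        _ = _ := by
            rw [ENNReal.mul_inv_cancel (dyadicValue_ne_zero hpos hk0) (dyadicValue_ne_top φ k),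
              mul_one]
    · gcongr
      exact hF.outerNorm_dyadic_rearr_le_two hz
  have hNfin : F.outerNorm (dyadicStep fun k => u k * (v k)⁻¹) ≠ ∞ :=
    ne_top_of_le_ne_top (ENNReal.mul_ne_top hS
      (ENNReal.mul_ne_top (by simp) (hF.nrm_lt_top z hz).ne)) hN
  have hufin : ∀ k, u k ≠ ∞ := fun k => by
    by_cases hk : k ∈ I.indices
    · have h1 : u k * (v k)⁻¹ ≠ ∞ :=
        forall_of_ae_dyadicIndex (p := fun k => u k * (v k)⁻¹ ≠ ∞)
          (FunctionSpace.ae_ne_top_of_outerNorm hNfin) hk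
      intro h
      rw [h, ENNReal.top_mul (ENNReal.inv_ne_zero.2 (dyadicValue_ne_top φ k))] at h1
      exact h1 rfl
    · rw [hu, decreasingMajorant_of_not_mem _ hk]
      exact ENNReal.zero_ne_top
  obtain ⟨x, y, hxy, hx, hy⟩ := exists_factorization (hF.distr_ne_top hα0 hz) haanti
    (antitone_decreasingMajorant _) hufin fun k hk => by
      have h1 := le_decreasingMajorant (fun k => v k * rearr z (2 ^ k)) hk
      have h2 := dyadicValue_ne_zero hpos hk
      have h3 := dyadicValue_ne_top φ k
      rw [ha, indicator_of_mem hk]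
      calc rearr z (2 ^ k) = (v k)⁻¹ * (v k * rearr z (2 ^ k)) := by
            rw [← mul_assoc, ENNReal.inv_mul_cancel h2 h3, one_mul]
        _ ≤ _ := by gcongr
  have hxn : G.nrm x ≤ C * 8 := by
    refine (hge x).trans ?_
    gcongr
    refine marcinkiewiczStar_nrm_le_of_dyadic hpos hconc fun k hk => ?_
    have := hx k
    rwa [ha, indicator_of_mem hk] at this
  have hxG : x ∈ G.carrier := hcar x (ne_top_of_le_ne_top
    (ENNReal.mul_ne_top ENNReal.coe_ne_top (by simp)) hxn)
  have hym := FunctionSpace.mem_multipliers_of_le (G := G) (F := F) (y := y)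
    (C := 8 * S * 2 * F.nrm z) fun w hw => by
      have hwfin := hG.nrm_ne_top w hw
      -- `y^*` is controlled by `u` and `w^*` by `‖w‖ / φ`.
      have hkey : ∀ k ∈ I.indices, rearr (y * w) (2 ^ (k + (3 : ℕ))) ≤
          (G.nrm w).toNNReal * (u k * (v k)⁻¹) := fun k hk => by
        rw [ENNReal.coe_toNNReal hwfin]
        have h1 : rearr w (2 ^ (k + 1)) ≤ G.nrm w * (v k)⁻¹ :=
          (antitone_rearr w (zpow_le_zpow_right₀ one_le_two (by omega))).trans
            ((rearr_le_of_marcinkiewiczStar hpos w hk).trans (mul_le_mul_left (hle w) _))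
        have h2 := rearr_mul_le (hufin k) (ENNReal.mul_ne_top hwfin
          (ENNReal.inv_ne_top.2 (dyadicValue_ne_zero hpos hk))) (hy k) h1
        rw [add_assoc] at h2
        refine h2.trans (le_of_eq ?_)
        ring
      have h3 : F.outerNorm (dyadicStep fun k =>
          ((G.nrm w).toNNReal : ℝ≥0∞) * (u k * (v k)⁻¹)) ≤
          G.nrm w * (S * (2 * F.nrm z)) := by
        refine (hF.outerNorm_const_mul _ (dyadicStep fun k => u k * (v k)⁻¹)).trans ?_
        rw [ENNReal.coe_toNNReal hwfin]
        gcongr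
      have h4 := hF.nrm_le_of_dyadic_rearr 3 hkey (ne_top_of_le_ne_top
        (ENNReal.mul_ne_top hwfin (ENNReal.mul_ne_top hS
          (ENNReal.mul_ne_top (by simp) (hF.nrm_lt_top z hz).ne))) h3)
      refine ⟨h4.1, h4.2.trans ?_⟩
      calc (2 : ℝ≥0∞) ^ 3 * _ ≤ 2 ^ 3 * (G.nrm w * (S * (2 * F.nrm z))) := by gcongr
        _ = _ := by ring
  refine ⟨x, hxG, y, hym.1, hxy, ?_⟩
  calc G.nrm x * (G.multipliers F).nrm y ≤ C * 8 * (8 * S * 2 * F.nrm z) := by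
        gcongr
        exact hym.2
    _ = _ := by
        push_cast
        rw [ENNReal.coe_toNNReal (ENNReal.mul_ne_top (ENNReal.mul_ne_top (by simp) hS) (by simp))]
        ring

end Marcinkiewicz

/-! ### Factorization of summable sequences through the dyadic unit ball -/

/-- The nonnegative dyadic sequences whose step functions have norm at most `1` in `E`. -/
def FunctionSpace.dyadicBall (E : FunctionSpace I) : Set (ℤ → ℝ≥0∞) :=
  {a | E.outerNorm (dyadicStep a) ≤ 1}

namespace IsSymmetricSpace

open FunctionSpace

variable {E : FunctionSpace I}

/-- The Fatou property of `E` in terms of `[0, ∞]`-valued functions. -/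
theorem outerNorm_iSup_le (hE : IsSymmetricSpace E) (hFatou : HasFatouProperty E)
    {f : ℕ → ℝ → ℝ≥0∞} (hf : ∀ n, Measurable (f n)) (hmono : ∀ t, Monotone fun n => f n t)
    (hfin : ∀ᵐ t ∂I.measure, ⨆ n, f n t ≠ ∞) {R : ℝ≥0} (hR : ∀ n, E.outerNorm (f n) ≤ R) :
    E.outerNorm (fun t => ⨆ n, f n t) ≤ R := by
  have hfn : ∀ n, ∀ᵐ t ∂I.measure, f n t ≠ ∞ := fun n => by
    filter_upwards [hfin] with t ht using ne_top_of_le_ne_top ht (le_iSup (fun n => f n t) n)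
  have hm : Measurable fun t => ⨆ n, f n t := Measurable.iSup hf
  set u : ℕ → L0 I := fun n => toL0 I (f n) (hf n)
  set x : L0 I := toL0 I (fun t => ⨆ n, f n t) hm
  have hun : ∀ n, ∀ᵐ t ∂I.measure, ‖u n t‖ₑ ≤ f n t := fun n => by
    filter_upwards [enorm_toL0 (hf n) (hfn n)] with t ht using ht.le
  have huE : ∀ n, u n ∈ E.carrier := fun n => hE.mem_of_outerNorm_ne_top
    (ne_top_of_le_ne_top ENNReal.coe_ne_top ((outerNorm_mono (hun n)).trans (hR n)))
  have hule : ∀ n, E.nrm (u n) ≤ R := fun n => (hE.nrm_le_outerNorm _ (hun n)).trans (hR n)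
  have h := hFatou u x huE ?_ ((iSup_le hule).trans_lt ENNReal.coe_lt_top)
  · refine le_trans (outerNorm_le h.1 ?_) (le_of_tendsto' h.2.2 hule)
    filter_upwards [enorm_toL0 hm hfin] with t ht using ht.ge
  · have hu : ∀ᵐ t ∂I.measure, ∀ n, u n t = (f n t).toReal :=
      ae_all_iff.2 fun n => AEEqFun.coeFn_mk _ _
    have hx : ∀ᵐ t ∂I.measure, x t = (⨆ n, f n t).toReal := AEEqFun.coeFn_mk _ _
    filter_upwards [hu, hx, hfin, ae_all_iff.2 hfn] with t h1 h2 h3 h4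
    simp only [h1, h2]
    refine ⟨ENNReal.toReal_nonneg, fun m n hmn => ENNReal.toReal_mono (h4 n) (hmono t hmn), ?_⟩
    exact (ENNReal.tendsto_toReal h3).comp (tendsto_atTop_iSup (hmono t))

theorem ne_top_of_mem_dyadicBall {a : ℤ → ℝ≥0∞} (ha : a ∈ E.dyadicBall) {k : ℤ}
    (hk : k ∈ I.indices) : a k ≠ ∞ :=
  forall_of_ae_dyadicIndex (p := fun k => a k ≠ ∞)
    (ae_ne_top_of_outerNorm (ne_top_of_le_ne_top ENNReal.one_ne_top ha)) hk

/-- The coordinates are bounded on the dyadic ball. -/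
theorem exists_le_of_mem_dyadicBall (hE : IsSymmetricSpace E) {k : ℤ} (hk : k ∈ I.indices) :
    ∃ M : ℝ≥0∞, M ≠ ∞ ∧ ∀ a ∈ E.dyadicBall, a k ≤ M := by
  set δ := E.outerNorm (dyadicStep (Pi.single k 1))
  have hδ0 : δ ≠ 0 := fun h => by
    have := hE.eq_zero_of_outerNorm_eq_zero h hk
    simp at this
  refine ⟨δ⁻¹, ENNReal.inv_ne_top.2 hδ0, fun a ha => ?_⟩
  rcases eq_or_ne (a k) 0 with h0 | h0
  · simp [h0]
  · have hfin := ne_top_of_mem_dyadicBall ha hk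
    have hc := ENNReal.coe_toNNReal (ENNReal.inv_ne_top.2 h0)
    have h1 := hE.outerNorm_const_mul (a k)⁻¹.toNNReal (dyadicStep a)
    rw [hc] at h1
    have h2 : δ ≤ (a k)⁻¹ := by
      calc δ ≤ _ := outerNorm_mono (ae_of_all _ fun t => ?_)
        _ ≤ _ := h1
        _ ≤ (a k)⁻¹ * 1 := mul_le_mul' le_rfl ha
        _ = _ := mul_one _
      unfold dyadicStep
      by_cases h : dyadicIndex t = k
      · rw [h, Pi.single_eq_same, ENNReal.inv_mul_cancel h0 hfin]
      · rw [Pi.single_eq_of_ne h]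
        exact bot_le
    exact ENNReal.le_inv_iff_le_inv.1 h2

/-- The ball is closed in the compact space of all sequences with values in `[0, ∞]`. -/
theorem isCompact_dyadicBall (hE : IsSymmetricSpace E) (hFatou : HasFatouProperty E) :
    IsCompact E.dyadicBall := by
  refine IsClosed.isCompact (IsSeqClosed.isClosed fun a b ha hab => ?_)
  have hlim : ∀ k, Tendsto (fun n => a n k) atTop (𝓝 (b k)) := tendsto_pi_nhds.1 hab
  -- The limit is the increasing limit of `⨅ m ≥ n, a m`, to which the Fatou property applies.
  have hb : ∀ k, ⨆ n, ⨅ m ≥ n, a m k = b k := fun k => by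
    rw [← liminf_eq_iSup_iInf_of_nat]
    exact (hlim k).liminf_eq
  have h := hE.outerNorm_iSup_le hFatou (f := fun n => dyadicStep fun k => ⨅ m ≥ n, a m k)
    (R := 1) (fun n => measurable_dyadicStep _)
    (fun t m n hmn => le_iInf₂ fun i hi => iInf₂_le i (hmn.trans hi)) ?_ fun n => ?_
  · change E.outerNorm (dyadicStep b) ≤ 1
    refine (le_of_eq ?_).trans h
    congr 1
    ext t
    exact (hb _).symm
  · filter_upwards [I.ae_mem] with t ht
    have hk := I.dyadicIndex_mem ht
    obtain ⟨M, hM, hle⟩ := hE.exists_le_of_mem_dyadicBall hk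
    unfold dyadicStep
    rw [hb]
    exact ne_top_of_le_ne_top hM (le_of_tendsto' (hlim _) fun n => hle _ (ha n))
  · exact (outerNorm_mono (ae_of_all _ fun t => iInf₂_le n le_rfl)).trans (ha n)

theorem exists_mem_dyadicBall_ne_zero (hE : IsSymmetricSpace E) (k : ℤ) :
    ∃ w ∈ E.dyadicBall, ∀ j ≤ k, w j ≠ 0 := by
  obtain ⟨x, hx, hx0⟩ := hE.exists_ne_zero
  obtain ⟨t, ht, hxt⟩ : ∃ t ∈ I.set, rearr x t ≠ 0 := by
    by_contra! h
    exact hx0 (eq_zero_of_rearr h)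
  -- Shift `x^*` so far to the right that it is not zero at `2 ^ k`.
  set n : ℕ := (k + 1 - dyadicIndex t).toNat
  set b : ℤ → ℝ≥0∞ := fun j => rearr x (2 ^ (j - n + 1))
  have hfin : E.outerNorm (dyadicStep b) ≠ ∞ := by
    refine ne_top_of_le_ne_top ?_
      (hE.outerNorm_shift_nat_le (fun j => rearr x (2 ^ (j + 1))) n)
    exact ENNReal.mul_ne_top (by simp)
      (ne_top_of_le_ne_top (hE.nrm_lt_top x hx).ne (hE.outerNorm_dyadic_rearr_le hx))
  set c : ℝ≥0 := ((E.outerNorm (dyadicStep b)).toNNReal + 1)⁻¹ with hc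
  have hc0 : c ≠ 0 := by positivity
  refine ⟨fun j => c * b j, ?_, fun j hj => mul_ne_zero (by simpa using hc0) fun h0 => hxt ?_⟩
  · refine (hE.outerNorm_const_mul c (dyadicStep b)).trans ?_
    rw [← ENNReal.coe_toNNReal hfin, ← ENNReal.coe_mul, ENNReal.coe_le_one_iff, hc]
    exact inv_mul_le_one_of_le₀ (by simp) bot_le
  · refine le_antisymm (le_trans (antitone_rearr x ?_) h0.le) bot_le
    refine (zpow_le_zpow_right₀ one_le_two ?_).trans (zpow_dyadicIndex_le (I.pos_of_mem ht))
    omega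

theorem convex_mem_dyadicBall (hE : IsSymmetricSpace E) {a w : ℤ → ℝ≥0∞}
    (ha : a ∈ E.dyadicBall) (hw : w ∈ E.dyadicBall) {s r : ℝ≥0} (hsr : s + r = 1) :
    (fun k => s * a k + r * w k) ∈ E.dyadicBall := by
  refine (hE.outerNorm_add_le (fun t => s * dyadicStep a t) (fun t => r * dyadicStep w t)).trans ?_
  calc _ ≤ (s : ℝ≥0∞) * 1 + r * 1 := add_le_add
        ((hE.outerNorm_const_mul s _).trans (mul_le_mul' le_rfl ha))
        ((hE.outerNorm_const_mul r _).trans (mul_le_mul' le_rfl hw))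
    _ = 1 := by
        rw [mul_one, mul_one]
        exact_mod_cast hsr

end IsSymmetricSpace

/-- The first order condition at a maximum of `∑ c k log (a k)` on a convex set. -/
theorem sum_mul_div_le_of_log_le {ι : Type*} (K : Finset ι) {c a w : ι → ℝ}
    (ha : ∀ k ∈ K, 0 < a k) (hw : ∀ k ∈ K, 0 ≤ w k) (hc : ∀ k ∈ K, 0 ≤ c k)
    (h : ∀ ε ∈ Ioo (0 : ℝ) 1, ∑ k ∈ K, c k * Real.log ((1 - ε) * a k + ε * w k) ≤
      ∑ k ∈ K, c k * Real.log (a k)) :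
    ∑ k ∈ K, c k / a k * w k ≤ ∑ k ∈ K, c k := by
  set r : ι → ℝ := fun k => w k / a k with hr
  have h1 : ∀ ε ∈ Ioo (0 : ℝ) 1,
      ∑ k ∈ K, c k * ((r k - 1) / (1 + ε * (r k - 1))) ≤ 0 := by
    intro ε hε
    have h2 : ε * ∑ k ∈ K, c k * ((r k - 1) / (1 + ε * (r k - 1))) ≤
        ∑ k ∈ K, c k * Real.log ((1 - ε) * a k + ε * w k) - ∑ k ∈ K, c k * Real.log (a k) := by
      rw [Finset.mul_sum, ← Finset.sum_sub_distrib]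
      refine Finset.sum_le_sum fun k hk => ?_
      have hak := ha k hk
      have hb : 0 < 1 + ε * (r k - 1) := by
        have : 0 ≤ r k := div_nonneg (hw k hk) hak.le
        nlinarith [hε.1, hε.2]
      have h3 : (1 - ε) * a k + ε * w k = a k * (1 + ε * (r k - 1)) := by
        rw [hr]
        field_simp
        ring
      rw [h3, Real.log_mul hak.ne' hb.ne']
      -- `log y ≥ 1 - 1 / y` gives a lower bound of the difference quotient at `ε`; then `ε → 0`.
      have h4 := Real.one_sub_inv_le_log_of_pos hb
      have h5 : ε * ((r k - 1) / (1 + ε * (r k - 1))) = 1 - (1 + ε * (r k - 1))⁻¹ := by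
        field_simp
        ring
      calc ε * (c k * ((r k - 1) / (1 + ε * (r k - 1))))
          = c k * (ε * ((r k - 1) / (1 + ε * (r k - 1)))) := by ring
        _ ≤ c k * Real.log (1 + ε * (r k - 1)) := by
            rw [h5]
            exact mul_le_mul_of_nonneg_left h4 (hc k hk)
        _ = _ := by ring
    have h3 := h ε hε
    have h4 : ε * ∑ k ∈ K, c k * ((r k - 1) / (1 + ε * (r k - 1))) ≤ 0 := by linarith
    exact nonpos_of_mul_nonpos_right h4 hε.1
  have hlim : Tendsto (fun ε : ℝ => ∑ k ∈ K, c k * ((r k - 1) / (1 + ε * (r k - 1))))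
      (𝓝[>] 0) (𝓝 (∑ k ∈ K, c k * (r k - 1))) := by
    refine tendsto_finsetSum K fun k _ => ?_
    have h2 : ContinuousAt (fun ε : ℝ => c k * ((r k - 1) / (1 + ε * (r k - 1)))) 0 := by
      refine ContinuousAt.mul continuousAt_const (ContinuousAt.div continuousAt_const ?_ (by simp))
      fun_prop
    have h3 := h2.tendsto.mono_left (nhdsWithin_le_nhds (s := Ioi 0))
    simpa using h3
  have h2 : ∑ k ∈ K, c k * (r k - 1) ≤ 0 := by
    refine le_of_tendsto hlim ?_
    filter_upwards [Ioo_mem_nhdsGT (zero_lt_one (α := ℝ))] with ε hε using h1 ε hε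
  have h3 : ∑ k ∈ K, c k * (r k - 1) = ∑ k ∈ K, c k / a k * w k - ∑ k ∈ K, c k := by
    rw [← Finset.sum_sub_distrib]
    refine Finset.sum_congr rfl fun k _ => ?_
    rw [hr]
    ring
  linarith

namespace IsSymmetricSpace

open FunctionSpace

variable {E : FunctionSpace I}

/-- Lozanovskii's factorization for finitely many indices: a maximizer `a` of `∏ a k ^ c k` over
the ball is such that the functional with the coefficients `c k / a k` is bounded on the ball. -/
theorem exists_factor_finset (hE : IsSymmetricSpace E) (hFatou : HasFatouProperty E)
    {c : ℤ → ℝ≥0∞} (K : Finset ℤ) (hK : ∀ k ∈ K, k ∈ I.indices)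
    (hc : ∀ k ∈ K, c k ≠ 0 ∧ c k ≠ ∞) :
    ∃ a ∈ E.dyadicBall, (∀ k ∈ K, a k ≠ 0) ∧
      ∀ w ∈ E.dyadicBall, ∑ k ∈ K, c k / a k * w k ≤ ∑ k ∈ K, c k := by
  obtain ⟨b, hb⟩ := K.exists_le
  obtain ⟨w₀, hw₀, hw₀pos⟩ := hE.exists_mem_dyadicBall_ne_zero b
  set f : (ℤ → ℝ≥0∞) → ℝ := fun a => ∏ k ∈ K, (a k).toReal ^ (c k).toReal with hf
  have hcont : ContinuousOn f E.dyadicBall := by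
    refine continuousOn_finsetProd K fun k hk => ?_
    refine ContinuousOn.rpow_const ?_ fun _ _ => Or.inr ENNReal.toReal_nonneg
    exact ENNReal.continuousOn_toReal.comp (continuous_apply k).continuousOn
      fun a ha => ne_top_of_mem_dyadicBall ha (hK k hk)
  obtain ⟨a, ha, hmax⟩ := (hE.isCompact_dyadicBall hFatou).exists_isMaxOn ⟨w₀, hw₀⟩ hcont
  have hreal : ∀ w ∈ E.dyadicBall, ∀ k ∈ K, w k ≠ 0 → 0 < (w k).toReal := fun w hw k hk h0 =>
    ENNReal.toReal_pos h0 (ne_top_of_mem_dyadicBall hw (hK k hk))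
  -- The ball contains a sequence without zeros on `K`, so the maximum is positive.
  have hfpos : 0 < f a := lt_of_lt_of_le (Finset.prod_pos fun k hk =>
    Real.rpow_pos_of_pos (hreal w₀ hw₀ k hk (hw₀pos k (hb k hk))) _) (hmax hw₀)
  have ha0 : ∀ k ∈ K, a k ≠ 0 := fun k hk h0 => by
    refine hfpos.ne' (Finset.prod_eq_zero hk ?_)
    rw [h0, ENNReal.toReal_zero, Real.zero_rpow]
    exact (ENNReal.toReal_pos (hc k hk).1 (hc k hk).2).ne'
  refine ⟨a, ha, ha0, fun w hw => ?_⟩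
  have key := sum_mul_div_le_of_log_le K (c := fun k => (c k).toReal) (a := fun k => (a k).toReal)
    (w := fun k => (w k).toReal) (fun k hk => hreal a ha k hk (ha0 k hk))
    (fun _ _ => ENNReal.toReal_nonneg) (fun _ _ => ENNReal.toReal_nonneg) fun ε hε => by
      have h1ε : 0 ≤ 1 - ε := by linarith [hε.2]
      have hsum : (1 - ε).toNNReal + ε.toNNReal = 1 := by
        rw [← Real.toNNReal_add h1ε hε.1.le]
        simp
      have hmem := hE.convex_mem_dyadicBall ha hw hsum
      have h2 := hmax hmem
      have hval : ∀ k ∈ K, (((1 - ε).toNNReal : ℝ≥0∞) * a k + ε.toNNReal * w k).toReal =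
          (1 - ε) * (a k).toReal + ε * (w k).toReal := fun k hk => by
        rw [ENNReal.toReal_add (ENNReal.mul_ne_top ENNReal.coe_ne_top
            (ne_top_of_mem_dyadicBall ha (hK k hk))) (ENNReal.mul_ne_top ENNReal.coe_ne_top
            (ne_top_of_mem_dyadicBall hw (hK k hk))), ENNReal.toReal_mul, ENNReal.toReal_mul,
          ENNReal.coe_toReal, ENNReal.coe_toReal, Real.coe_toNNReal _ h1ε,
          Real.coe_toNNReal _ hε.1.le]
      have hpos : ∀ k ∈ K, 0 < (1 - ε) * (a k).toReal + ε * (w k).toReal := fun k hk => by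
        have := hreal a ha k hk (ha0 k hk)
        have h3 : 0 ≤ ε * (w k).toReal := mul_nonneg hε.1.le ENNReal.toReal_nonneg
        have h4 : 0 < (1 - ε) * (a k).toReal := mul_pos (by linarith [hε.2]) this
        linarith
      have h3 : ∏ k ∈ K, ((1 - ε) * (a k).toReal + ε * (w k).toReal) ^ (c k).toReal ≤ f a := by
        refine le_trans (le_of_eq (Finset.prod_congr rfl fun k hk => ?_)) h2
        rw [hval k hk]
      have h4 := Real.log_le_log (Finset.prod_pos fun k hk =>
        Real.rpow_pos_of_pos (hpos k hk) _) h3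
      rw [Real.log_prod fun k hk => (Real.rpow_pos_of_pos (hpos k hk) _).ne', hf,
        Real.log_prod fun k hk => (Real.rpow_pos_of_pos (hreal a ha k hk (ha0 k hk)) _).ne'] at h4
      rw [Finset.sum_congr rfl fun k hk => Real.log_rpow (hpos k hk) _,
        Finset.sum_congr rfl fun k hk => Real.log_rpow (hreal a ha k hk (ha0 k hk)) _] at h4
      exact h4
  have hterm : ∀ k ∈ K, c k / a k * w k ≠ ∞ := fun k hk =>
    ENNReal.mul_ne_top (ENNReal.div_ne_top (hc k hk).2 (ha0 k hk))
      (ne_top_of_mem_dyadicBall hw (hK k hk))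
  refine (ENNReal.toReal_le_toReal (ENNReal.sum_ne_top.2 hterm)
    (ENNReal.sum_ne_top.2 fun k hk => (hc k hk).2)).1 ?_
  rw [ENNReal.toReal_sum hterm, ENNReal.toReal_sum fun k hk => (hc k hk).2]
  refine le_trans (le_of_eq (Finset.sum_congr rfl fun k _ => ?_)) key
  rw [ENNReal.toReal_mul, ENNReal.toReal_div]

/-- Lozanovskii's factorization `ℓ¹ = E ⊙ E'` for the dyadic sequences of a symmetric space with
the Fatou property, obtained from finite sets of indices by compactness of the ball. -/
theorem exists_factor (hE : IsSymmetricSpace E) (hFatou : HasFatouProperty E)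
    {c : ℤ → ℝ≥0∞} (hcI : ∀ k ∉ I.indices, c k = 0) (hsum : ∑' k, c k ≠ ∞) :
    ∃ a ∈ E.dyadicBall, (∀ k, c k ≠ 0 → a k ≠ 0) ∧
      ∀ w ∈ E.dyadicBall, ∑' k, c k / a k * w k ≤ ∑' k, c k := by
  classical
  have hcfin : ∀ k, c k ≠ ∞ := fun k => ne_top_of_le_ne_top hsum (ENNReal.le_tsum k)
  have hmemI : ∀ k, c k ≠ 0 → k ∈ I.indices := fun k hk => by
    by_contra h
    exact hk (hcI k h)
  set K : ℕ → Finset ℤ := fun n => (Finset.Icc (-(n : ℤ)) n).filter fun k => c k ≠ 0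
  have hKmem : ∀ k, c k ≠ 0 → ∀ᶠ n in atTop, k ∈ K n := fun k hk => by
    filter_upwards [eventually_ge_atTop k.natAbs] with n hn
    simp only [K, Finset.mem_filter, Finset.mem_Icc]
    exact ⟨by omega, hk⟩
  have hK : ∀ n, ∀ k ∈ K n, c k ≠ 0 := fun n k hk => (Finset.mem_filter.1 hk).2
  have hex := fun n => hE.exists_factor_finset hFatou (c := c) (K n)
    (fun k hk => hmemI k (hK n k hk)) fun k hk => ⟨hK n k hk, hcfin k⟩
  choose a haB ha0 ha using hex
  obtain ⟨b, hb, ψ, hψ, hlim⟩ := (hE.isCompact_dyadicBall hFatou).tendsto_subseq haB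
  have hlimk : ∀ k, Tendsto (fun n => a (ψ n) k) atTop (𝓝 (b k)) := tendsto_pi_nhds.1 hlim
  have hbound : ∀ w ∈ E.dyadicBall, ∀ s : Finset ℤ, (∀ k ∈ s, c k ≠ 0) →
      ∀ᶠ n in atTop, ∑ k ∈ s, c k / a (ψ n) k * w k ≤ ∑' k, c k := fun w hw s hs => by
    have h1 : ∀ᶠ n in atTop, ∀ k ∈ s, k ∈ K (ψ n) :=
      (Finset.eventually_all s).2 fun k hk => hψ.tendsto_atTop.eventually (hKmem k (hs k hk))
    filter_upwards [h1] with n hn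
    calc _ ≤ ∑ k ∈ K (ψ n), c k / a (ψ n) k * w k :=
          Finset.sum_le_sum_of_subset (fun k hk => hn k hk)
      _ ≤ ∑ k ∈ K (ψ n), c k := ha (ψ n) w hw
      _ ≤ _ := ENNReal.sum_le_tsum _
  have hlims : ∀ w ∈ E.dyadicBall, ∀ s : Finset ℤ, (∀ k ∈ s, c k ≠ 0) →
      ∑ k ∈ s, c k / b k * w k ≤ ∑' k, c k := fun w hw s hs => by
    refine le_of_tendsto (tendsto_finsetSum s fun k hk => ?_) (hbound w hw s hs)
    exact ENNReal.Tendsto.mul_const (ENNReal.Tendsto.const_div (hlimk k) (Or.inr (hcfin k)))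
      (Or.inr (ne_top_of_mem_dyadicBall hw (hmemI k (hs k hk))))
  refine ⟨b, hb, fun k hk h0 => ?_, fun w hw => ?_⟩
  -- If `b k = 0`, the term `c k / b k * w k` would be infinite for a `w` with `w k ≠ 0`.
  · obtain ⟨w, hw, hwk⟩ := hE.exists_mem_dyadicBall_ne_zero k
    have h1 := hlims w hw {k} fun j hj => by rwa [Finset.mem_singleton.1 hj]
    rw [Finset.sum_singleton, h0, ENNReal.div_zero hk, ENNReal.top_mul (hwk k le_rfl)] at h1
    exact hsum (top_le_iff.1 h1)
  · rw [ENNReal.tsum_eq_iSup_sum]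
    refine iSup_le fun s => ?_
    rw [← Finset.sum_filter_of_ne (p := fun k => c k ≠ 0)]
    · exact hlims w hw _ fun k hk => (Finset.mem_filter.1 hk).2
    · intro k _ h h0
      rw [h0, ENNReal.zero_div, zero_mul] at h
      exact h rfl

end IsSymmetricSpace

/-! ### Lorentz spaces -/

section Lorentz

variable {φ : ℝ → ℝ}

theorem zpow_ofReal_ne (k : ℤ) : ENNReal.ofReal ((2 : ℝ) ^ k) ≠ 0 := by
  rw [Ne, ENNReal.ofReal_eq_zero, not_le]
  positivity

/-- A lower bound for a weighted integral of a rearrangement by a dyadic sum, given lower bounds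
for the weight on the dyadic intervals. -/
theorem tsum_dyadicRearr_le_lintegral (x : L0 I) {g : ℝ → ℝ≥0∞} {d : ℤ → ℝ≥0∞}
    (h : ∀ᵐ t ∂I.measure, d (dyadicIndex t) ≤ ENNReal.ofReal (2 ^ dyadicIndex t) * g t) :
    ∑' k, dyadicRearr x (k + 1) * d k ≤ ∫⁻ t, rearr x t * g t ∂I.measure := by
  calc ∑' k, dyadicRearr x (k + 1) * d k
      ≤ ∑' k, dyadicRearr x (k + 1) * (d k / ENNReal.ofReal (2 ^ k)) *
          I.measure {t | dyadicIndex t = k} := by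
        refine ENNReal.tsum_le_tsum fun k => ?_
        by_cases hk : k ∈ I.indices
        · rw [I.measure_dyadicIndex hk, mul_assoc,
            ENNReal.div_mul_cancel (zpow_ofReal_ne k) ENNReal.ofReal_ne_top]
        · rw [dyadicRearr_of_not_mem fun h => hk (I.mem_indices_of_le (by omega) h), zero_mul]
          exact bot_le
    _ = ∫⁻ t, dyadicStep
          (fun k => dyadicRearr x (k + 1) * (d k / ENNReal.ofReal (2 ^ k))) t ∂I.measure :=
        (lintegral_dyadicStep _).symm
    _ ≤ _ := by
        refine lintegral_mono_ae ?_
        filter_upwards [h, I.ae_mem] with t ht htI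
        refine mul_le_mul' ?_ (ENNReal.div_le_of_le_mul' ht)
        by_cases hk : dyadicIndex t + 1 ∈ I.indices
        · rw [dyadicRearr_of_mem hk]
          exact antitone_rearr x (lt_zpow_dyadicIndex (I.pos_of_mem htI)).le
        · rw [dyadicRearr_of_not_mem hk]
          exact bot_le

theorem lorentzOne_nrm_le (hpos : ∀ t ∈ I.set, 0 < φ t) (hconc : ConcaveOn ℝ I.set φ)
    (x : L0 I) :
    (lorentzOne I φ).nrm x ≤ 4 * ∑' k, dyadicRearr x k * dyadicValue φ k := by
  calc ∫⁻ t, rearr x t * ENNReal.ofReal (φ t / t) ∂I.measure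
      ≤ ∫⁻ t, dyadicStep (fun k => 4 * (dyadicRearr x k * dyadicValue φ k) /
          ENNReal.ofReal (2 ^ k)) t ∂I.measure := by
        refine lintegral_mono_ae ?_
        filter_upwards [I.ae_mem] with t ht
        have ht0 := I.pos_of_mem ht
        have h1 := ofReal_le_dyadicValue hpos hconc ht 0
        simp only [Nat.cast_zero, sub_zero] at h1
        have h2 : ENNReal.ofReal (2 ^ dyadicIndex t) ≤ ENNReal.ofReal t :=
          ENNReal.ofReal_le_ofReal (zpow_dyadicIndex_le ht0)
        simp only [dyadicStep]
        rw [dyadicRearr_of_mem (I.dyadicIndex_mem ht), ENNReal.ofReal_div_of_pos ht0]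
        calc rearr x t * (ENNReal.ofReal (φ t) / ENNReal.ofReal t)
            ≤ rearr x (2 ^ dyadicIndex t) * (2 ^ (0 + 2) * dyadicValue φ (dyadicIndex t) /
                ENNReal.ofReal (2 ^ dyadicIndex t)) := by
              gcongr
              exact antitone_rearr x (zpow_dyadicIndex_le ht0)
          _ = _ := by
              rw [← mul_div_assoc]
              congr 1
              norm_num
              ring
    _ = ∑' k, 4 * (dyadicRearr x k * dyadicValue φ k) /
          ENNReal.ofReal (2 ^ k) * I.measure {t | dyadicIndex t = k} := lintegral_dyadicStep _
    _ ≤ ∑' k, 4 * (dyadicRearr x k * dyadicValue φ k) := by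
        refine ENNReal.tsum_le_tsum fun k => ?_
        by_cases hk : k ∈ I.indices
        · rw [I.measure_dyadicIndex hk,
            ENNReal.div_mul_cancel (zpow_ofReal_ne k) ENNReal.ofReal_ne_top]
        · rw [I.measure_dyadicIndex_of_not_mem hk, mul_zero]
          exact bot_le
    _ = _ := ENNReal.tsum_mul_left

theorem dyadicIndex_zpow (k : ℤ) : dyadicIndex ((2 : ℝ) ^ k) = k :=
  dyadicIndex_eq le_rfl (zpow_lt_zpow_right₀ one_lt_two (by omega))

theorem dyadicValue_le (hpos : ∀ t ∈ I.set, 0 < φ t) (hconc : ConcaveOn ℝ I.set φ) {k : ℤ}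
    (hk : k ∈ I.indices) (n : ℕ) :
    dyadicValue φ k ≤ 2 ^ (n + 2) * dyadicValue φ (k - n) := by
  have := ofReal_le_dyadicValue hpos hconc (t := 2 ^ k) hk n
  rwa [dyadicIndex_zpow] at this

theorem tsum_le_lorentzOne_nrm (hpos : ∀ t ∈ I.set, 0 < φ t) (hmono : MonotoneOn φ I.set)
    (hconc : ConcaveOn ℝ I.set φ) (x : L0 I) :
    ∑' k, dyadicRearr x k * dyadicValue φ k ≤ 16 * (lorentzOne I φ).nrm x := by
  have h1 := tsum_dyadicRearr_le_lintegral x (g := fun t => ENNReal.ofReal (φ t / t))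
    (d := fun k => dyadicValue φ k / 2) <| by
      filter_upwards [I.ae_mem] with t ht
      have ht0 := I.pos_of_mem ht
      have hle := zpow_dyadicIndex_le ht0
      have hlt := lt_zpow_dyadicIndex ht0
      have hp : (0 : ℝ) < 2 ^ dyadicIndex t := by positivity
      rw [dyadicValue, ← ENNReal.ofReal_ofNat, ← ENNReal.ofReal_div_of_pos two_pos,
        ← ENNReal.ofReal_mul hp.le]
      refine ENNReal.ofReal_le_ofReal ?_
      have h2 := hmono (I.dyadicIndex_mem ht) ht hle
      have h3 := (hpos t ht).le
      rw [zpow_add_one₀ two_ne_zero] at hlt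
      rw [← mul_div_assoc, div_le_div_iff₀ two_pos ht0]
      calc φ (2 ^ dyadicIndex t) * t ≤ φ t * (2 ^ dyadicIndex t * 2) := by gcongr
        _ = _ := by ring
  rw [← (Equiv.addRight (1 : ℤ)).tsum_eq]
  simp only [Equiv.coe_addRight]
  calc ∑' k, dyadicRearr x (k + 1) * dyadicValue φ (k + 1)
      ≤ ∑' k, 16 * (dyadicRearr x (k + 1) * (dyadicValue φ k / 2)) := by
        refine ENNReal.tsum_le_tsum fun k => ?_
        by_cases hk : k + 1 ∈ I.indices
        · have h2 := dyadicValue_le hpos hconc hk 1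
          rw [Nat.cast_one, add_sub_cancel_right] at h2
          calc _ ≤ dyadicRearr x (k + 1) * (2 ^ (1 + 2) * dyadicValue φ k) := by gcongr
            _ = dyadicRearr x (k + 1) * (8 * (2 * (dyadicValue φ k / 2))) := by
                rw [ENNReal.mul_div_cancel (by simp) (by simp)]
                norm_num
            _ = _ := by ring
        · rw [dyadicRearr_of_not_mem hk, zero_mul]
          exact bot_le
    _ = 16 * ∑' k, dyadicRearr x (k + 1) * (dyadicValue φ k / 2) := ENNReal.tsum_mul_left
    _ ≤ _ := by
        gcongr
        exact h1

theorem isOpen_set (I : BaseInterval) : IsOpen I.set := by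
  cases I
  · exact isOpen_Ioo
  · exact isOpen_Ioi

theorem ae_differentiableAt (hmono : MonotoneOn φ I.set) :
    ∀ᵐ t ∂I.measure, DifferentiableAt ℝ φ t := by
  filter_upwards [hmono.ae_differentiableWithinAt I.measurableSet_set, I.ae_mem] with t h ht
  exact h.differentiableAt ((isOpen_set I).mem_nhds ht)

theorem deriv_le_two_mul_div (hpos : ∀ t ∈ I.set, 0 < φ t) (hconc : ConcaveOn ℝ I.set φ)
    {t : ℝ} (ht : t ∈ I.set) : deriv φ t ≤ 2 * (φ t / t) := by
  have ht0 := I.pos_of_mem ht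
  by_cases hd : DifferentiableAt ℝ φ t
  · have hs : t / 2 ∈ I.set := I.mem_of_le (by positivity) (by linarith) ht
    have h := hconc.le_slope_of_hasDerivAt hs ht (by linarith) hd.hasDerivAt
    rw [slope_def_field] at h
    refine h.trans ?_
    have h1 := hpos _ hs
    have h2 : (0 : ℝ) < t - t / 2 := by linarith
    rw [div_le_iff₀ h2]
    have h3 : 2 * (φ t / t) * (t - t / 2) = φ t := by
      field_simp
      ring
    rw [h3]
    linarith
  · rw [deriv_zero_of_not_differentiableAt hd]
    have := hpos t ht
    positivity

/-- If the lower index is positive, `φ` is at least halved by some dyadic dilation. -/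
theorem exists_dyadicValue_sub_le_half (hpos : ∀ t ∈ I.set, 0 < φ t)
    (hmono : MonotoneOn φ I.set) (hconc : ConcaveOn ℝ I.set φ) (hp : 0 < lowerIndex I φ) :
    ∃ N : ℕ, ∀ k ∈ I.indices, dyadicValue φ (k - N) ≤ dyadicValue φ k / 2 := by
  obtain ⟨p, hp0, hp1⟩ := exists_between hp
  obtain ⟨C, hC⟩ := exists_dyadicValue_sub_le hpos hmono hconc hp1
  have hr : ((2 : ℝ) ^ (-p)).toNNReal < 1 := by
    rw [Real.toNNReal_lt_one]
    exact Real.rpow_lt_one_of_one_lt_of_neg one_lt_two (by linarith)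
  have hlim := (tendsto_pow_atTop_nhds_zero_of_lt_one bot_le hr).const_mul C
  rw [mul_zero] at hlim
  obtain ⟨N, hN⟩ := (hlim.eventually (gt_mem_nhds (by norm_num : (0 : ℝ≥0) < 2⁻¹))).exists
  refine ⟨N, fun k hk => (hC N k hk).trans ?_⟩
  rw [div_eq_mul_inv, mul_comm (dyadicValue φ k)]
  gcongr
  calc _ ≤ ((2⁻¹ : ℝ≥0) : ℝ≥0∞) := ENNReal.coe_le_coe.2 hN.le
    _ = _ := by simp

theorem iInf_ofReal_eq_zero (hpos : ∀ t ∈ I.set, 0 < φ t)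
    (hmono : MonotoneOn φ I.set) (hconc : ConcaveOn ℝ I.set φ) (hp : 0 < lowerIndex I φ) :
    ⨅ t ∈ I.set, ENNReal.ofReal (φ t) = 0 := by
  obtain ⟨N, hN⟩ := exists_dyadicValue_sub_le_half hpos hmono hconc hp
  set m := ⨅ t ∈ I.set, ENNReal.ofReal (φ t)
  have hle : ∀ k ∈ I.indices, m ≤ dyadicValue φ k := fun k hk => iInf₂_le (2 ^ k : ℝ) hk
  have h2 : m ≤ m / 2 := by
    rw [ENNReal.le_div_iff_mul_le (Or.inl (by simp)) (Or.inl (by simp))]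
    refine le_iInf₂ fun t ht => ?_
    have hk := I.dyadicIndex_mem ht
    have h3 := (hle _ (I.mem_indices_of_le (by omega) hk)).trans (hN _ hk)
    rw [ENNReal.le_div_iff_mul_le (Or.inl (by simp)) (Or.inl (by simp))] at h3
    exact h3.trans (ENNReal.ofReal_le_ofReal
      (hmono hk ht (zpow_dyadicIndex_le (I.pos_of_mem ht))))
  have hmfin : m ≠ ∞ := ne_top_of_le_ne_top (dyadicValue_ne_top φ _) (hle _ I.neg_one_mem_indices)
  by_contra h0
  exact absurd (ENNReal.half_lt_self h0 hmfin) (not_lt.2 h2)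

theorem lorentz_eq (hpos : ∀ t ∈ I.set, 0 < φ t) (hmono : MonotoneOn φ I.set)
    (hconc : ConcaveOn ℝ I.set φ) (hp : 0 < lowerIndex I φ) :
    lorentz I φ = .ofENorm fun x =>
      ∫⁻ t in I.set, rearr x t * ENNReal.ofReal (deriv φ t) := by
  unfold lorentz
  simp only [iInf_ofReal_eq_zero hpos hmono hconc hp, zero_mul, zero_add]

theorem isHomogeneous_lorentz (hpos : ∀ t ∈ I.set, 0 < φ t) (hmono : MonotoneOn φ I.set)
    (hconc : ConcaveOn ℝ I.set φ) (hp : 0 < lowerIndex I φ) : (lorentz I φ).IsHomogeneous := by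
  rw [lorentz_eq hpos hmono hconc hp]
  refine FunctionSpace.isHomogeneous_ofENorm ?_ fun c x hc => ?_
  · rw [setLIntegral_congr_fun (g := fun _ => 0) I.measurableSet_set fun t ht => by
      rw [rearr_zero (I.pos_of_mem ht), zero_mul]]
    simp
  · simp_rw [rearr_smul hc, mul_assoc]
    exact lintegral_const_mul' _ _ ENNReal.ofReal_ne_top

theorem lorentz_nrm_le (hpos : ∀ t ∈ I.set, 0 < φ t) (hmono : MonotoneOn φ I.set)
    (hconc : ConcaveOn ℝ I.set φ) (hp : 0 < lowerIndex I φ) (x : L0 I) :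
    (lorentz I φ).nrm x ≤ 2 * (lorentzOne I φ).nrm x := by
  rw [lorentz_eq hpos hmono hconc hp]
  change _ ≤ 2 * ∫⁻ t in I.set, rearr x t * ENNReal.ofReal (φ t / t)
  rw [← lintegral_const_mul' _ _ (by simp)]
  refine setLIntegral_mono' I.measurableSet_set fun t ht => ?_
  have h := ENNReal.ofReal_le_ofReal (deriv_le_two_mul_div hpos hconc ht)
  rw [ENNReal.ofReal_mul zero_le_two, ENNReal.ofReal_ofNat] at h
  calc _ ≤ rearr x t * (2 * ENNReal.ofReal (φ t / t)) := by gcongr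
    _ = _ := by ring

/-- The increments of `φ` along dyadic points are bounded by its derivative to the left. -/
theorem ae_increment_le_deriv (hmono : MonotoneOn φ I.set) (hconc : ConcaveOn ℝ I.set φ) :
    ∀ᵐ t ∂I.measure, dyadicIndex t + 2 ∈ I.indices →
      (dyadicValue φ (dyadicIndex t + 2) - dyadicValue φ (dyadicIndex t + 1)) / 2 ≤
        ENNReal.ofReal (2 ^ dyadicIndex t) * ENNReal.ofReal (deriv φ t) := by
  filter_upwards [I.ae_mem, ae_differentiableAt hmono] with t ht hd hk
  have hlt := lt_zpow_dyadicIndex (I.pos_of_mem ht)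
  set k := dyadicIndex t
  have hk1 : (2 : ℝ) ^ (k + 1) ∈ I.set := I.mem_indices_of_le (by omega) hk
  have hk2 : (2 : ℝ) ^ (k + 2) ∈ I.set := hk
  have hp : (0 : ℝ) < 2 ^ k := by positivity
  have e1 : (2 : ℝ) ^ (k + 1) = 2 ^ k * 2 := zpow_add_one₀ two_ne_zero k
  have e2 : (2 : ℝ) ^ (k + 2) = 2 ^ k * 4 := by
    rw [zpow_add₀ two_ne_zero]
    norm_num
  have hlt2 : (2 : ℝ) ^ (k + 1) < 2 ^ (k + 2) := zpow_lt_zpow_right₀ one_lt_two (by omega)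
  have h1 := hconc.slope_le_of_hasDerivAt ht hk1 hlt hd.hasDerivAt
  have h2 := hconc.slope_anti_adjacent ht hk2 hlt hlt2
  rw [slope_def_field] at h1
  have h3 := h2.trans h1
  have e3 : (2 : ℝ) ^ (k + 2) - 2 ^ (k + 1) = 2 ^ k * 2 := by rw [e1, e2]; ring
  rw [e3, div_le_iff₀ (by positivity)] at h3
  rw [dyadicValue, dyadicValue, ← ENNReal.ofReal_mul hp.le]
  refine ENNReal.div_le_of_le_mul (tsub_le_iff_right.2 ?_)
  have h4 : (2 : ℝ≥0∞) = ENNReal.ofReal 2 := by simp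
  rw [h4, ← ENNReal.ofReal_mul' zero_le_two]
  refine le_trans (ENNReal.ofReal_le_ofReal ?_) ENNReal.ofReal_add_le
  linarith

/-- For a positive lower index the norm of `Λ_{φ,1}` is bounded by the norm of `Λ_φ`. -/
theorem exists_lorentzOne_nrm_le (hpos : ∀ t ∈ I.set, 0 < φ t) (hmono : MonotoneOn φ I.set)
    (hconc : ConcaveOn ℝ I.set φ) (hp : 0 < lowerIndex I φ) :
    ∃ C : ℝ≥0, ∀ x : L0 I, (lorentzOne I φ).nrm x ≤ C * (lorentz I φ).nrm x := by
  classical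
  obtain ⟨N, hN⟩ := exists_dyadicValue_sub_le_half hpos hmono hconc hp
  refine ⟨4 * (2 * (N * 2)), fun x => (lorentzOne_nrm_le hpos hconc x).trans ?_⟩
  set v := dyadicValue φ
  -- The increments of `φ` along the dyadic points.
  set δ : ℤ → ℝ≥0∞ := fun k => if k + 1 ∈ I.indices then v (k + 1) - v k else 0 with hδ
  have hδ1 : ∑' k, dyadicRearr x k * δ k ≤ 2 * (lorentz I φ).nrm x := by
    have h1 := tsum_dyadicRearr_le_lintegral x (g := fun t => ENNReal.ofReal (deriv φ t))
      (d := fun k => δ (k + 1) / 2) <| by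
        filter_upwards [ae_increment_le_deriv hmono hconc] with t ht
        by_cases hk : dyadicIndex t + 2 ∈ I.indices
        · have e : dyadicIndex t + 1 + 1 = dyadicIndex t + 2 := by ring
          simp only [hδ, e, if_pos hk]
          exact ht hk
        · have e : dyadicIndex t + 1 + 1 = dyadicIndex t + 2 := by ring
          simp only [hδ, e, if_neg hk, ENNReal.zero_div]
          exact bot_le
    rw [lorentz_eq hpos hmono hconc hp, ← (Equiv.addRight (1 : ℤ)).tsum_eq]
    simp only [Equiv.coe_addRight]
    calc ∑' k, dyadicRearr x (k + 1) * δ (k + 1)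
        = ∑' k, 2 * (dyadicRearr x (k + 1) * (δ (k + 1) / 2)) := by
          refine tsum_congr fun k => ?_
          rw [mul_left_comm, ENNReal.mul_div_cancel (by simp) (by simp)]
      _ = 2 * ∑' k, dyadicRearr x (k + 1) * (δ (k + 1) / 2) := ENNReal.tsum_mul_left
      _ ≤ _ := by
          gcongr
          exact h1
  have htel : ∀ k ∈ I.indices, ∀ n : ℕ,
      v k ≤ v (k - n) + ∑ i ∈ Finset.range n, δ (k - (i + 1 : ℕ)) := fun k hk n => by
    induction n with
    | zero => simp
    | succ n ih =>
      refine ih.trans ?_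
      have e : k - ((n + 1 : ℕ) : ℤ) + 1 = k - n := by push_cast; ring
      have h1 : v (k - n) ≤ v (k - (n + 1 : ℕ)) + δ (k - (n + 1 : ℕ)) := by
        simp only [hδ, e]
        rw [if_pos (I.mem_indices_of_le (by omega) hk)]
        exact le_add_tsub
      rw [Finset.sum_range_succ]
      calc _ ≤ v (k - (n + 1 : ℕ)) + δ (k - (n + 1 : ℕ)) +
            ∑ i ∈ Finset.range n, δ (k - (i + 1 : ℕ)) := by gcongr
        _ = _ := by ring
  -- As `φ (2 ^ (k - N)) ≤ φ (2 ^ k) / 2`, half of `φ (2 ^ k)` is at most a sum of `N` increments.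
  have hvle : ∀ k ∈ I.indices, v k ≤ 2 * ∑ i ∈ Finset.range N, δ (k - (i + 1 : ℕ)) :=
    fun k hk => by
      have h1 := (htel k hk N).trans (add_le_add_left (hN k hk) _)
      nth_rewrite 1 [← ENNReal.add_halves (v k)] at h1
      have h2 := (ENNReal.add_le_add_iff_left
        (ENNReal.div_ne_top (dyadicValue_ne_top φ k) two_ne_zero)).1 h1
      calc v k = 2 * (v k / 2) := (ENNReal.mul_div_cancel (by simp) (by simp)).symm
        _ ≤ _ := by gcongr
  have hsum : ∑' k, dyadicRearr x k * v k ≤ 2 * (N * (2 * (lorentz I φ).nrm x)) := by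
    calc ∑' k, dyadicRearr x k * v k
        ≤ ∑' k, 2 * ∑ i ∈ Finset.range N,
            dyadicRearr x (k - (i + 1 : ℕ)) * δ (k - (i + 1 : ℕ)) := by
          refine ENNReal.tsum_le_tsum fun k => ?_
          by_cases hk : k ∈ I.indices
          · calc _ ≤ dyadicRearr x k * (2 * ∑ i ∈ Finset.range N, δ (k - (i + 1 : ℕ))) := by
                  gcongr
                  exact hvle k hk
              _ = 2 * ∑ i ∈ Finset.range N, dyadicRearr x k * δ (k - (i + 1 : ℕ)) := by
                  rw [Finset.mul_sum, Finset.mul_sum, Finset.mul_sum]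
                  exact Finset.sum_congr rfl fun i _ => by ring
              _ ≤ _ := by
                  gcongr with i
                  exact antitone_dyadicRearr x (by omega)
          · rw [dyadicRearr_of_not_mem hk, zero_mul]
            exact bot_le
      _ = 2 * ∑ i ∈ Finset.range N, ∑' k,
            dyadicRearr x (k - (i + 1 : ℕ)) * δ (k - (i + 1 : ℕ)) := by
          rw [ENNReal.tsum_mul_left, Summable.tsum_finsetSum fun _ _ => ENNReal.summable]
      _ = 2 * ∑ i ∈ Finset.range N, ∑' k, dyadicRearr x k * δ k := by
          congr 1
          refine Finset.sum_congr rfl fun i _ => ?_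
          exact (Equiv.subRight ((i + 1 : ℕ) : ℤ)).tsum_eq fun k => dyadicRearr x k * δ k
      _ ≤ _ := by
          rw [Finset.sum_const, Finset.card_range, nsmul_eq_mul]
          gcongr
  calc 4 * ∑' k, dyadicRearr x k * v k ≤ 4 * (2 * (N * (2 * (lorentz I φ).nrm x))) := by gcongr
    _ = _ := by
        push_cast
        ring

end Lorentz

/-! ### Factorization of Lorentz spaces -/

namespace IsSymmetricSpace

open FunctionSpace

variable {E : FunctionSpace I} {φ : ℝ → ℝ}

/-- A functional bounded by `T` on the ball is bounded by `T` times the norm. If the norm of `w` is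
zero, `w` vanishes on the indices of the base interval. -/
theorem tsum_mul_le_outerNorm_mul (hE : IsSymmetricSpace E) {b : ℤ → ℝ≥0∞} {T : ℝ≥0∞}
    (hb : ∀ k ∉ I.indices, b k = 0)
    (h : ∀ w ∈ E.dyadicBall, ∑' k, b k * w k ≤ T) {w : ℤ → ℝ≥0∞}
    (hw : E.outerNorm (dyadicStep w) ≠ ∞) :
    ∑' k, b k * w k ≤ E.outerNorm (dyadicStep w) * T := by
  set R := E.outerNorm (dyadicStep w) with hR
  rcases eq_or_ne R 0 with h0 | h0
  · rw [ENNReal.tsum_eq_zero.2 fun k => ?_]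
    · exact bot_le
    · by_cases hk : k ∈ I.indices
      · rw [hE.eq_zero_of_outerNorm_eq_zero h0 hk, mul_zero]
      · rw [hb k hk, zero_mul]
  · have hc := ENNReal.coe_toNNReal (ENNReal.inv_ne_top.2 h0)
    have h1 : (fun k => R⁻¹ * w k) ∈ E.dyadicBall := by
      have h2 := hE.outerNorm_const_mul R⁻¹.toNNReal (dyadicStep w)
      rw [hc, ← hR, ENNReal.inv_mul_cancel h0 hw] at h2
      exact h2
    have h2 : ∑' k, R⁻¹ * (b k * w k) ≤ T :=
      (tsum_congr fun k => mul_left_comm _ _ _).trans_le (h _ h1)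
    rw [ENNReal.tsum_mul_left, mul_comm, ← div_eq_mul_inv] at h2
    rw [mul_comm]
    exact (ENNReal.div_le_iff h0 hw).1 h2

/-- The least decreasing majorant of `b / φ`, tested against `φ w`, costs only the sum of the
dilation norms. -/
theorem tsum_decreasingMajorant_mul_le (hE : IsSymmetricSpace E) {v b : ℤ → ℝ≥0∞} {T : ℝ≥0∞}
    (hv : ∀ k ∈ I.indices, v k ≠ 0 ∧ v k ≠ ∞) {c : ℕ → ℝ≥0}
    (hc : ∀ (i : ℕ) (k : ℤ), k ∈ I.indices → v (k - i) ≤ c i * v k)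
    (hb : ∀ k ∉ I.indices, b k = 0)
    (h : ∀ w ∈ E.dyadicBall, ∑' k, b k * w k ≤ T) {w : ℤ → ℝ≥0∞}
    (hw : E.outerNorm (dyadicStep w) ≠ ∞) :
    ∑' k, decreasingMajorant I (fun k => b k * (v k)⁻¹) k * v k * w k ≤
      (∑' i, (c i : ℝ≥0∞) * dilationNorm E (2 ^ i)) * (E.outerNorm (dyadicStep w) * T) := by
  calc ∑' k, decreasingMajorant I (fun k => b k * (v k)⁻¹) k * v k * w k
      ≤ ∑' k, ∑' i : ℕ, c i * (b (k + i) * w k) := by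
        refine ENNReal.tsum_le_tsum fun k => ?_
        rw [mul_assoc]
        refine (mul_le_mul_left (decreasingMajorant_le_tsum _ k) _).trans ?_
        rw [← ENNReal.tsum_mul_right]
        refine ENNReal.tsum_le_tsum fun i => ?_
        by_cases hk : k + i ∈ I.indices
        · rw [shiftLeft_of_mem hk]
          have h1 := hc i (k + i) hk
          rw [add_sub_cancel_right] at h1
          calc b (k + i) * (v (k + i))⁻¹ * (v k * w k)
              ≤ b (k + i) * (v (k + i))⁻¹ * (c i * v (k + i) * w k) := by gcongr
            _ = c i * (b (k + i) * w k) * (v (k + i) * (v (k + i))⁻¹) := by ring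
            _ ≤ _ := by rw [ENNReal.mul_inv_cancel (hv _ hk).1 (hv _ hk).2, mul_one]
        · rw [shiftLeft_of_not_mem hk, zero_mul]
          exact bot_le
    _ = ∑' i : ℕ, c i * ∑' k, b k * w (k - i) := by
        rw [ENNReal.tsum_comm]
        refine tsum_congr fun i => ?_
        rw [ENNReal.tsum_mul_left]
        congr 1
        have h1 := (Equiv.addRight (i : ℤ)).tsum_eq fun k => b k * w (k - i)
        simp only [Equiv.coe_addRight, add_sub_cancel_right] at h1
        exact h1
    _ ≤ _ := by
        rw [← ENNReal.tsum_mul_right]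
        refine ENNReal.tsum_le_tsum fun i => ?_
        have h1 := hE.outerNorm_shiftRight_le w i
        have h2 := hE.tsum_mul_le_outerNorm_mul hb h (ne_top_of_le_ne_top
          (ENNReal.mul_ne_top (hE.dilationNorm_ne_top (by positivity)) hw) h1)
        calc _ ≤ (c i : ℝ≥0∞) * (dilationNorm E (2 ^ i) * E.outerNorm (dyadicStep w) * T) := by
              gcongr
              exact h2.trans (mul_le_mul_left h1 T)
          _ = _ := by ring

end IsSymmetricSpace

/-- A function in `Λ_{φ,1}` has a rearrangement vanishing at infinity. -/
theorem distr_ne_top_of_tsum {φ : ℝ → ℝ} (hpos : ∀ t ∈ I.set, 0 < φ t) (hmono : MonotoneOn φ I.set)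
    {z : L0 I} (hz : ∑' k, dyadicRearr z k * dyadicValue φ k ≠ ∞) (l : ℝ≥0) (hl : 0 < l) :
    distr z l ≠ ∞ := by
  intro htop
  have hI : ∀ k : ℤ, k ∈ I.indices := fun k => by
    by_contra hk
    have h1 := (distr_le_univ z l).trans (I.measure_univ_le_of_not_mem hk)
    rw [htop] at h1
    exact absurd h1 (by simp)
  have h1 : ∑' n : ℕ, dyadicRearr z n * dyadicValue φ n ≠ ∞ :=
    ne_top_of_le_ne_top hz (ENNReal.tsum_comp_le_tsum_of_injective Nat.cast_injective _)
  have h2 := ENNReal.tendsto_atTop_zero_of_tsum_ne_top h1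
  have h3 : ∀ n : ℕ, (l : ℝ≥0∞) * dyadicValue φ 0 ≤ dyadicRearr z n * dyadicValue φ n :=
    fun n => mul_le_mul' (by
      rw [dyadicRearr_of_mem (hI _)]
      exact le_rearr_of_le_distr (htop ▸ le_top)) (dyadicValue_mono hmono (by omega) (hI _))
  have h4 := ge_of_tendsto' h2 h3
  exact mul_ne_zero (by simpa using hl.ne') (dyadicValue_ne_zero hpos (hI 0))
    (le_antisymm h4 bot_le)

/-- The factorization of `Λ_{φ,1}` through a symmetric space `E` with the Fatou property. The
factors are modelled on decreasing majorants of the two factors of the sequence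
`z^*(2 ^ k) φ(2 ^ k)` given by Lozanovskii's factorization. -/
theorem lorentzOne_same_prod_multipliers {φ : ℝ → ℝ} {E : FunctionSpace I} (hE : IsSymmetricSpace E)
    (hFatou : HasFatouProperty E) (hpos : ∀ t ∈ I.set, 0 < φ t) (hmono : MonotoneOn φ I.set)
    (hconc : ConcaveOn ℝ I.set φ) (hp : 0 < lowerIndex I φ) (hα : 0 < lowerBoydIndex E)
    (hβ : upperBoydIndex E < lowerIndex I φ) :
    (lorentzOne I φ).Same (E.prod (E.multipliers (lorentz I φ))) := by
  obtain ⟨A, hA⟩ := exists_lorentzOne_nrm_le hpos hmono hconc hp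
  obtain ⟨c, hc, hS2⟩ := hE.exists_summable_of_lt_lowerIndex hpos hmono hconc hβ
  have hS1 := hE.tsum_dilationNorm_inv_ne_top hα
  set S1 := ∑' i : ℕ, dilationNorm E (2 ^ i)⁻¹
  set S2 := ∑' i : ℕ, (c i : ℝ≥0∞) * dilationNorm E (2 ^ i)
  refine FunctionSpace.same_prod_multipliers (A := A)
    (B := 2 * S1.toNNReal * (2 * 4 * 32 * S2.toNNReal * 16)) hE.isHomogeneous
    (isHomogeneous_lorentz hpos hmono hconc hp) (fun x hx => (hE.nrm_eq_zero x hx).1)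
    (fun x hx => ⟨(hA x).trans_lt (ENNReal.mul_lt_top ENNReal.coe_lt_top hx), hA x⟩)
    fun z hz => ?_
  set v := dyadicValue φ
  have hv0 : ∀ k ∈ I.indices, v k ≠ 0 ∧ v k ≠ ∞ := fun k hk =>
    ⟨dyadicValue_ne_zero hpos hk, dyadicValue_ne_top φ k⟩
  -- The summable sequence `z^*(2 ^ k) φ(2 ^ k)` to be factored; outside the indices it is zero.
  set d : ℤ → ℝ≥0∞ := fun k => dyadicRearr z k * v k with hd
  set T := ∑' k, d k
  have hTle : T ≤ 16 * (lorentzOne I φ).nrm z := tsum_le_lorentzOne_nrm hpos hmono hconc z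
  have hTfin : T ≠ ∞ := ne_top_of_le_ne_top (ENNReal.mul_ne_top (by simp) (ne_of_lt hz)) hTle
  have hdI : ∀ k ∉ I.indices, d k = 0 := fun k hk => by
    simp only [hd, dyadicRearr_of_not_mem hk, zero_mul]
  obtain ⟨a, ha, ha0, hab⟩ := hE.exists_factor hFatou hdI hTfin
  have hbI : ∀ k ∉ I.indices, d k / a k = 0 := fun k hk => by rw [hdI k hk, ENNReal.zero_div]
  set u := decreasingMajorant I fun k => d k / a k * (v k)⁻¹ with hu
  have hkey : ∀ w : ℤ → ℝ≥0∞, E.outerNorm (dyadicStep w) ≠ ∞ →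
      ∑' k, u k * v k * w k ≤ S2 * (E.outerNorm (dyadicStep w) * T) := fun w hw =>
    hE.tsum_decreasingMajorant_mul_le hv0 hc hbI hab hw
  have hufin : ∀ k, u k ≠ ∞ := fun k => by
    by_cases hk : k ∈ I.indices
    -- Testing `u` against a `w` in the ball with `w k ≠ 0` shows that `u k` is finite.
    · obtain ⟨w, hw, hwk⟩ := hE.exists_mem_dyadicBall_ne_zero k
      have hwfin : E.outerNorm (dyadicStep w) ≠ ∞ := ne_top_of_le_ne_top ENNReal.one_ne_top hw
      have h1 := ne_top_of_le_ne_top (ENNReal.mul_ne_top hS2 (ENNReal.mul_ne_top hwfin hTfin))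
        (hkey w hwfin)
      have h2 := ENNReal.ne_top_of_tsum_ne_top h1 k
      intro h
      rw [h, ENNReal.top_mul (hv0 k hk).1, ENNReal.top_mul (hwk k le_rfl)] at h2
      exact h2 rfl
    · rw [hu, decreasingMajorant_of_not_mem _ hk]
      exact ENNReal.zero_ne_top
  obtain ⟨x, y, hxy, hx, hy⟩ := exists_factorization
    (distr_ne_top_of_tsum hpos hmono hTfin) (antitone_decreasingMajorant (I := I) a)
    (antitone_decreasingMajorant _) hufin fun k hk => by
      rcases eq_or_ne (d k) 0 with h0 | h0
      · rcases mul_eq_zero.1 h0 with h1 | h1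
        · rw [dyadicRearr_of_mem hk] at h1
          rw [h1]
          exact bot_le
        · exact absurd h1 (hv0 k hk).1
      · have h1 : a k * (d k / a k) = d k := ENNReal.mul_div_cancel (ha0 k h0)
          (IsSymmetricSpace.ne_top_of_mem_dyadicBall ha hk)
        calc rearr z (2 ^ k) = d k * (v k)⁻¹ := by
              simp only [hd]
              rw [mul_assoc, ENNReal.mul_inv_cancel (hv0 k hk).1 (hv0 k hk).2, mul_one,
                dyadicRearr_of_mem hk]
          _ = a k * (d k / a k * (v k)⁻¹) := by rw [← mul_assoc, h1]
          _ ≤ _ := mul_le_mul' (le_decreasingMajorant a hk)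
            (le_decreasingMajorant (fun k => d k / a k * (v k)⁻¹) hk)
  have haN : E.outerNorm (dyadicStep (decreasingMajorant I a)) ≤ S1 := by
    have h1 := hE.outerNorm_decreasingMajorant_le (a := a) (b := a) (fun _ => 1) (c := fun _ => 1)
      fun i k _ => by simp
    simp only [mul_one, ENNReal.coe_one, one_mul] at h1
    exact h1.trans (mul_le_of_le_one_right bot_le ha)
  have hxE := hE.nrm_le_of_dyadic_rearr (x := x) 1 (fun k _ => by simpa using hx k)
    (ne_top_of_le_ne_top hS1 haN)
  have hyM := FunctionSpace.mem_multipliers_of_le (G := E) (F := lorentz I φ) (y := y)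
    (C := 2 * 4 * 32 * S2 * T) fun w hw => by
      have hwN := hE.outerNorm_dyadic_rearr_le hw
      have hwfin : E.nrm w ≠ ∞ := (hE.nrm_lt_top w hw).ne
      obtain ⟨l, hl⟩ := hE.exists_distr_ne_top hw
      -- The shift by `3` comes from `(y w)^*(2 ^ (j + 3)) ≤ y^*(2 ^ (j + 1)) w^*(2 ^ (j + 1))`
      -- and costs the factor `32` by concavity of `φ`.
      have h1 : ∀ k, dyadicRearr (y * w) k * v k ≤
          32 * (u (k - 3) * v (k - 3) * rearr w (2 ^ (k - 3 + 1))) := fun k => by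
        by_cases hk : k ∈ I.indices
        · have h2 := rearr_mul_le (hufin (k - 3)) (rearr_ne_top hl (by positivity))
            (hy (k - 3)) (le_refl (rearr w (2 ^ (k - 3 + 1))))
          have e : k - 3 + 1 + 2 = k := by ring
          rw [e] at h2
          have h3 := dyadicValue_le hpos hconc hk 3
          rw [dyadicRearr_of_mem hk]
          calc _ ≤ u (k - 3) * rearr w (2 ^ (k - 3 + 1)) * (2 ^ (3 + 2) * v (k - 3)) := by
                gcongr
                exact_mod_cast h3
            _ = _ := by ring
        · rw [dyadicRearr_of_not_mem hk, zero_mul]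
          exact bot_le
      have h2 : ∑' k, dyadicRearr (y * w) k * v k ≤ 32 * (S2 * (E.nrm w * T)) := by
        calc _ ≤ ∑' k, 32 * (u (k - 3) * v (k - 3) * rearr w (2 ^ (k - 3 + 1))) :=
              ENNReal.tsum_le_tsum h1
          _ = 32 * ∑' k, u k * v k * rearr w (2 ^ (k + 1)) := by
              rw [ENNReal.tsum_mul_left]
              congr 1
              exact (Equiv.subRight (3 : ℤ)).tsum_eq fun k => u k * v k * rearr w (2 ^ (k + 1))
          _ ≤ _ := by
              gcongr
              refine (hkey _ (ne_top_of_le_ne_top hwfin hwN)).trans ?_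
              gcongr
      have h3 : (lorentz I φ).nrm (y * w) ≤ 2 * 4 * 32 * S2 * T * E.nrm w := by
        calc _ ≤ 2 * (lorentzOne I φ).nrm (y * w) := lorentz_nrm_le hpos hmono hconc hp _
          _ ≤ 2 * (4 * (32 * (S2 * (E.nrm w * T)))) := by
              gcongr
              exact (lorentzOne_nrm_le hpos hconc _).trans (mul_le_mul' le_rfl h2)
          _ = _ := by ring
      refine ⟨h3.trans_lt (lt_top_iff_ne_top.2 ?_), h3⟩
      exact ENNReal.mul_ne_top (ENNReal.mul_ne_top (ENNReal.mul_ne_top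
        (ENNReal.mul_ne_top (ENNReal.mul_ne_top (by simp) (by simp)) (by simp)) hS2) hTfin) hwfin
  refine ⟨x, hxE.1, y, hyM.1, hxy, ?_⟩
  calc E.nrm x * (E.multipliers (lorentz I φ)).nrm y
      ≤ 2 ^ 1 * S1 * (2 * 4 * 32 * S2 * (16 * (lorentzOne I φ).nrm z)) := by
        refine mul_le_mul' (hxE.2.trans ?_) (hyM.2.trans ?_) <;> gcongr
    _ = _ := by
        push_cast
        rw [ENNReal.coe_toNNReal hS1, ENNReal.coe_toNNReal hS2]
        ring

end

theorem theorem11 (I : BaseInterval) (φ : ℝ → ℝ)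
    (hpos : ∀ t ∈ I.set, 0 < φ t) (hmono : MonotoneOn φ I.set) (hconc : ConcaveOn ℝ I.set φ)
    (hp : 0 < lowerIndex I φ) (hpq : lowerIndex I φ ≤ upperIndex I φ) (hq : upperIndex I φ < 1) :
    (∀ F : FunctionSpace I, IsSymmetricSpace F →
      upperIndex I φ < lowerBoydIndex F →
      ((marcinkiewiczStar I φ).multipliers F).carrier ≠ {0} →
      F.Same ((marcinkiewiczStar I φ).prod ((marcinkiewiczStar I φ).multipliers F)) ∧
        F.Same ((marcinkiewicz I φ).prod ((marcinkiewicz I φ).multipliers F))) ∧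
    (∀ E : FunctionSpace I, IsSymmetricSpace E → HasFatouProperty E →
      0 < lowerBoydIndex E → lowerBoydIndex E ≤ upperBoydIndex E →
      upperBoydIndex E < lowerIndex I φ →
      (E.multipliers (lorentz I φ)).carrier ≠ {0} →
      (lorentzOne I φ).Same (E.prod (E.multipliers (lorentz I φ)))) := by
  refine ⟨fun F hF hα _ => ?_, fun E hE hFatou hα _ hβ _ =>
    lorentzOne_same_prod_multipliers hE hFatou hpos hmono hconc hp hα hβ⟩
  have hα0 : 0 < lowerBoydIndex F := (hp.trans_le hpq).trans hα
  obtain ⟨C, hC⟩ := exists_marcinkiewicz_nrm_le hpos hmono hconc hq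
  exact ⟨same_prod_multipliers_of_equiv_marcinkiewiczStar hF hpos hmono hconc hα0 hα
      isHomogeneous_marcinkiewiczStar (fun _ => lt_top_iff_ne_top.2) (fun _ => le_rfl) (C := 1)
      fun x => by rw [ENNReal.coe_one, one_mul],
    same_prod_multipliers_of_equiv_marcinkiewiczStar hF hpos hmono hconc hα0 hα
      isHomogeneous_marcinkiewicz (fun _ => lt_top_iff_ne_top.2) marcinkiewiczStar_nrm_le hC⟩
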